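/- All graphs are finite, may have parallel edges, and have no loops; graphs are considered up to isomorphism. For a graph $G$ and $X\subseteq V(G)$ let $\partial_G(X)$ be the set of edges with exactly one end in $X$, and write $\partial_G(v)=\partial_G(\{v\})$. An $r$-regular graph $G$ is an *$r$-graph* if $|\partial_G(X)|\ge r$ for every $X\subseteq V(G)$ of odd cardinality. An *$H$-coloring* of $G$ is a map $f\colon E(G)\to E(H)$ such that $f(e_1)\neq f(e_2)$ for any two adjacent edges $e_1,e_2$ of $G$, and for every $v\in V(G)$ there is $u\in V(H)$ with $f(\partial_G(v))=\partial_H(u)$; if one exists, $H$ *colors* $G$. A set $\mathcal A$ of connected $r$-graphs is *$r$-complete* if every connected $r$-graph is colored by some element of $\mathcal A$. Let $P$ be the Petersen graph; the *Petersen Coloring Conjecture* is the assertion that $P$ colors every bridgeless cubic graph. **Theorem.** For every $r\ge 3$ there is exactly one inclusion-wise minimal $r$-complete set; denote it by $\mathcal H_r$. Then: 1. Either $\mathcal H_3=\{P\}$ or $\mathcal H_3$ is infinite; moreover, $\mathcal H_3=\{P\}$ if and only if the Petersen Coloring Conjecture holds. 2. For every $r\ge 4$, the set $\mathcal H_r$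 is infinite. -/

import Mathlib

open scoped Graph

namespace RGraphs

section Basic

variable {α β α' β' : Type}

/-- `∂_G(X)`: the set of edges having exactly one end in `X`. -/
def edgeCut (G : Graph α β) (X : Set α) : Set β :=
  {e | ∃ x y, G.IsLink e x y ∧ x ∈ X ∧ y ∉ X}

/-- `G` is `r`-regular. (For loopless graphs, which are the only ones considered below,
the degree of `v` is the number of edges incident with `v`.) -/
def IsRegular (r : ℕ) (G : Graph α β) : Prop :=
  ∀ v ∈ V(G), (G.incidenceSet v).ncard = r

/-- An `r`-graph: an `r`-regular graph in which every odd set of vertices is joined to its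
complement by at least `r` edges. -/
def IsRGraph (r : ℕ) (G : Graph α β) : Prop :=
  IsRegular r G ∧ ∀ X : Set α, X ⊆ V(G) → Odd X.ncard → r ≤ (edgeCut G X).ncard

/-- `G` is connected (in particular, it has a vertex). -/
def IsConnected (G : Graph α β) : Prop := G.toSimpleGraph.Connected

/-- Two distinct edges are adjacent if they have a common end. -/
def AdjacentEdges (G : Graph α β) (e₁ e₂ : β) : Prop :=
  e₁ ≠ e₂ ∧ ∃ v, G.Inc e₁ v ∧ G.Inc e₂ v

/-- `f : E(G) → E(H)` is an `H`-coloring of `G`: adjacent edges get different images, and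
for every vertex `v` of `G` there is a vertex `u` of `H` with `f(∂_G(v)) = ∂_H(u)`. -/
def IsColoring (H : Graph α' β') (G : Graph α β) (f : E(G) → E(H)) : Prop :=
  (∀ e₁ e₂ : E(G), AdjacentEdges G e₁ e₂ → f e₁ ≠ f e₂) ∧
  ∀ v ∈ V(G), ∃ u ∈ V(H), f '' {e : E(G) | G.Inc e v} = {e : E(H) | H.Inc e u}

/-- `H ≺ G`: the graph `H` colors the graph `G`. -/
def Colors (H : Graph α' β') (G : Graph α β) : Prop :=
  ∃ f : E(G) → E(H), IsColoring H G f

/-- Graph isomorphism: compatible bijections of the vertex sets and of the edge sets. -/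
def Isomorphic (G : Graph α β) (H : Graph α' β') : Prop :=
  ∃ (θ : V(G) ≃ V(H)) (φ : E(G) ≃ E(H)),
    ∀ (e : E(G)) (x y : V(G)), G.IsLink e x y ↔ H.IsLink (φ e) (θ x) (θ y)

/-- An edge is a bridge if its ends are not joined by a path after deleting it. -/
def IsBridge (G : Graph α β) (e : β) : Prop :=
  ∃ x y, G.IsLink e x y ∧
    ¬ Relation.ReflTransGen (fun a b => ∃ e', e' ≠ e ∧ G.IsLink e' a b) x y

/-- `G` has no bridge. -/
def IsBridgeless (G : Graph α β) : Prop := ∀ e ∈ E(G), ¬ IsBridge G e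

end Basic

/-- The graphs under consideration: finite, parallel edges allowed, no loops. -/
structure Multigraph : Type 1 where
  {Vert : Type}
  {Edge : Type}
  graph : Graph Vert Edge
  finite_vertexSet : V(graph).Finite
  finite_edgeSet : E(graph).Finite
  loopless : graph.Loopless

theorem Isomorphic.refl {α β : Type} (G : Graph α β) : Isomorphic G G :=
  ⟨Equiv.refl _, Equiv.refl _, fun _ _ _ => Iff.rfl⟩

theorem Isomorphic.symm {α β α' β' : Type} {G : Graph α β} {H : Graph α' β'}
    (h : Isomorphic G H) : Isomorphic H G := by
  obtain ⟨θ, φ, h⟩ := h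
  refine ⟨θ.symm, φ.symm, fun e x y => ?_⟩
  rw [h]
  simp

theorem Isomorphic.trans {α β α' β' α'' β'' : Type} {G : Graph α β} {H : Graph α' β'}
    {K : Graph α'' β''} (h₁ : Isomorphic G H) (h₂ : Isomorphic H K) : Isomorphic G K := by
  obtain ⟨θ₁, φ₁, h₁⟩ := h₁
  obtain ⟨θ₂, φ₂, h₂⟩ := h₂
  exact ⟨θ₁.trans θ₂, φ₁.trans φ₂, fun e x y => (h₁ e x y).trans (h₂ _ _ _)⟩

instance multigraphSetoid : Setoid Multigraph where
  r G H := Isomorphic G.graph H.graph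
  iseqv := ⟨fun G => Isomorphic.refl G.graph, Isomorphic.symm, Isomorphic.trans⟩

/-- Graphs up to isomorphism. -/
def IsoClass : Type 1 := Quotient multigraphSetoid

/-- The isomorphism class of a graph. -/
def isoClass (G : Multigraph) : IsoClass := Quotient.mk multigraphSetoid G

/-- A connected `r`-graph. -/
def IsConnectedRGraph (r : ℕ) (G : Multigraph) : Prop :=
  IsRGraph r G.graph ∧ IsConnected G.graph

/-- An `r`-complete set (of graphs up to isomorphism): all its members are connected
`r`-graphs, and every connected `r`-graph is colored by a member. -/
def IsComplete (r : ℕ) (A : Set IsoClass) : Prop :=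
  (∀ G : Multigraph, isoClass G ∈ A → IsConnectedRGraph r G) ∧
  ∀ G : Multigraph, IsConnectedRGraph r G →
    ∃ H : Multigraph, isoClass H ∈ A ∧ Colors H.graph G.graph

/-- An inclusion-wise minimal `r`-complete set. -/
def IsMinimalComplete (r : ℕ) (A : Set IsoClass) : Prop := Minimal (IsComplete r) A

/-- The Petersen graph as a simple graph: the vertices are the 2-element subsets of a
5-element set, adjacent exactly if they are disjoint. -/
def petersenSimple : SimpleGraph {s : Finset (Fin 5) // s.card = 2} where
  Adj s t := Disjoint s.1 t.1
  symm := ⟨fun _ _ h => h.symm⟩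
  loopless := ⟨fun s h => by
    have h0 : s.1 = ∅ := by simpa using h
    have h2 := s.2
    rw [h0] at h2
    simp at h2⟩

/-- The Petersen graph `P`. -/
abbrev petersen : Multigraph where
  graph := Graph.ofSimpleGraph petersenSimple
  finite_vertexSet := Set.toFinite _
  finite_edgeSet := Set.toFinite _
  loopless := Graph.loopless_iff_forall_ne_of_adj.2 fun u v h =>
    ((Graph.ofSimpleGraph_adj_iff u v).1 h).ne

/-- The Petersen Coloring Conjecture: `P` colors every bridgeless cubic graph. -/
def PetersenColoringConjecture : Prop :=
  ∀ G : Multigraph, IsRegular 3 G.graph → IsBridgeless G.graph →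
    Colors petersen.graph G.graph

end RGraphs

/-! Call a connected `r`-graph rigid if every connected `r`-graph coloring it is isomorphic to it.
Every `r`-complete set contains all rigid graphs, so once the rigid graphs form an `r`-complete set,
that set is the least one and hence the only minimal one. The theorem then reduces to statements
about rigid graphs. Write `r = k + 2` throughout.

Completeness. An `r`-edge-colorable graph is colored by any graph having a vertex of degree `r`, in
particular by the rigid graph `pet k`, the Petersen graph with each spoke of one perfect matching
replaced by `k` parallel edges. If `G` is not `r`-edge-colorable, a connected `r`-graph `H` of least
order coloring `G` is rigid (`exists_rigid`). Indeed, let `H'` color `H` with vertex map `g`. If `g`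
is onto, minimality makes it bijective and the coloring is an isomorphism. Otherwise the vertices
outside the image of `g`, all but one of them if parity requires, can be removed by splitting off
edges without losing the `r`-graph property (`IsR.exists_lift`). This contradicts minimality, or
else leaves `H` with two vertices joined by `r` parallel edges, so that `G` would be
`r`-edge-colorable.

Rigidity of `pet k`. Preimages of perfect matchings under a coloring are perfect matchings, and
those of `pet k` are few: either no rim edge is used, or one of five rim patterns is. By Tutte's
theorem an `r`-graph has a perfect matching avoiding any `r - 1` prescribed edges. Enough matchings
therefore exist to separate the colors of rim edges from one another and from those of spokes. The
vertex map is then injective, and connectedness makes it onto.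

Infinitude. Replace every edge of `G` by a copy of `pet k` minus a rim edge. In a coloring of the
new graph by a connected `H`, the two attachment edges of a gadget may receive one color; then `H`
colors `pet k`, so `H` is `pet k`, and `pet k` colors `G`. If no gadget collapses in this way, the
gadget images in `H` are disjoint or equal 10-vertex sets with two leaving edges. Turning them back
into edges gives a smaller connected `r`-graph coloring `G` (`exists_col_card_lt`). So if `pet k`
fails to color some `G`, iteration yields graphs colored only by arbitrarily large ones, and there
are infinitely many rigid graphs. For `r = 3` such a `G` exists exactly if the Petersen Coloring
Conjecture fails; for `r ≥ 4` the substituted graph of `pet k` itself is one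
(`not_pet_col_subst_pet`). -/

namespace RGraphs
open Finset
open scoped Classical

/-! ### Finite multigraphs: cuts, degree sums, colorings -/

/-- A finite loopless multigraph given by two endpoint functions. -/
structure FinGraph : Type 1 where
  V : Type
  E : Type
  [fintypeV : Fintype V]
  [fintypeE : Fintype E]
  s : E → V
  t : E → V
  ne : ∀ e, s e ≠ t e

attribute [instance] FinGraph.fintypeV FinGraph.fintypeE

namespace FinGraph

variable (G H K : FinGraph)

/-- Incidence of an edge with a vertex. -/
def Inc (e : G.E) (v : G.V) : Prop := G.s e = v ∨ G.t e = v

/-- `e` joins `x` and `y`. -/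
def Link (e : G.E) (x y : G.V) : Prop := (G.s e = x ∧ G.t e = y) ∨ (G.s e = y ∧ G.t e = x)

/-- The edges at a vertex. -/
noncomputable def star (v : G.V) : Finset G.E := univ.filter (fun e => G.Inc e v)

/-- The edges with exactly one end in `S`. -/
noncomputable def cut (S : Finset G.V) : Finset G.E :=
  univ.filter (fun e => ¬ (G.s e ∈ S ↔ G.t e ∈ S))

/-- The edges with both ends in `S`. -/
noncomputable def inside (S : Finset G.V) : Finset G.E :=
  univ.filter (fun e => G.s e ∈ S ∧ G.t e ∈ S)

/-- The property of being an `r`-graph. -/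
def IsR (r : ℕ) : Prop :=
  (∀ v, #(G.star v) = r) ∧ ∀ S : Finset G.V, Odd #S → r ≤ #(G.cut S)

/-- Connectedness in terms of cuts. -/
def Conn : Prop := Nonempty G.V ∧ ∀ S : Finset G.V, S.Nonempty → G.cut S = ∅ → S = univ

/-- `f` is an `H`-coloring of `G`. -/
def IsCol (f : G.E → H.E) : Prop :=
  ∀ v, ∃ u, Set.InjOn f (G.star v) ∧ (G.star v).image f = H.star u

/-- `G` colors `H`. -/
def Col : Prop := ∃ f, IsCol H G f

/-- Isomorphism. -/
def Iso : Prop := ∃ (θ : G.V ≃ H.V) (φ : G.E ≃ H.E),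
  ∀ e x y, G.Link e x y ↔ H.Link (φ e) (θ x) (θ y)

/-- Perfect matchings. -/
def PM (N : Finset G.E) : Prop := ∀ v, #(N ∩ G.star v) = 1

variable {G H K}

@[simp] lemma mem_star {e : G.E} {v : G.V} : e ∈ G.star v ↔ G.Inc e v := by simp [star]

@[simp] lemma mem_cut {e : G.E} {S : Finset G.V} : e ∈ G.cut S ↔ ¬ (G.s e ∈ S ↔ G.t e ∈ S) := by
  simp [cut]

lemma inc_s (e : G.E) : G.Inc e (G.s e) := Or.inl rfl
lemma inc_t (e : G.E) : G.Inc e (G.t e) := Or.inr rfl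

lemma Inc.exists_link {e : G.E} {v : G.V} (h : G.Inc e v) : ∃ w, w ≠ v ∧ G.Link e v w := by
  rcases h with h | h
  · exact ⟨G.t e, fun h' => G.ne e (h.trans h'.symm), Or.inl ⟨h, rfl⟩⟩
  · exact ⟨G.s e, fun h' => G.ne e (h'.trans h.symm), Or.inr ⟨rfl, h⟩⟩

lemma Link.symm {e : G.E} {x y : G.V} (h : G.Link e x y) : G.Link e y x := Or.symm h
lemma Link.inc_left {e : G.E} {x y : G.V} (h : G.Link e x y) : G.Inc e x := by
  rcases h with h | h
  · exact Or.inl h.1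
  · exact Or.inr h.2
lemma Link.inc_right {e : G.E} {x y : G.V} (h : G.Link e x y) : G.Inc e y := h.symm.inc_left
lemma Link.ne {e : G.E} {x y : G.V} (h : G.Link e x y) : x ≠ y := by
  have := G.ne e
  rcases h with h | h
  · rwa [h.1, h.2] at this
  · rw [h.1, h.2] at this; exact this.symm

lemma Link.mem_cut {e : G.E} {x y : G.V} (h : G.Link e x y) {S : Finset G.V} :
    e ∈ G.cut S ↔ ¬ (x ∈ S ↔ y ∈ S) := by
  rcases h with ⟨rfl, rfl⟩ | ⟨rfl, rfl⟩ <;> rw [FinGraph.mem_cut]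
  tauto

lemma Link.eq_or_eq {e : G.E} {x y z : G.V} (h : G.Link e x y) (hz : G.Inc e z) : z = x ∨ z = y := by
  rcases h with ⟨rfl, rfl⟩ | ⟨rfl, rfl⟩ <;> rcases hz with rfl | rfl <;> simp

lemma link_s_t (e : G.E) : G.Link e (G.s e) (G.t e) := Or.inl ⟨rfl, rfl⟩

lemma link_of_inc {e : G.E} {x y : G.V} (hx : G.Inc e x) (hy : G.Inc e y) (h : x ≠ y) :
    G.Link e x y := by
  rcases hx with rfl | rfl <;> rcases hy with rfl | rfl <;> first | exact absurd rfl h | skip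
  · exact link_s_t e
  · exact (link_s_t e).symm

lemma mem_cut_iff_link {e : G.E} {S : Finset G.V} :
    e ∈ G.cut S ↔ ∃ x ∈ S, ∃ y ∉ S, G.Link e x y := by
  constructor
  · intro h
    rw [mem_cut] at h
    by_cases hs : G.s e ∈ S
    · exact ⟨_, hs, _, fun ht => h ⟨fun _ => ht, fun _ => hs⟩, link_s_t e⟩
    · have ht : G.t e ∈ S := by by_contra ht; exact h ⟨fun h' => absurd h' hs, fun h' => absurd h' ht⟩
      exact ⟨_, ht, _, hs, (link_s_t e).symm⟩
  · rintro ⟨x, hx, y, hy, h⟩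
    rw [h.mem_cut]; tauto

lemma cut_singleton (v : G.V) : G.cut {v} = G.star v := by
  ext e
  have := G.ne e
  simp only [mem_cut, mem_star, mem_singleton, Inc]
  constructor
  · intro h; by_contra h'; push Not at h'; exact h (by simp [h'])
  · rintro (h | h) h'
    · exact this (h.trans (h'.1 h).symm)
    · exact this ((h'.2 h).trans h.symm)

lemma cut_univ : G.cut univ = ∅ := by ext e; simp
lemma cut_compl (S : Finset G.V) : G.cut Sᶜ = G.cut S := by
  ext e; simp only [mem_cut, mem_compl]; tauto

/-- Every edge of `N` meeting `S` is counted once or twice in the degree sum. -/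
lemma sum_star_inter (N : Finset G.E) (S : Finset G.V) :
    ∑ v ∈ S, #(N ∩ G.star v) = #(N ∩ G.cut S) + 2 * #(N ∩ G.inside S) := by
  have h1 : ∀ v, #(N ∩ G.star v) = ∑ e ∈ N, if G.Inc e v then 1 else 0 := by
    intro v
    rw [← card_filter]; congr 1; ext e; simp
  simp_rw [h1]
  rw [sum_comm]
  have h2 : #(N ∩ G.cut S) = ∑ e ∈ N, if ¬ (G.s e ∈ S ↔ G.t e ∈ S) then 1 else 0 := by
    rw [← card_filter]; congr 1; ext e; simp
  have h3 : #(N ∩ G.inside S) = ∑ e ∈ N, if (G.s e ∈ S ∧ G.t e ∈ S) then 1 else 0 := by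
    rw [← card_filter]; congr 1; ext e; simp [inside]
  rw [h2, h3, mul_sum, ← sum_add_distrib]
  refine sum_congr rfl fun e _ => ?_
  rw [← card_filter]
  have hne := G.ne e
  have h4 : S.filter (fun v => G.Inc e v) = S ∩ {G.s e, G.t e} := by
    ext v; simp [Inc, eq_comm]
  rw [h4]
  by_cases ha : G.s e ∈ S <;> by_cases hb : G.t e ∈ S
  · rw [inter_eq_right.2 (by intro x; simp; rintro (rfl | rfl) <;> assumption)]
    simp [ha, hb, card_pair hne]
  · have : S ∩ {G.s e, G.t e} = {G.s e} := by ext x; simp; constructor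
                                              · rintro ⟨h, rfl | rfl⟩
                                                · rfl
                                                · exact absurd h hb
                                              · rintro rfl; exact ⟨ha, Or.inl rfl⟩
    simp [this, ha, hb]
  · have : S ∩ {G.s e, G.t e} = {G.t e} := by ext x; simp; constructor
                                              · rintro ⟨h, rfl | rfl⟩
                                                · exact absurd h ha
                                                · rfl
                                              · rintro rfl; exact ⟨hb, Or.inr rfl⟩
    simp [this, ha, hb]
  · have : S ∩ {G.s e, G.t e} = ∅ := by ext x; simp; rintro h; constructor <;> rintro rfl <;> contradiction
    simp [this, ha, hb]

lemma sum_star (S : Finset G.V) :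
    ∑ v ∈ S, #(G.star v) = #(G.cut S) + 2 * #(G.inside S) := by
  simpa using sum_star_inter univ S

lemma IsR.card_mul {r : ℕ} (h : G.IsR r) (S : Finset G.V) :
    r * #S = #(G.cut S) + 2 * #(G.inside S) := by
  rw [← sum_star, sum_congr rfl (fun v _ => h.1 v)]; simp [mul_comm]

/-- An even `S` has an even cut by the degree sum, and an odd `S` has at least `r ≥ 2` leaving
edges. -/
lemma IsR.card_cut_ne_one {r : ℕ} (h : G.IsR r) (hr : 2 ≤ r) (S : Finset G.V) : #(G.cut S) ≠ 1 := by
  intro h1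
  have h2 := h.card_mul S
  have h3 : Odd #S := by
    by_contra h3
    rw [Nat.not_odd_iff_even] at h3
    have := h3.mul_left r
    rw [h2, h1] at this
    rw [Nat.even_iff] at this; omega
  have := h.2 S h3
  omega

lemma IsR.even_card {r : ℕ} (h : G.IsR r) (hr : 1 ≤ r) : Even (Fintype.card G.V) := by
  by_contra h1
  rw [Nat.not_even_iff_odd] at h1
  have := h.2 univ h1
  rw [cut_univ] at this
  simp at this; omega

lemma PM.parity {N : Finset G.E} (h : G.PM N) (S : Finset G.V) :
    #S = #(N ∩ G.cut S) + 2 * #(N ∩ G.inside S) := by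
  rw [← sum_star_inter, sum_congr rfl (fun v _ => h v)]; simp

lemma Col.trans (h₁ : G.Col H) (h₂ : K.Col G) : K.Col H := by
  obtain ⟨f, hf⟩ := h₁
  obtain ⟨g, hg⟩ := h₂
  refine ⟨g ∘ f, fun v => ?_⟩
  obtain ⟨u, hu, hu'⟩ := hf v
  obtain ⟨w, hw, hw'⟩ := hg u
  refine ⟨w, ?_, ?_⟩
  · refine Set.InjOn.comp hw hu ?_
    intro e he
    rw [← hu']
    exact mem_image_of_mem _ he
  · rw [← image_image, hu', hw']

lemma IsCol.exists_map {f : G.E → H.E} (hf : IsCol G H f) :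
    ∃ g : G.V → H.V, ∀ v, (G.star v).image f = H.star (g v) := by
  choose g hg using hf
  exact ⟨g, fun v => (hg v).2⟩

lemma IsCol.injOn {f : G.E → H.E} (hf : IsCol G H f) (v : G.V) : Set.InjOn f (G.star v) :=
  (hf v).choose_spec.1

/-- Each star is mapped bijectively onto a star of `H`, which meets `N` once. This is how matchings
of an unknown coloring graph give information about the colored one. -/
lemma IsCol.pm_preimage {f : G.E → H.E} (hf : IsCol G H f) {N : Finset H.E} (hN : H.PM N) :
    G.PM (univ.filter (fun e => f e ∈ N)) := by
  intro v
  obtain ⟨u, hu, hu'⟩ := hf v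
  rw [← hN u, ← hu', ← card_image_of_injOn (f := f) (s := (univ.filter (fun e => f e ∈ N)) ∩ G.star v)]
  · congr 1; ext e; simp only [mem_image, mem_inter, mem_filter, mem_univ, true_and]
    constructor
    · rintro ⟨a, ⟨h1, h2⟩, rfl⟩; exact ⟨h1, a, h2, rfl⟩
    · rintro ⟨h1, a, h2, rfl⟩; exact ⟨a, ⟨h1, h2⟩, rfl⟩
  · exact hu.mono (by intro e he; exact (mem_inter.1 he).2)

/-- Equal degrees make injectivity on stars automatic. -/
lemma isCol_of_image_eq {r : ℕ} (hG : ∀ v, #(G.star v) = r) (hH : ∀ v, #(H.star v) = r)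
    {f : G.E → H.E} {g : G.V → H.V} (h : ∀ v, (G.star v).image f = H.star (g v)) : IsCol G H f := by
  intro v
  refine ⟨g v, ?_, h v⟩
  rw [← card_image_iff, h v, hG, hH]

lemma Iso.col (h : G.Iso H) : H.Col G := by
  obtain ⟨θ, φ, h⟩ := h
  have key : ∀ e v, G.Inc e v ↔ H.Inc (φ e) (θ v) := by
    intro e v
    constructor
    · intro hi
      obtain ⟨w, -, hw⟩ := hi.exists_link
      exact ((h _ _ _).1 hw).inc_left
    · intro hi
      obtain ⟨w, -, hw⟩ := hi.exists_link
      have := (h e v (θ.symm w)).2 (by simpa using hw)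
      exact this.inc_left
  refine ⟨φ, fun v => ⟨θ v, φ.injective.injOn, ?_⟩⟩
  ext e
  simp only [mem_image, mem_star]
  constructor
  · rintro ⟨a, ha, rfl⟩; exact (key _ _).1 ha
  · intro he; exact ⟨φ.symm e, (key _ _).2 (by simpa using he), by simp⟩

lemma Iso.symm (h : G.Iso H) : H.Iso G := by
  obtain ⟨θ, φ, h⟩ := h
  refine ⟨θ.symm, φ.symm, fun e x y => ?_⟩
  rw [h]; simp

/-- A coloring whose vertex map is bijective is an isomorphism. -/
lemma IsCol.iso {f : G.E → H.E} (hf : IsCol G H f) {g : G.V → H.V}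
    (hg : ∀ v, (G.star v).image f = H.star (g v)) (hb : Function.Bijective g) : G.Iso H := by
  have hinc : ∀ e v, G.Inc e v → H.Inc (f e) (g v) := by
    intro e v he
    rw [← mem_star, ← hg]
    exact mem_image_of_mem _ (mem_star.2 he)
  have hlink : ∀ e x y, G.Link e x y → H.Link (f e) (g x) (g y) := fun e x y h =>
    link_of_inc (hinc _ _ h.inc_left) (hinc _ _ h.inc_right) (fun h' => h.ne (hb.1 h'))
  have hinc' : ∀ e v, H.Inc (f e) (g v) → G.Inc e v := by
    intro e v h
    have := (hlink _ _ _ (link_s_t e)).eq_or_eq h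
    rcases this with h | h
    · rw [hb.1 h]; exact inc_s e
    · rw [hb.1 h]; exact inc_t e
  have hfi : Function.Injective f := by
    intro e e' h
    refine hf.injOn (G.s e) (mem_star.2 (inc_s e)) ?_ h
    refine mem_star.2 (hinc' _ _ ?_)
    rw [← h]; exact hinc _ _ (inc_s e)
  have hfs : Function.Surjective f := by
    intro h
    obtain ⟨x, hx⟩ := hb.2 (H.s h)
    have : h ∈ H.star (g x) := by rw [hx]; exact mem_star.2 (inc_s h)
    rw [← hg] at this
    obtain ⟨e, -, he⟩ := mem_image.1 this
    exact ⟨e, he⟩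
  refine ⟨Equiv.ofBijective g hb, Equiv.ofBijective f ⟨hfi, hfs⟩, fun e x y => ⟨hlink e x y, ?_⟩⟩
  intro h
  simp only [Equiv.ofBijective_apply] at h
  exact link_of_inc (hinc' _ _ h.inc_left) (hinc' _ _ h.inc_right) (fun h' => h.ne (by rw [h']))

/-! ### Restriction to unions of components -/

/-- Restriction to a set of vertices. -/
noncomputable def sub (G : FinGraph) (S : Finset G.V) : FinGraph where
  V := {v // v ∈ S}
  E := {e // G.s e ∈ S ∧ G.t e ∈ S}
  s e := ⟨G.s e.1, e.2.1⟩
  t e := ⟨G.t e.1, e.2.2⟩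
  ne e h := G.ne e.1 (congrArg Subtype.val h)

/-- The inclusion of the vertices of a restriction. -/
def subV (S : Finset G.V) (v : (G.sub S).V) : G.V := Subtype.val v

/-- The inclusion of the edges of a restriction. -/
def subE (S : Finset G.V) (e : (G.sub S).E) : G.E := Subtype.val e

lemma subV_injective (S : Finset G.V) : Function.Injective (subV S) := Subtype.val_injective
lemma subE_injective (S : Finset G.V) : Function.Injective (subE S) := Subtype.val_injective
lemma subV_mem {S : Finset G.V} (v : (G.sub S).V) : subV S v ∈ S := v.2
lemma subV_s {S : Finset G.V} (e : (G.sub S).E) : subV S ((G.sub S).s e) = G.s (subE S e) := rfl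
lemma subV_t {S : Finset G.V} (e : (G.sub S).E) : subV S ((G.sub S).t e) = G.t (subE S e) := rfl
lemma exists_subV {S : Finset G.V} {v : G.V} (h : v ∈ S) : ∃ w, subV S w = v := ⟨⟨v, h⟩, rfl⟩
lemma exists_subE {S : Finset G.V} {e : G.E} (h : G.s e ∈ S ∧ G.t e ∈ S) : ∃ w, subE S w = e :=
  ⟨⟨e, h⟩, rfl⟩

lemma sub_inc {S : Finset G.V} {e : (G.sub S).E} {v : (G.sub S).V} :
    (G.sub S).Inc e v ↔ G.Inc (subE S e) (subV S v) := by
  simp only [Inc, ← subV_s, ← subV_t, (subV_injective S).eq_iff]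

lemma card_sub_V (S : Finset G.V) : Fintype.card (G.sub S).V = #S :=
  (Fintype.card_congr (Equiv.refl _)).trans (Fintype.card_coe S)

lemma mem_of_cut_eq_empty {S : Finset G.V} (hS : G.cut S = ∅) (e : G.E) :
    G.s e ∈ S ↔ G.t e ∈ S := by
  have : e ∉ G.cut S := by simp [hS]
  simpa using this

lemma mem_of_cut_eq_empty' {S : Finset G.V} (hS : G.cut S = ∅) {e : G.E} {v : G.V}
    (hv : v ∈ S) (he : G.Inc e v) : G.s e ∈ S ∧ G.t e ∈ S := by
  have h1 := mem_of_cut_eq_empty hS e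
  rcases he with h | h
  · rw [← h] at hv; exact ⟨hv, h1.1 hv⟩
  · rw [← h] at hv; exact ⟨h1.2 hv, hv⟩

lemma image_sub_star {S : Finset G.V} (hS : G.cut S = ∅) (v : (G.sub S).V) :
    ((G.sub S).star v).image (subE S) = G.star (subV S v) := by
  ext e
  simp only [mem_image, mem_star]
  constructor
  · rintro ⟨a, ha, rfl⟩; exact sub_inc.1 ha
  · intro he
    obtain ⟨a, rfl⟩ := exists_subE (mem_of_cut_eq_empty' hS (subV_mem v) he)
    exact ⟨a, sub_inc.2 he, rfl⟩

lemma image_sub_cut {S : Finset G.V} (hS : G.cut S = ∅) (T : Finset (G.sub S).V) :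
    ((G.sub S).cut T).image (subE S) = G.cut (T.image (subV S)) := by
  ext e
  simp only [mem_image, mem_cut]
  constructor
  · rintro ⟨a, ha, rfl⟩
    simpa [← subV_s, ← subV_t, (subV_injective S).eq_iff] using ha
  · intro he
    have h2 : G.s e ∈ S ∧ G.t e ∈ S := by
      by_contra h2
      have h1 := mem_of_cut_eq_empty hS e
      have hs : G.s e ∉ S := by tauto
      have ht : G.t e ∉ S := by tauto
      apply he
      constructor
      · rintro ⟨b, -, hb⟩; exact absurd (hb ▸ subV_mem b) hs
      · rintro ⟨b, -, hb⟩; exact absurd (hb ▸ subV_mem b) ht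
    obtain ⟨a, rfl⟩ := exists_subE h2
    refine ⟨a, ?_, rfl⟩
    simpa [← subV_s, ← subV_t, (subV_injective S).eq_iff] using he

lemma sub_isR {r : ℕ} (h : G.IsR r) {S : Finset G.V} (hS : G.cut S = ∅) : (G.sub S).IsR r := by
  refine ⟨fun v => ?_, fun T hT => ?_⟩
  · rw [← h.1 (subV S v), ← image_sub_star hS, card_image_of_injective _ (subE_injective S)]
  · rw [← card_image_of_injective _ (subE_injective S), image_sub_cut hS]
    apply h.2
    rwa [card_image_of_injective _ (subV_injective S)]

/-- The restriction to a union of components colors whatever `G` colors with vertex images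
inside it. -/
lemma col_sub {S : Finset G.V} (hS : G.cut S = ∅) {f : K.E → G.E} (hf : IsCol K G f)
    {g : K.V → G.V} (hg : ∀ v, (K.star v).image f = G.star (g v)) (h : ∀ v, g v ∈ S) :
    (G.sub S).Col K := by
  have h1 : ∀ e, ∃ e', subE S e' = f e := by
    intro e
    apply exists_subE
    refine mem_of_cut_eq_empty' hS (h (K.s e)) ?_
    rw [← mem_star, ← hg]
    exact mem_image_of_mem _ (mem_star.2 (inc_s e))
  choose f' hf' using h1
  refine ⟨f', fun v => ?_⟩
  obtain ⟨u, hu⟩ := exists_subV (h v)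
  refine ⟨u, ?_, ?_⟩
  · intro a ha b hb hab
    refine hf.injOn v ha hb ?_
    rw [← hf', hab, hf']
  · apply image_injective (subE_injective S)
    rw [image_sub_star hS, hu, ← hg, image_image]
    congr 1; ext e; exact hf' e

end FinGraph
end RGraphs

/-! ### Splitting off edges at an even set of vertices -/

namespace RGraphs
open Finset
open scoped Classical
namespace FinGraph
variable {G H K : FinGraph}

lemma card_cut (S : Finset G.V) :
    #(G.cut S) = ∑ e, if (G.s e ∈ S ↔ G.t e ∈ S) then 0 else 1 := by
  rw [cut, card_filter]
  exact sum_congr rfl fun e _ => by split_ifs <;> simp_all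

lemma card_cut_inter_add_union (A B : Finset G.V) :
    #(G.cut (A ∩ B)) + #(G.cut (A ∪ B)) ≤ #(G.cut A) + #(G.cut B) := by
  simp only [card_cut, ← sum_add_distrib]
  refine sum_le_sum fun e _ => ?_
  simp only [mem_inter, mem_union]
  by_cases h1 : G.s e ∈ A <;> by_cases h2 : G.s e ∈ B <;> by_cases h3 : G.t e ∈ A <;>
    by_cases h4 : G.t e ∈ B <;> simp [h1, h2, h3, h4]

/-- Posimodularity of the cut function, checked edge by edge. The gain of 2 comes from `e₀`: it
leaves both `A` and `B` but meets neither difference. -/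
lemma card_cut_sdiff_add_sdiff (A B : Finset G.V) {e₀ : G.E} {x u : G.V} (h₀ : G.Link e₀ x u)
    (hu : u ∈ A ∩ B) (hx : x ∉ A ∪ B) :
    #(G.cut (A \ B)) + #(G.cut (B \ A)) + 2 ≤ #(G.cut A) + #(G.cut B) := by
  have h : (2 : ℕ) = ∑ e : G.E, if e = e₀ then 2 else 0 := by simp
  rw [h]
  simp only [card_cut, ← sum_add_distrib]
  refine sum_le_sum fun e _ => ?_
  simp only [mem_sdiff]
  rw [mem_inter] at hu
  rw [mem_union] at hx
  by_cases he : e = e₀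
  · subst he
    rcases h₀ with ⟨rfl, rfl⟩ | ⟨rfl, rfl⟩ <;> simp_all
  · by_cases h1 : G.s e ∈ A <;> by_cases h2 : G.s e ∈ B <;> by_cases h3 : G.t e ∈ A <;>
      by_cases h4 : G.t e ∈ B <;> simp [h1, h2, h3, h4, he]

/-- The conditions on a graph outside a set `X` of vertices of an `r`-graph that survive
splitting off edges at `X`. -/
structure IsROff (G : FinGraph) (r : ℕ) (X : Finset G.V) : Prop where
  deg : ∀ v, v ∉ X → #(G.star v) = r
  le_cut : ∀ S : Finset G.V, Disjoint S X → Odd #S → r ≤ #(G.cut S)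
  even : Even #Xᶜ

lemma IsROff.parity {r : ℕ} {X : Finset G.V} (h : G.IsROff r X) {S : Finset G.V}
    (hS : Disjoint S X) : r * #S = #(G.cut S) + 2 * #(G.inside S) := by
  rw [← sum_star, sum_congr rfl (fun v hv => h.deg v (disjoint_left.1 hS hv))]; simp [mul_comm]

/-- For odd `S` the degree sum gives the cut the parity of `r`, which excludes the value `r + 1`. -/
lemma IsROff.tight_of_lt {r : ℕ} {X : Finset G.V} (h : G.IsROff r X) {S : Finset G.V}
    (hS : Disjoint S X) (ho : Odd #S) (hlt : #(G.cut S) < r + 2) : #(G.cut S) = r := by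
  have h1 := h.le_cut S hS ho
  have h2 := h.parity hS
  obtain ⟨m, hm⟩ := ho
  rw [hm, mul_add, mul_one, mul_left_comm] at h2
  omega

/-- Uncrossing of tight sets. If `A ∩ B` is odd, submodularity applies. If it is even, both
differences are odd, and posimodularity with the edge `e₀` would give `2 * r + 2 ≤ 2 * r`. -/
lemma IsROff.tight_union {r : ℕ} {X : Finset G.V} (h : G.IsROff r X) {e₀ : G.E} {x u : G.V}
    (h₀ : G.Link e₀ x u) (hx : x ∈ X) {A B : Finset G.V} (hA : Disjoint A X) (hB : Disjoint B X)
    (hAo : Odd #A) (hBo : Odd #B) (huA : u ∈ A) (huB : u ∈ B) (hAr : #(G.cut A) = r)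
    (hBr : #(G.cut B) = r) : Odd #(A ∪ B) ∧ #(G.cut (A ∪ B)) = r := by
  have hU : Disjoint (A ∪ B) X := disjoint_union_left.2 ⟨hA, hB⟩
  have hI : Disjoint (A ∩ B) X := disjoint_of_subset_left inter_subset_left hA
  have hc := card_union_add_card_inter A B
  by_cases ho : Odd #(A ∩ B)
  · have hUo : Odd #(A ∪ B) := by
      rw [Nat.odd_iff] at *; omega
    have h1 := card_cut_inter_add_union A B
    have h2 := h.le_cut _ hI ho
    have h3 := h.le_cut _ hU hUo
    exact ⟨hUo, by omega⟩
  · exfalso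
    have h1 := card_cut_sdiff_add_sdiff A B h₀ (mem_inter.2 ⟨huA, huB⟩)
      (fun h' => disjoint_left.1 hU h' hx)
    have h4 := card_sdiff_add_card_inter A B
    have h5 := card_sdiff_add_card_inter B A
    rw [inter_comm] at h5
    rw [Nat.not_odd_iff_even, Nat.even_iff] at ho
    rw [Nat.odd_iff] at hAo hBo
    have h2 := h.le_cut (A \ B) (disjoint_of_subset_left sdiff_subset hA) (by rw [Nat.odd_iff]; omega)
    have h3 := h.le_cut (B \ A) (disjoint_of_subset_left sdiff_subset hB) (by rw [Nat.odd_iff]; omega)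
    omega

/-- The edge `e₂` is one that can be split off together with `e₁`. If there were none, every
neighbor of `X` outside `X` would lie in a tight odd set through `u`. By uncrossing, a largest such
set `S` contains them all, so the remaining vertices form an odd set whose leaving edges all go to
`S`. Since `e₁` also leaves `S`, fewer than `r` edges are left for them. -/
lemma IsROff.exists_partner {r : ℕ} {X : Finset G.V} (h : G.IsROff r X)
    {e₁ : G.E} {x u : G.V} (h₁ : G.Link e₁ x u) (hx : x ∈ X) (hu : u ∉ X) :
    ∃ e₂ y v, G.Link e₂ y v ∧ y ∈ X ∧ v ∉ X ∧ v ≠ u ∧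
      ∀ S : Finset G.V, Disjoint S X → Odd #S → u ∈ S → v ∈ S → r + 2 ≤ #(G.cut S) := by
  by_contra hcon
  push Not at hcon
  let T : Finset (Finset G.V) :=
    univ.filter (fun S => Disjoint S X ∧ Odd #S ∧ u ∈ S ∧ #(G.cut S) = r)
  have hT : ∀ S, S ∈ T ↔ Disjoint S X ∧ Odd #S ∧ u ∈ S ∧ #(G.cut S) = r := fun S => by simp [T]
  have hne : T.Nonempty := by
    refine ⟨{u}, (hT _).2 ⟨by simpa using hu, by simp, by simp, ?_⟩⟩
    rw [cut_singleton, h.deg u hu]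
  obtain ⟨S, hST, hmax⟩ := exists_max_image T card hne
  have hsub : ∀ S' ∈ T, S' ⊆ S := by
    intro S' hS'
    have hS'' := (hT _).1 hS'
    have hS2 := (hT _).1 hST
    have h3 := h.tight_union h₁ hx hS2.1 hS''.1 hS2.2.1 hS''.2.1 hS2.2.2.1 hS''.2.2.1 hS2.2.2.2
      hS''.2.2.2
    have h4 := hmax (S ∪ S') ((hT _).2 ⟨disjoint_union_left.2 ⟨hS2.1, hS''.1⟩, h3.1,
      mem_union_left _ hS2.2.2.1, h3.2⟩)
    have h5 := eq_of_subset_of_card_le subset_union_left h4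
    rw [h5]; exact subset_union_right
  obtain ⟨hSX, hSo, huS, hSr⟩ := (hT _).1 hST
  have hnb : ∀ e y v, G.Link e y v → y ∈ X → v ∉ X → v ∈ S := by
    intro e y v hl hy hv
    by_cases hvu : v = u
    · rwa [hvu]
    · obtain ⟨S', h1, h2, h3, h4, h5⟩ := hcon e y v hl hy hv hvu
      exact hsub S' ((hT _).2 ⟨h1, h2, h3, h.tight_of_lt h1 h2 h5⟩) h4
  set R := (X ∪ S)ᶜ with hR
  have hRX : Disjoint R X := by
    rw [disjoint_left]; intro a ha; rw [hR, mem_compl, mem_union] at ha; tauto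
  have hRo : Odd #R := by
    have h1 : R ∪ S = Xᶜ := by
      ext a; simp only [hR, mem_union, mem_compl]
      have := fun h : a ∈ S => disjoint_left.1 hSX h
      tauto
    have h2 : Disjoint R S := by
      rw [disjoint_left]; intro a ha; rw [hR, mem_compl, mem_union] at ha; tauto
    have h3 := card_union_of_disjoint h2
    have h4 := h.even
    rw [h1] at h3
    rw [Nat.odd_iff] at *; rw [Nat.even_iff] at h4; omega
  have h1 := h.le_cut R hRX hRo
  have h2 : insert e₁ (G.cut R) ⊆ G.cut S := by
    intro e he
    rcases mem_insert.1 he with rfl | he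
    · rw [mem_cut_iff_link]
      exact ⟨u, huS, x, fun h' => disjoint_left.1 hSX h' hx, h₁.symm⟩
    · obtain ⟨a, ha, b, hb, hl⟩ := mem_cut_iff_link.1 he
      have ha' := ha
      rw [hR, mem_compl, mem_union] at ha
      rw [hR, mem_compl, not_not, mem_union] at hb
      rw [mem_cut_iff_link]
      rcases hb with hb | hb
      · have := hnb e b a hl.symm hb (by tauto)
        tauto
      · exact ⟨b, hb, a, by tauto, hl.symm⟩
  have h3 := card_le_card h2
  rw [card_insert_of_notMem] at h3
  · omega
  · rw [h₁.mem_cut]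
    simp [hR, huS, hx]

/-- Replace two edges by one edge joining `u` and `v`: the edge `e₂` is removed and `e₁` gets
new ends. -/
noncomputable def merge (G : FinGraph) (e₁ e₂ : G.E) {u v : G.V} (h : u ≠ v) : FinGraph where
  V := G.V
  E := {e // e ≠ e₂}
  s e := if e.1 = e₁ then u else G.s e.1
  t e := if e.1 = e₁ then v else G.t e.1
  ne e := by
    by_cases h1 : e.1 = e₁
    · simp [h1, h]
    · simp [h1, G.ne]

section merge
variable {e₁ e₂ : G.E} {u v : G.V} (h : u ≠ v)

/-- The edge map of a merge. -/
noncomputable def mergeMap (h : u ≠ v) (he : e₁ ≠ e₂) (e : G.E) : (G.merge e₁ e₂ h).E :=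
  if h2 : e = e₂ then ⟨e₁, he⟩ else ⟨e, h2⟩

/-- The underlying edge. -/
def mergeVal (h : u ≠ v) (e : (G.merge e₁ e₂ h).E) : G.E := Subtype.val e

/-- The underlying vertex. -/
def mergeV (h : u ≠ v) (w : G.V) : (G.merge e₁ e₂ h).V := w

end merge

lemma mergeVal_injective {e₁ e₂ : G.E} {u v : G.V} (h : u ≠ v) :
    Function.Injective (mergeVal (e₁ := e₁) (e₂ := e₂) h) := Subtype.val_injective

lemma mergeVal_mergeMap {e₁ e₂ : G.E} {u v : G.V} (h : u ≠ v) (he : e₁ ≠ e₂) (e : G.E) :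
    mergeVal h (mergeMap h he e) = if e = e₂ then e₁ else e := by
  unfold mergeMap mergeVal; split_ifs with h1 <;> simp [h1]

lemma merge_link_self {e₁ e₂ : G.E} {u v : G.V} (h : u ≠ v) {e : (G.merge e₁ e₂ h).E}
    (he : mergeVal h e = e₁) : (G.merge e₁ e₂ h).Link e (mergeV h u) (mergeV h v) := by
  refine Or.inl ⟨if_pos he, if_pos he⟩

lemma merge_link {e₁ e₂ : G.E} {u v : G.V} (h : u ≠ v) {e : (G.merge e₁ e₂ h).E}
    (he : mergeVal h e ≠ e₁) {x y : G.V} (hl : G.Link (mergeVal h e) x y) :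
    (G.merge e₁ e₂ h).Link e (mergeV h x) (mergeV h y) := by
  have h1 : (G.merge e₁ e₂ h).s e = mergeV h (G.s (mergeVal h e)) := if_neg he
  have h2 : (G.merge e₁ e₂ h).t e = mergeV h (G.t (mergeVal h e)) := if_neg he
  unfold Link
  rw [h1, h2]
  exact hl

lemma merge_inc {e₁ e₂ : G.E} {u v : G.V} (h : u ≠ v) {e : (G.merge e₁ e₂ h).E} {w : G.V} :
    (G.merge e₁ e₂ h).Inc e (mergeV h w) ↔
      (mergeVal h e = e₁ ∧ (w = u ∨ w = v)) ∨ (mergeVal h e ≠ e₁ ∧ G.Inc (mergeVal h e) w) := by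
  by_cases he : mergeVal h e = e₁
  · have hl := merge_link_self h he
    simp only [he, true_and, ne_eq, not_true, false_and, or_false]
    exact ⟨fun hi => hl.eq_or_eq hi, by rintro (rfl | rfl); exacts [hl.inc_left, hl.inc_right]⟩
  · simp only [he, false_and, ne_eq, not_false_eq_true, true_and, false_or]
    have hl := merge_link h he (link_s_t _)
    constructor
    · intro hi
      rcases hl.eq_or_eq hi with h1 | h1
      · exact Or.inl h1.symm
      · exact Or.inr h1.symm
    · rintro (h1 | h1)
      · rw [← h1]; exact hl.inc_left
      · rw [← h1]; exact hl.inc_right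

/-- Regard a set of vertices as a set of vertices of a merge. -/
def mergeS {e₁ e₂ : G.E} {u v : G.V} (h : u ≠ v) (S : Finset G.V) :
    Finset (G.merge e₁ e₂ h).V := S

section lift
variable {r : ℕ} {X : Finset G.V} {e₁ e₂ : G.E} {x y u v : G.V}

/-- Splitting off is invisible at vertices outside `X`: the merged edge takes over the role of `e₁`
at `u` and of `e₂` at `v`. Injectivity on stars needs `u ≠ v`. -/
lemma merge_star (h₁ : G.Link e₁ x u) (h₂ : G.Link e₂ y v) (hx : x ∈ X) (hy : y ∈ X) (h : u ≠ v)
    (he : e₁ ≠ e₂) {w : G.V} (hw : w ∉ X) :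
    Set.InjOn (mergeMap h he) (G.star w) ∧
      (G.star w).image (mergeMap h he) = (G.merge e₁ e₂ h).star (mergeV h w) := by
  have hw1 : G.Inc e₁ w → w = u := fun hi => (h₁.eq_or_eq hi).resolve_left (by rintro rfl; exact hw hx)
  have hw2 : G.Inc e₂ w → w = v := fun hi => (h₂.eq_or_eq hi).resolve_left (by rintro rfl; exact hw hy)
  constructor
  · intro a ha b hb hab
    rw [mem_coe, mem_star] at ha hb
    have h3 := congrArg (mergeVal h) hab
    rw [mergeVal_mergeMap, mergeVal_mergeMap] at h3
    split_ifs at h3 with h4 h5 h5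
    · rw [h4, h5]
    · subst h4; subst h3; exact absurd ((hw1 hb).symm.trans (hw2 ha)) h
    · subst h5; subst h3; exact absurd ((hw1 ha).symm.trans (hw2 hb)) h
    · exact h3
  · ext e
    rw [mem_image, mem_star, merge_inc]
    constructor
    · rintro ⟨a, ha, rfl⟩
      rw [mem_star] at ha
      rw [mergeVal_mergeMap]
      split_ifs with h4
      · subst h4; exact Or.inl ⟨rfl, Or.inr (hw2 ha)⟩
      · by_cases h5 : a = e₁
        · subst h5; exact Or.inl ⟨rfl, Or.inl (hw1 ha)⟩
        · exact Or.inr ⟨h5, ha⟩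
    · have hne : mergeVal h e ≠ e₂ := e.2
      rintro (⟨h1, rfl | rfl⟩ | ⟨h1, h2⟩)
      · refine ⟨e₁, mem_star.2 h₁.inc_right, mergeVal_injective h ?_⟩
        rw [mergeVal_mergeMap, if_neg he, h1]
      · refine ⟨e₂, mem_star.2 h₂.inc_right, mergeVal_injective h ?_⟩
        rw [mergeVal_mergeMap, if_pos rfl, h1]
      · refine ⟨mergeVal h e, mem_star.2 h2, mergeVal_injective h ?_⟩
        rw [mergeVal_mergeMap, if_neg hne]

lemma merge_mem_cut_of_ne (h : u ≠ v) {e : (G.merge e₁ e₂ h).E} (he : mergeVal h e ≠ e₁)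
    {S : Finset G.V} : e ∈ (G.merge e₁ e₂ h).cut (mergeS h S) ↔ mergeVal h e ∈ G.cut S := by
  have hl := merge_link h he (link_s_t _)
  rw [hl.mem_cut, mem_cut]
  rfl

lemma merge_mem_cut_of_eq (h : u ≠ v) {e : (G.merge e₁ e₂ h).E} (he : mergeVal h e = e₁)
    {S : Finset G.V} : e ∈ (G.merge e₁ e₂ h).cut (mergeS h S) ↔ ¬ (u ∈ S ↔ v ∈ S) := by
  have hl := merge_link_self h he
  rw [hl.mem_cut]
  rfl

/-- Only odd sets containing both `u` and `v` lose edges from their cut, namely the two split ones;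
`hS` provides for exactly this loss. -/
lemma merge_isROff (hG : G.IsROff r X) (h₁ : G.Link e₁ x u) (h₂ : G.Link e₂ y v) (hx : x ∈ X)
    (hy : y ∈ X) (h : u ≠ v) (he : e₁ ≠ e₂)
    (hS : ∀ S : Finset G.V, Disjoint S X → Odd #S → u ∈ S → v ∈ S → r + 2 ≤ #(G.cut S)) :
    (G.merge e₁ e₂ h).IsROff r (mergeS h X) := by
  refine ⟨fun w hw => ?_, fun S hSX hSo => ?_, hG.even⟩
  · obtain ⟨h3, h4⟩ := merge_star h₁ h₂ hx hy h he (w := w) hw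
    rw [← hG.deg w hw, ← card_image_of_injOn h3, h4]; rfl
  · change Finset G.V at S
    have hSX' : Disjoint S X := hSX
    have hSo' : Odd #S := hSo
    have hxS : x ∉ S := fun h' => disjoint_left.1 hSX' h' hx
    have hyS : y ∉ S := fun h' => disjoint_left.1 hSX' h' hy
    change r ≤ #((G.merge e₁ e₂ h).cut (mergeS h S))
    have hinj : ∀ a b, a ≠ e₂ → b ≠ e₂ → mergeMap h he a = mergeMap h he b → a = b := by
      intro a b ha hb hab
      have h3 := congrArg (mergeVal h) hab
      rwa [mergeVal_mergeMap, mergeVal_mergeMap, if_neg ha, if_neg hb] at h3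
    have hoth : ∀ a, a ≠ e₁ → a ≠ e₂ → a ∈ G.cut S →
        mergeMap h he a ∈ (G.merge e₁ e₂ h).cut (mergeS h S) := by
      intro a h1 h2 ha
      have h3 : mergeVal h (mergeMap h he a) = a := by rw [mergeVal_mergeMap, if_neg h2]
      rw [merge_mem_cut_of_ne h (by rwa [h3]), h3]
      exact ha
    by_cases huv : u ∈ S ∧ v ∈ S
    · have h3 := hS S hSX' hSo' huv.1 huv.2
      have h4 : #(((G.cut S).erase e₁).erase e₂) ≤ #((G.merge e₁ e₂ h).cut (mergeS h S)) := by
        apply card_le_card_of_injOn (mergeMap h he)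
        · intro a ha
          simp only [mem_coe, mem_erase] at ha
          exact hoth a ha.2.1 ha.1 ha.2.2
        · intro a ha b hb
          simp only [mem_coe, mem_erase] at ha hb
          exact hinj a b ha.1 hb.1
      have h5 := pred_card_le_card_erase (s := G.cut S) (a := e₁)
      have h6 := pred_card_le_card_erase (s := (G.cut S).erase e₁) (a := e₂)
      omega
    · refine (hG.le_cut S hSX' hSo').trans ?_
      have hc1 : e₁ ∈ G.cut S ↔ u ∈ S := by rw [h₁.mem_cut]; tauto
      have hc2 : e₂ ∈ G.cut S ↔ v ∈ S := by rw [h₂.mem_cut]; tauto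
      apply card_le_card_of_injOn (mergeMap h he)
      · intro a ha
        rw [mem_coe] at ha ⊢
        by_cases h1 : a = e₂
        · subst h1
          rw [merge_mem_cut_of_eq h (by rw [mergeVal_mergeMap, if_pos rfl])]
          tauto
        · by_cases h2 : a = e₁
          · subst h2
            rw [merge_mem_cut_of_eq h (by rw [mergeVal_mergeMap, if_neg h1])]
            tauto
          · exact hoth a h2 h1 ha
      · intro a ha b hb hab
        rw [mem_coe] at ha hb
        have h3 := congrArg (mergeVal h) hab
        rw [mergeVal_mergeMap, mergeVal_mergeMap] at h3
        split_ifs at h3 with h4 h5 h5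
        · rw [h4, h5]
        · subst h4; subst h3; tauto
        · subst h5; subst h3; tauto
        · exact h3

lemma merge_cut_card_lt (h₁ : G.Link e₁ x u) (hx : x ∈ X) (hu : u ∉ X) (hv : v ∉ X) (h : u ≠ v) :
    #((G.merge e₁ e₂ h).cut (mergeS h X)) < #(G.cut X) := by
  rw [← card_image_of_injective _ (mergeVal_injective h)]
  apply card_lt_card
  refine ⟨?_, fun hsub => ?_⟩
  · intro a ha
    obtain ⟨e, hec, rfl⟩ := mem_image.1 ha
    by_cases h1 : mergeVal h e = e₁
    · rw [merge_mem_cut_of_eq h h1] at hec; tauto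
    · rwa [merge_mem_cut_of_ne h h1] at hec
  · have h3 : e₁ ∈ G.cut X := by rw [h₁.mem_cut]; tauto
    obtain ⟨e, hec, h1⟩ := mem_image.1 (hsub h3)
    rw [merge_mem_cut_of_eq h h1] at hec; tauto

end lift

/-- Splitting off all edges leaving `X`. -/
theorem IsROff.exists_lift {r : ℕ} (hr : 1 ≤ r) : ∀ (G : FinGraph) (X : Finset G.V),
    G.IsROff r X → Xᶜ.Nonempty → ∃ (F : FinGraph) (j : F.V → G.V) (φ : G.E → F.E), F.IsR r ∧
      Function.Injective j ∧ (∀ w, w ∉ X ↔ ∃ a, j a = w) ∧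
      ∀ a, Set.InjOn φ (G.star (j a)) ∧ (G.star (j a)).image φ = F.star a := by
  intro G X
  induction hn : #(G.cut X) using Nat.strong_induction_on generalizing G with
  | _ n ih =>
  intro hG hne
  by_cases hX : G.cut X = ∅
  · have hc : G.cut Xᶜ = ∅ := by rw [cut_compl, hX]
    obtain ⟨w₀, hw₀⟩ := hne
    have hst : (G.star w₀).Nonempty := by
      rw [← card_pos, hG.deg w₀ (mem_compl.1 hw₀)]; omega
    obtain ⟨e₀, he₀⟩ := hst
    -- An edge is needed for `Function.invFun`, which sends the edges inside `X` to an arbitrary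
    -- value; only stars outside `X` matter.
    have hE : Nonempty (G.sub Xᶜ).E := by
      obtain ⟨a, -⟩ := exists_subE (mem_of_cut_eq_empty' hc hw₀ (mem_star.1 he₀))
      exact ⟨a⟩
    have hinv := Function.leftInverse_invFun (subE_injective Xᶜ)
    have him : ∀ a, (G.star (subV Xᶜ a)).image (Function.invFun (subE Xᶜ)) = (G.sub Xᶜ).star a := by
      intro a
      rw [← image_sub_star hc, image_image, hinv.comp_eq_id, image_id]
    refine ⟨G.sub Xᶜ, subV Xᶜ, Function.invFun (subE Xᶜ), ⟨fun v => ?_, fun T hT => ?_⟩,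
      subV_injective _, fun w => ⟨fun h => exists_subV (mem_compl.2 h), ?_⟩, fun a => ⟨?_, him a⟩⟩
    · rw [← hG.deg (subV _ v) (mem_compl.1 (subV_mem v)), ← image_sub_star hc,
        card_image_of_injective _ (subE_injective _)]
    · rw [← card_image_of_injective _ (subE_injective _), image_sub_cut hc]
      apply hG.le_cut
      · rw [disjoint_left]
        intro b hb
        obtain ⟨c, -, rfl⟩ := mem_image.1 hb
        exact mem_compl.1 (subV_mem c)
      · rwa [card_image_of_injective _ (subV_injective _)]
    · rintro ⟨a, rfl⟩; exact mem_compl.1 (subV_mem a)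
    · rw [← image_sub_star hc, coe_image]
      rintro _ ⟨b, -, rfl⟩ _ ⟨c, -, rfl⟩ hbc
      rw [hinv, hinv] at hbc
      rw [hbc]
  · obtain ⟨e₁, he₁⟩ := nonempty_iff_ne_empty.2 hX
    obtain ⟨x, hx, u, hu, h₁⟩ := mem_cut_iff_link.1 he₁
    obtain ⟨e₂, y, v, h₂, hy, hv, hvu, hS⟩ := hG.exists_partner h₁ hx hu
    have he : e₁ ≠ e₂ := by
      rintro rfl
      rcases h₁.eq_or_eq h₂.inc_right with h3 | h3
      · rw [h3] at hv; exact hv hx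
      · exact hvu h3
    obtain ⟨F, j, φ, hF, hj, hjX, hφ⟩ := ih _
      (hn ▸ merge_cut_card_lt h₁ hx hu hv hvu.symm) (G.merge e₁ e₂ hvu.symm)
      (mergeS hvu.symm X) rfl (merge_isROff hG h₁ h₂ hx hy hvu.symm he hS) hne
    refine ⟨F, j, φ ∘ mergeMap hvu.symm he, hF, hj, hjX, fun a => ?_⟩
    obtain ⟨h3, h4⟩ := merge_star h₁ h₂ hx hy hvu.symm he (w := j a) ((hjX _).2 ⟨a, rfl⟩)
    obtain ⟨h5, h6⟩ := hφ a
    constructor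
    · refine Set.InjOn.comp h5 h3 ?_
      intro b hb
      have : mergeMap hvu.symm he b ∈ (G.merge e₁ e₂ hvu.symm).star (mergeV hvu.symm (j a)) := by
        rw [← h4]; exact mem_image_of_mem _ hb
      exact this
    · rw [← image_image, h4]; exact h6

/-- Removing an even set of vertices from an `r`-graph by lifting. -/
theorem IsR.exists_lift {r : ℕ} (hr : 1 ≤ r) (hG : G.IsR r) (X : Finset G.V) (hX : Even #X)
    (hne : Xᶜ.Nonempty) : ∃ (F : FinGraph) (j : F.V → G.V) (φ : G.E → F.E), F.IsR r ∧
      Function.Injective j ∧ (∀ w, w ∉ X ↔ ∃ a, j a = w) ∧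
      ∀ a, Set.InjOn φ (G.star (j a)) ∧ (G.star (j a)).image φ = F.star a := by
  refine IsROff.exists_lift hr G X ⟨fun v _ => hG.1 v, fun S _ => hG.2 S, ?_⟩ hne
  rw [card_compl]
  exact (Nat.even_sub (card_le_univ X)).2 ⟨fun _ => hX, fun _ => hG.even_card hr⟩

end FinGraph
end RGraphs

/-! ### Perfect matchings avoiding `r - 1` edges, by Tutte's theorem -/

namespace RGraphs
open Finset
open scoped Classical
namespace FinGraph
variable {G H K : FinGraph}

/-- The simple graph of the edges outside `F`. -/
def simpleOff (G : FinGraph) (F : Finset G.E) : SimpleGraph G.V where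
  Adj x y := ∃ e ∉ F, G.Link e x y
  symm := ⟨fun _ _ ⟨e, he, h⟩ => ⟨e, he, h.symm⟩⟩
  loopless := ⟨fun _ ⟨_, _, h⟩ => h.ne rfl⟩

lemma exists_pm_of_isPerfectMatching {F : Finset G.E} {M : (G.simpleOff F).Subgraph}
    (hM : M.IsPerfectMatching) : ∃ N, G.PM N ∧ Disjoint N F := by
  rw [SimpleGraph.Subgraph.isPerfectMatching_iff] at hM
  have h1 : ∀ a : Sym2 G.V, a ∈ M.edgeSet → ∃ e ∉ F, s(G.s e, G.t e) = a := by
    intro a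
    induction a using Sym2.ind with
    | _ x y =>
    intro h
    obtain ⟨e, he, hl⟩ := M.adj_sub h
    refine ⟨e, he, ?_⟩
    rcases hl with ⟨rfl, rfl⟩ | ⟨rfl, rfl⟩
    · rfl
    · exact Sym2.eq_swap
  choose ε hε1 hε2 using h1
  refine ⟨univ.filter (fun e => ∃ a, ∃ h : a ∈ M.edgeSet, ε a h = e), fun v => ?_, ?_⟩
  · obtain ⟨w, hw, hw'⟩ := hM v
    rw [card_eq_one]
    have hvw : s(v, w) ∈ M.edgeSet := hw
    refine ⟨ε s(v, w) hvw, ?_⟩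
    ext e
    rw [mem_inter, mem_filter, mem_star, mem_singleton]
    constructor
    · rintro ⟨⟨-, a, ha, rfl⟩, hi⟩
      have h2 := hε2 a ha
      have h3 : v ∈ a := by
        rw [← h2]
        rcases hi with h | h
        · rw [← h]; exact Sym2.mem_mk_left _ _
        · rw [← h]; exact Sym2.mem_mk_right _ _
      obtain ⟨w', rfl⟩ := Sym2.mem_iff_exists.1 h3
      have := hw' w' ha
      subst this
      rfl
    · rintro rfl
      refine ⟨⟨mem_univ _, _, hvw, rfl⟩, ?_⟩
      have h2 := hε2 _ hvw
      have h3 : v ∈ s(G.s (ε s(v, w) hvw), G.t (ε s(v, w) hvw)) := by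
        rw [h2]; exact Sym2.mem_mk_left _ _
      rcases Sym2.mem_iff.1 h3 with h | h
      · exact Or.inl h.symm
      · exact Or.inr h.symm
  · rw [disjoint_left]
    intro e he
    obtain ⟨-, a, ha, rfl⟩ := mem_filter.1 he
    exact hε1 a ha

/-- If pairwise disjoint odd sets are only joined by edges of `F` and by edges to `U`, there are
not many of them. -/
lemma IsR.card_odd_sets {r : ℕ} (hG : G.IsR r) {ι : Type} {Q : Finset ι} {S : ι → Finset G.V}
    {F : Finset G.E} {U : Finset G.V} (hodd : ∀ c ∈ Q, Odd #(S c))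
    (hdisj : ∀ c ∈ Q, ∀ d ∈ Q, ∀ v, v ∈ S c → v ∈ S d → c = d) (hU : ∀ c ∈ Q, Disjoint (S c) U)
    (hcl : ∀ c ∈ Q, ∀ e ∉ F, ∀ x y, G.Link e x y → x ∈ S c → y ∉ U → y ∈ S c) :
    r * #Q ≤ r * #U + 2 * #F := by
  have h1 : r * #Q ≤ ∑ c ∈ Q, #(G.cut (S c)) := by
    rw [mul_comm, ← smul_eq_mul]
    exact card_nsmul_le_sum _ _ _ (fun c hc => hG.2 _ (hodd c hc))
  have h2 : r * #U = ∑ v ∈ U, #(G.star v) := by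
    rw [sum_congr rfl (fun v _ => hG.1 v)]; simp [mul_comm]
  refine h1.trans ?_
  rw [h2]
  have h3 : ∑ c ∈ Q, #(G.cut (S c)) = ∑ e : G.E, #(Q.filter (fun c => e ∈ G.cut (S c))) := by
    simp only [card_filter]
    rw [sum_comm]
    refine sum_congr rfl fun c _ => ?_
    rw [← card_filter]; congr 1; ext e; simp
  have h4 : ∑ v ∈ U, #(G.star v) = ∑ e : G.E, #(U.filter (fun v => G.Inc e v)) := by
    simp only [card_filter]
    rw [sum_comm]
    refine sum_congr rfl fun c _ => ?_
    rw [← card_filter]; congr 1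
  have h5 : 2 * #F = ∑ e : G.E, if e ∈ F then 2 else 0 := by
    rw [← sum_filter, sum_const, smul_eq_mul, mul_comm]; congr 2; ext e; simp
  rw [h3, h4, h5, ← sum_add_distrib]
  -- Compare edge by edge. An edge of `F` leaves at most two of the disjoint sets. Any other edge
  -- leaving one of them has its other end in `U`, so it leaves only one and is paid for by that
  -- end.
  refine sum_le_sum fun e _ => ?_
  have hone : ∀ v, #(Q.filter (fun c => v ∈ S c)) ≤ 1 := by
    intro v
    rw [card_le_one]
    intro c hc d hd
    rw [mem_filter] at hc hd
    exact hdisj c hc.1 d hd.1 v hc.2 hd.2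
  have hsub : Q.filter (fun c => e ∈ G.cut (S c)) ⊆
      Q.filter (fun c => G.s e ∈ S c) ∪ Q.filter (fun c => G.t e ∈ S c) := by
    intro c hc
    simp only [mem_filter, mem_union, mem_cut] at hc ⊢
    tauto
  by_cases heF : e ∈ F
  · rw [if_pos heF]
    have h6 := (card_le_card hsub).trans (card_union_le _ _)
    have h7 := hone (G.s e)
    have h8 := hone (G.t e)
    omega
  · rw [if_neg heF, add_zero]
    by_cases hs : G.s e ∈ U
    · have h6 : 1 ≤ #(U.filter (fun v => G.Inc e v)) := by
        rw [Nat.one_le_iff_ne_zero, card_ne_zero]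
        exact ⟨_, mem_filter.2 ⟨hs, inc_s e⟩⟩
      refine le_trans ((card_le_card ?_).trans (hone (G.t e))) h6
      intro c hc
      simp only [mem_filter, mem_cut] at hc ⊢
      have := fun h => disjoint_left.1 (hU c hc.1) h hs
      tauto
    · by_cases ht : G.t e ∈ U
      · have h6 : 1 ≤ #(U.filter (fun v => G.Inc e v)) := by
          rw [Nat.one_le_iff_ne_zero, card_ne_zero]
          exact ⟨_, mem_filter.2 ⟨ht, inc_t e⟩⟩
        refine le_trans ((card_le_card ?_).trans (hone (G.s e))) h6
        intro c hc
        simp only [mem_filter, mem_cut] at hc ⊢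
        have := fun h => disjoint_left.1 (hU c hc.1) h ht
        tauto
      · rw [filter_eq_empty_iff.2]
        · simp
        · intro c hc
          rw [mem_cut, not_not]
          exact ⟨fun h => hcl c hc e heF _ _ (link_s_t e) h ht,
            fun h => hcl c hc e heF _ _ (link_s_t e).symm h hs⟩

/-- An `r`-graph has a perfect matching avoiding any given `r - 1` edges. -/
theorem IsR.exists_pm {r : ℕ} (hG : G.IsR r) (F : Finset G.E) (hF : #F < r) :
    ∃ N, G.PM N ∧ Disjoint N F := by
  by_contra hcon
  have hno : ¬ ∃ M : (G.simpleOff F).Subgraph, M.IsPerfectMatching := by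
    rintro ⟨M, hM⟩; exact hcon (exists_pm_of_isPerfectMatching hM)
  rw [SimpleGraph.tutte] at hno
  push Not at hno
  obtain ⟨u, hu⟩ := hno
  unfold SimpleGraph.IsTutteViolator at hu
  set G' := ((⊤ : (G.simpleOff F).Subgraph).deleteVerts u).coe with hG'
  have hfin : G'.oddComponents.Finite := Set.toFinite _
  set Q := hfin.toFinset with hQ
  have hQc : G'.oddComponents.ncard = #Q := Set.ncard_eq_toFinset_card _ hfin
  set U := u.toFinset with hUdef
  have hUc : u.ncard = #U := Set.ncard_eq_toFinset_card' u
  have hverts : ∀ v, v ∈ ((⊤ : (G.simpleOff F).Subgraph).deleteVerts u).verts ↔ v ∉ u := by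
    intro v; simp
  let S : G'.ConnectedComponent → Finset G.V := fun c =>
    univ.filter (fun v => ∃ h : v ∉ u, G'.connectedComponentMk ⟨v, (hverts v).2 h⟩ = c)
  have hS : ∀ c v, v ∈ S c ↔ ∃ h : v ∉ u, G'.connectedComponentMk ⟨v, (hverts v).2 h⟩ = c := by
    intro c v; simp [S]
  have hScard : ∀ c : G'.ConnectedComponent, c.supp.ncard = #(S c) := by
    intro c
    rw [← Set.ncard_coe_finset, ← Set.ncard_image_of_injective _ Subtype.val_injective]
    congr 1
    ext v
    rw [mem_coe, hS, Set.mem_image]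
    constructor
    · rintro ⟨⟨w, hw⟩, hc, rfl⟩
      exact ⟨(hverts w).1 hw, hc⟩
    · rintro ⟨h, hc⟩
      exact ⟨⟨v, (hverts v).2 h⟩, hc, rfl⟩
  have hkey := hG.card_odd_sets (Q := Q) (S := S) (F := F) (U := U) ?_ ?_ ?_ ?_
  · have hpar : Odd #Q ↔ Odd (Fintype.card G.V - #U) := by
      rw [← hQc, SimpleGraph.odd_ncard_oddComponents, ← card_compl]
      have : ((⊤ : (G.simpleOff F).Subgraph).deleteVerts u).verts = ↑(Uᶜ) := by
        ext v; rw [hverts]; simp [hUdef]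
      rw [Nat.card_coe_set_eq, this, Set.ncard_coe_finset]
    have h1 := hG.even_card (by omega)
    have h2 : #U ≤ Fintype.card G.V := card_le_univ U
    rw [hQc, hUc] at hu
    -- As `G` has even order, the number of odd components has the parity of `#U`, so a Tutte
    -- violator has an excess of at least 2. With the edge count this forces `r ≤ #F`.
    have h3 : #U + 2 ≤ #Q := by
      rw [Nat.odd_iff, Nat.odd_iff] at hpar
      rw [Nat.even_iff] at h1
      omega
    have h4 : r * (#U + 2) ≤ r * #U + 2 * #F := (Nat.mul_le_mul_left r h3).trans hkey
    rw [mul_add] at h4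
    omega
  · intro c hc
    rw [← hScard]
    exact hfin.mem_toFinset.1 hc
  · intro c _ d _ v hvc hvd
    rw [hS] at hvc hvd
    exact hvc.2.symm.trans hvd.2
  · intro c _
    rw [disjoint_left]
    intro v hv hvU
    rw [hS] at hv
    exact hv.1 (by simpa [hUdef] using hvU)
  · intro c _ e he x y hl hx hy
    rw [hS] at hx ⊢
    obtain ⟨hxu, hxc⟩ := hx
    have hyu : y ∉ u := by simpa [hUdef] using hy
    refine ⟨hyu, ?_⟩
    rw [← hxc, SimpleGraph.ConnectedComponent.eq]
    apply SimpleGraph.Adj.reachable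
    rw [hG', SimpleGraph.Subgraph.coe_adj, SimpleGraph.Subgraph.deleteVerts_adj]
    simp only [SimpleGraph.Subgraph.verts_top, Set.mem_univ, hyu, hxu, not_false_eq_true,
      SimpleGraph.Subgraph.top_adj, true_and]
    exact ⟨e, he, hl.symm⟩

/-- Avoid the other `r - 1` edges at one end of `e`. -/
lemma IsR.exists_pm_mem {r : ℕ} (hG : G.IsR r) (e : G.E) (hr : 1 ≤ r) : ∃ N, G.PM N ∧ e ∈ N := by
  have hs : e ∈ G.star (G.s e) := mem_star.2 (inc_s e)
  obtain ⟨N, hN, hd⟩ := hG.exists_pm ((G.star (G.s e)).erase e) (by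
    rw [card_erase_of_mem hs, hG.1]; omega)
  refine ⟨N, hN, ?_⟩
  obtain ⟨a, ha⟩ := card_eq_one.1 (hN (G.s e))
  have h1 : a ∈ N ∩ G.star (G.s e) := by rw [ha]; exact mem_singleton_self a
  rw [mem_inter] at h1
  by_cases h : a = e
  · rw [← h]; exact h1.1
  · exact absurd (mem_erase.2 ⟨h, h1.2⟩) (disjoint_left.1 hd h1.1)

end FinGraph
end RGraphs

/-! ### Rigid graphs and coloring graphs of least order -/

namespace RGraphs
open Finset
open scoped Classical
namespace FinGraph
variable {G H K : FinGraph}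

/-- `r`-edge-colorability. -/
def ClassOne (r : ℕ) (G : FinGraph) : Prop := ∃ c : G.E → Fin r, ∀ v, Set.InjOn c (G.star v)

/-- A connected `r`-graph is rigid if it is the only connected `r`-graph coloring it. -/
def Rigid (r : ℕ) (G : FinGraph) : Prop :=
  G.IsR r ∧ G.Conn ∧ ∀ H : FinGraph, H.IsR r → H.Conn → H.Col G → G.Iso H

lemma ClassOne.of_col {r : ℕ} (h : G.ClassOne r) (hc : G.Col H) : H.ClassOne r := by
  obtain ⟨c, hc'⟩ := h
  obtain ⟨f, hf⟩ := hc
  refine ⟨c ∘ f, fun v => ?_⟩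
  obtain ⟨u, hu, hu'⟩ := hf v
  refine Set.InjOn.comp (hc' u) hu ?_
  intro e he
  rw [← hu']
  exact mem_image_of_mem _ he

/-- The `r` edges at the single vertex `u` serve as the colors. -/
lemma ClassOne.col {r : ℕ} (h : G.ClassOne r) (hG : ∀ v, #(G.star v) = r)
    {u : H.V} (hu : #(H.star u) = r) : H.Col G := by
  obtain ⟨c, hc⟩ := h
  let ψ : Fin r ≃ H.star u := (Finset.equivFinOfCardEq hu).symm
  refine ⟨fun e => (ψ (c e)).1, fun v => ⟨u, ?_, ?_⟩⟩
  · intro a ha b hb hab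
    exact hc v ha hb (ψ.injective (Subtype.ext hab))
  · apply eq_of_subset_of_card_le
    · intro e he
      obtain ⟨a, -, rfl⟩ := mem_image.1 he
      exact (ψ (c a)).2
    · rw [hu, card_image_of_injOn, hG]
      intro a ha b hb hab
      exact hc v ha hb (ψ.injective (Subtype.ext hab))

lemma inc_map {f : G.E → H.E} {g : G.V → H.V} (hg : ∀ v, (G.star v).image f = H.star (g v))
    {e : G.E} {v : G.V} (h : G.Inc e v) : H.Inc (f e) (g v) := by
  rw [← mem_star, ← hg]
  exact mem_image_of_mem _ (mem_star.2 h)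

lemma cut_preimage_eq_empty {f : G.E → H.E} {g : G.V → H.V}
    (hg : ∀ v, (G.star v).image f = H.star (g v)) {S : Finset H.V} (hS : H.cut S = ∅) :
    G.cut (univ.filter (fun v => g v ∈ S)) = ∅ := by
  rw [eq_empty_iff_forall_notMem]
  intro e he
  obtain ⟨x, hx, y, hy, hl⟩ := mem_cut_iff_link.1 he
  simp only [mem_filter, mem_univ, true_and] at hx hy
  have h1 := mem_of_cut_eq_empty' hS hx (inc_map hg hl.inc_left)
  rcases inc_map hg hl.inc_right with h | h
  · rw [← h] at hy; exact hy h1.1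
  · rw [← h] at hy; exact hy h1.2

/-- A connected graph is mapped into a single component, so `H` can be cut down until it is
connected. -/
lemma exists_conn_col {r : ℕ} (hG : G.Conn) : ∀ H : FinGraph, H.IsR r → H.Col G →
    ∃ H' : FinGraph, H'.IsR r ∧ H'.Conn ∧ H'.Col G ∧ Fintype.card H'.V ≤ Fintype.card H.V := by
  intro H
  induction hn : Fintype.card H.V using Nat.strong_induction_on generalizing H with
  | _ n ih =>
  intro hH hc
  by_cases hcon : H.Conn
  · exact ⟨H, hH, hcon, hc, hn.le⟩
  obtain ⟨f, hf⟩ := hc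
  obtain ⟨g, hg⟩ := hf.exists_map
  obtain ⟨v₀⟩ := hG.1
  have : ∃ S : Finset H.V, g v₀ ∈ S ∧ S ≠ univ ∧ H.cut S = ∅ := by
    have h1 : ¬ ∀ S : Finset H.V, S.Nonempty → H.cut S = ∅ → S = univ := fun h => hcon ⟨⟨g v₀⟩, h⟩
    push Not at h1
    obtain ⟨S, h2, h3, h4⟩ := h1
    by_cases h5 : g v₀ ∈ S
    · exact ⟨S, h5, h4, h3⟩
    · refine ⟨Sᶜ, mem_compl.2 h5, ?_, by rw [cut_compl, h3]⟩
      rw [Ne, compl_eq_univ_iff]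
      exact h2.ne_empty
  obtain ⟨S, hv₀, hSu, hS⟩ := this
  have h1 := hG.2 _ ⟨v₀, by simpa using hv₀⟩ (cut_preimage_eq_empty hg hS)
  have h2 : ∀ v, g v ∈ S := by
    intro v
    have := mem_univ v
    rw [← h1] at this
    simpa using this
  have h3 := col_sub hS hf hg h2
  have h4 : #S < n := by
    rw [← hn, ← card_univ]; exact card_lt_card (ssubset_univ_iff.2 hSu)
  obtain ⟨H', h5, h6, h7, h8⟩ := ih #S h4 (H.sub S) (card_sub_V S) (sub_isR hH hS) h3
  exact ⟨H', h5, h6, h7, h8.trans h4.le⟩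

/-- An edge leaving the image of a coloring is the image of an edge whose ends are identified. -/
lemma exists_identified {f : G.E → H.E} {g : G.V → H.V}
    (hg : ∀ v, (G.star v).image f = H.star (g v)) {h : H.E} (hh : h ∈ H.cut (univ.image g)) :
    ∃ e x y, G.Link e x y ∧ f e = h ∧ g x = g y := by
  obtain ⟨u, hu, t, ht, hl⟩ := mem_cut_iff_link.1 hh
  obtain ⟨x, -, rfl⟩ := mem_image.1 hu
  have h1 : h ∈ H.star (g x) := mem_star.2 hl.inc_left
  rw [← hg] at h1
  obtain ⟨e, he, rfl⟩ := mem_image.1 h1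
  obtain ⟨y, -, hxy⟩ := (mem_star.1 he).exists_link
  refine ⟨e, x, y, hxy, rfl, ?_⟩
  rcases hl.eq_or_eq (inc_map hg hxy.inc_right) with h2 | h2
  · exact h2.symm
  · exact absurd (h2 ▸ mem_image_of_mem g (mem_univ y)) ht

/-- If lifting is possible, then the graph on the image of the vertex map (with one more vertex if
needed) colors. -/
lemma exists_col_card_le {r : ℕ} (hr : 1 ≤ r) (hH : H.IsR r) {f : G.E → H.E} (hf : IsCol G H f)
    {g : G.V → H.V} (hg : ∀ v, (G.star v).image f = H.star (g v)) {X : Finset H.V} (hX : Even #X)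
    (hgX : ∀ v, g v ∉ X) [hne : Nonempty G.V] :
    ∃ F : FinGraph, F.IsR r ∧ F.Col G ∧ Fintype.card F.V = #Xᶜ := by
  obtain ⟨v₀⟩ := hne
  obtain ⟨F, j, φ, hF, hj, hjX, hφ⟩ := hH.exists_lift hr X hX ⟨g v₀, mem_compl.2 (hgX v₀)⟩
  refine ⟨F, hF, ⟨φ ∘ f, fun v => ?_⟩, ?_⟩
  · obtain ⟨a, ha⟩ := (hjX _).1 (hgX v)
    refine ⟨a, ?_, ?_⟩
    · refine Set.InjOn.comp (hφ a).1 (hf.injOn v) ?_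
      intro e he
      rw [ha, ← hg]
      exact mem_image_of_mem _ he
    · rw [← image_image, hg, ← ha]; exact (hφ a).2
  · rw [← card_univ, ← card_image_of_injective _ hj]
    congr 1
    ext w
    rw [mem_compl, hjX]; simp

/-- Two adjacent vertices joined by at least `r` edges form a component, which is class one. -/
lemma classOne_of_parallel {r : ℕ} (hG : G.IsR r) (hc : G.Conn) {x y : G.V}
    (h : r ≤ #(univ.filter (fun e => G.Link e x y))) : G.ClassOne r := by
  have h1 : ∀ z, z = x ∨ z = y → univ.filter (fun e => G.Link e x y) = G.star z := by
    intro z hz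
    apply eq_of_subset_of_card_le
    · intro e he
      rw [mem_filter] at he
      rw [mem_star]
      rcases hz with rfl | rfl
      · exact he.2.inc_left
      · exact he.2.inc_right
    · rwa [hG.1]
  have h2 : ({x, y} : Finset G.V) = univ := by
    refine hc.2 _ ⟨x, by simp⟩ ?_
    rw [eq_empty_iff_forall_notMem]
    intro e he
    obtain ⟨a, ha, b, hb, hl⟩ := mem_cut_iff_link.1 he
    have ha' : a = x ∨ a = y := by simpa using ha
    have h3 : e ∈ G.star a := mem_star.2 hl.inc_left
    rw [← h1 a ha', mem_filter] at h3
    have := h3.2.eq_or_eq hl.inc_right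
    simp only [mem_insert, mem_singleton] at hb
    exact hb this
  have h3 : ∀ e, e ∈ G.star x := by
    intro e
    have h4 : G.s e ∈ ({x, y} : Finset G.V) := by rw [h2]; exact mem_univ _
    have h5 : e ∈ G.star (G.s e) := mem_star.2 (inc_s e)
    rw [← h1 _ (by simpa using h4), h1 x (Or.inl rfl)] at h5
    exact h5
  let ψ : G.star x ≃ Fin r := Finset.equivFinOfCardEq (hG.1 x)
  refine ⟨fun e => ψ ⟨e, h3 e⟩, fun v => ?_⟩
  intro a _ b _ hab
  exact congrArg Subtype.val (ψ.injective hab)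

/-- By the count, `g` identifies exactly one pair `x₀`, `y₀`. Every edge leaving the odd image of
`g`, and there are at least `r`, is the color of an edge whose ends are identified, hence of an edge
joining `x₀` and `y₀`. -/
lemma classOne_of_card_image {r : ℕ} (hG : G.IsR r) (hc : G.Conn) (hH : H.IsR r)
    {f : G.E → H.E} {g : G.V → H.V} (hg : ∀ v, (G.star v).image f = H.star (g v))
    (hcard : #(univ.image g) + 1 = Fintype.card G.V) (hodd : Odd #(univ.image g)) :
    G.ClassOne r := by
  have h1 : ¬ Function.Injective g := by
    intro h
    rw [card_image_of_injective _ h, card_univ] at hcard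
    omega
  rw [Function.not_injective_iff] at h1
  obtain ⟨x₀, y₀, hxy, hne⟩ := h1
  have key : ∀ p q, g p = g q → p ≠ q → Set.InjOn g (univ.erase p : Finset G.V) := by
    intro p q hpq hne
    rw [← card_image_iff, card_erase_of_mem (mem_univ p), card_univ, ← hcard, Nat.add_sub_cancel]
    congr 1
    ext w
    simp only [mem_image, mem_erase, mem_univ, and_true, true_and]
    constructor
    · rintro ⟨a, -, h⟩; exact ⟨a, h⟩
    · rintro ⟨a, h⟩
      by_cases hap : a = p
      · exact ⟨q, hne.symm, by rw [← hpq, ← hap, h]⟩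
      · exact ⟨a, hap, h⟩
  have hk1 := key x₀ y₀ hxy hne
  have hk2 := key y₀ x₀ hxy.symm hne.symm
  have huniq : ∀ x y, g x = g y → x ≠ y → (x = x₀ ∧ y = y₀) ∨ (x = y₀ ∧ y = x₀) := by
    intro x y h h'
    by_contra hcon
    have h3 : (x = x₀ ∨ y = x₀) := by
      by_contra h4
      push Not at h4
      exact h' (hk1 (by simp [h4.1]) (by simp [h4.2]) h)
    have h4 : (x = y₀ ∨ y = y₀) := by
      by_contra h5
      push Not at h5
      exact h' (hk2 (by simp [h5.1]) (by simp [h5.2]) h)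
    rcases h3 with rfl | rfl <;> rcases h4 with h4 | h4 <;> simp_all
  refine classOne_of_parallel hG hc (x := x₀) (y := y₀) ((hH.2 _ hodd).trans ?_)
  have h5 : H.cut (univ.image g) ⊆ (univ.filter (fun e => G.Link e x₀ y₀)).image f := by
    intro h hh
    obtain ⟨e, x, y, hl, rfl, hxy'⟩ := exists_identified hg hh
    refine mem_image_of_mem _ (mem_filter.2 ⟨mem_univ _, ?_⟩)
    rcases huniq x y hxy' hl.ne with ⟨rfl, rfl⟩ | ⟨rfl, rfl⟩
    · exact hl
    · exact hl.symm
  exact (card_le_card h5).trans card_image_le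

/-- Every class two connected `r`-graph is colored by a rigid one. -/
theorem exists_rigid {r : ℕ} (hr : 1 ≤ r) (hG : G.IsR r) (hGc : G.Conn) (h2 : ¬ G.ClassOne r) :
    ∃ H : FinGraph, H.Rigid r ∧ H.Col G := by
  have hex : ∃ n, ∃ H : FinGraph, H.IsR r ∧ H.Conn ∧ H.Col G ∧ Fintype.card H.V = n :=
    ⟨_, G, hG, hGc, ⟨id, fun v => ⟨v, Set.injOn_id _, by simp⟩⟩, rfl⟩
  obtain ⟨H, hH, hHc, hHG, hHn⟩ := Nat.find_spec hex
  -- Minimality was among connected graphs coloring `G`; passing to a component extends it to all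
  -- `r`-graphs coloring `H`.
  have hmin : ∀ F : FinGraph, F.IsR r → F.Col H → Fintype.card H.V ≤ Fintype.card F.V := by
    intro F hF hFH
    obtain ⟨F', h3, h4, h5, h6⟩ := exists_conn_col hGc F hF (hHG.trans hFH)
    rw [hHn]
    exact (Nat.find_min' hex ⟨F', h3, h4, h5, rfl⟩).trans h6
  refine ⟨H, ⟨hH, hHc, fun H' hH' hH'c hcol => ?_⟩, hHG⟩
  have hcol' := hcol
  obtain ⟨f, hf⟩ := hcol
  obtain ⟨g, hg⟩ := hf.exists_map
  have := hHc.1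
  by_cases hU : univ.image g = univ
  · have hs : Function.Surjective g := by
      intro w
      have : w ∈ univ.image g := by rw [hU]; exact mem_univ w
      obtain ⟨a, -, ha⟩ := mem_image.1 this
      exact ⟨a, ha⟩
    refine hf.iso hg ((Fintype.bijective_iff_surjective_and_card g).2 ⟨hs, ?_⟩)
    exact le_antisymm (hmin H' hH' hcol') (Fintype.card_le_of_surjective g hs)
  · exfalso
    have hUne : (univ.image g).Nonempty := univ_nonempty.image g
    have hcut : (H'.cut (univ.image g)).Nonempty := by
      rw [nonempty_iff_ne_empty]
      exact fun h => hU (hH'c.2 _ hUne h)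
    -- An edge leaving the image forces two vertices to be identified, so the image is smaller than
    -- `H`.
    have hlt : #(univ.image g) < Fintype.card H.V := by
      obtain ⟨h, hh⟩ := hcut
      obtain ⟨e, x, y, hl, -, hxy⟩ := exists_identified hg hh
      refine lt_of_le_of_ne (card_image_le.trans_eq card_univ) fun h3 => hl.ne ?_
      rw [← card_univ, card_image_iff] at h3
      exact h3 (by simp) (by simp) hxy
    have hVe := hH'.even_card hr
    have hle := card_le_univ (univ.image g)
    -- Splitting off removes an even set of vertices, so an odd image has to keep one extra vertex
    -- `t`. Then minimality only yields that the image has one vertex less than `H`.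
    by_cases heven : Even #(univ.image g)
    · obtain ⟨F, hF, hFH, hFc⟩ := exists_col_card_le hr hH' hf hg (X := (univ.image g)ᶜ)
        (by rw [card_compl]; exact (Nat.even_sub hle).2 ⟨fun _ => heven, fun _ => hVe⟩)
        (fun v => by simp)
      rw [compl_compl] at hFc
      have := hmin F hF hFH
      omega
    · rw [Nat.not_even_iff_odd] at heven
      obtain ⟨t, ht⟩ : ∃ t, t ∉ univ.image g := by
        by_contra h; push Not at h; exact hU (eq_univ_of_forall h)
      have hX : ((univ.image g)ᶜ.erase t)ᶜ = insert t (univ.image g) := by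
        ext w; simp only [mem_compl, mem_erase, mem_insert]; tauto
      have hXc : #((univ.image g)ᶜ.erase t)ᶜ = #(univ.image g) + 1 := by
        rw [hX, card_insert_of_notMem ht]
      obtain ⟨F, hF, hFH, hFc⟩ := exists_col_card_le hr hH' hf hg (X := (univ.image g)ᶜ.erase t)
        (by
          rw [card_erase_of_mem (mem_compl.2 ht), card_compl]
          rw [Nat.odd_iff] at heven
          rw [Nat.even_iff] at hVe ⊢
          have : #(univ.image g) < Fintype.card H'.V := by
            rw [← card_univ]; exact card_lt_card (ssubset_univ_iff.2 hU)
          omega)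
        (fun v => by simp)
      have h3 := hmin F hF hFH
      rw [hFc, hXc] at h3
      exact h2 ((classOne_of_card_image hH hHc hH' hg (by omega) heven).of_col hHG)

end FinGraph
end RGraphs

/-! ### The Petersen graph with multiplied spokes: cuts and perfect matchings -/

namespace RGraphs
open Finset

/-- The successor along the outer cycle (`false`) or the inner cycle (`true`) of the Petersen
graph. -/
def rimNext (b : Bool) (i : Fin 5) : Fin 5 := if b then i + 2 else i + 1

/-- The rim edges in the perfect matching of the Petersen graph that contains only the spoke `a`;
the rim edge `(b, i)` joins `i` to `rimNext b i`. -/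
def rimType (a : Fin 5) (x : Bool × Fin 5) : Bool :=
  x.2 = a + 1 || x.2 = (if x.1 then a + 2 else a + 3)

/-- The rim edge `x` is incident with the vertex `v`. -/
def rimInc (x v : Bool × Fin 5) : Bool := x = v || (x.1, rimNext x.1 x.2) = v

-- Here `p` and `q` indicate the outer and inner rim edges of a perfect matching. Consecutive rim
-- edges are not both used, and the two vertices at position `i` are covered by rim edges either
-- both or not at all, as otherwise a copy of the spoke covers both. Multiplicities of spokes play
-- no role, so the solutions are the six perfect matchings of the Petersen graph.
set_option maxRecDepth 20000 in
lemma rim_matching : ∀ p q : Fin 5 → Bool,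
    (∀ i, !(p i && p (i + 1)) && !(q i && q (i + 2)) &&
      ((p (i + 4) || p i) == (q (i + 3) || q i))) →
    (∀ i, p i = false ∧ q i = false) ∨
      ∃ a, ∀ i, p i = rimType a (false, i) ∧ q i = rimType a (true, i) := by decide +kernel

-- Here `p` and `q` indicate a set of outer and inner vertices. Both alternatives give at least `k +
-- 2` leaving edges once each spoke counts `k ≥ 1` times: `3 * k` spokes, or `k` spokes and two rim
-- edges.
set_option maxRecDepth 20000 in
lemma rim_cut_odd : ∀ p q : Fin 5 → Bool,
    (∑ i, ((p i).toNat + (q i).toNat)) % 2 = 1 →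
    3 ≤ (∑ i, (p i ^^ q i).toNat) ∨ (1 ≤ ∑ i, (p i ^^ q i).toNat) ∧
      2 ≤ ∑ i, ((p i ^^ p (i + 1)).toNat + (q i ^^ q (i + 2)).toNat) := by decide +kernel

set_option maxRecDepth 20000 in
lemma rim_cut : ∀ p q : Fin 5 → Bool,
    (∀ i, p i = false ∧ q i = false) ∨ (∀ i, p i = true ∧ q i = true) ∨
    3 ≤ ∑ i, ((p i ^^ q i).toNat + ((p i ^^ p (i + 1)).toNat + (q i ^^ q (i + 2)).toNat)) := by
  decide +kernel

/-- Any perfect matching using the rim edge `z` uses exactly one of `x` and `y`, so `x` and `y`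
cannot have the same color. -/
lemma rim_separate : ∀ x y : Bool × Fin 5, x ≠ y →
    ∃ z, ∀ a, rimType a z → ¬ (rimType a x ↔ rimType a y) := by decide +kernel

/-- A perfect matching that uses rim edges but neither `y` nor `z` contains `x` and has its spoke at
a position other than `j`. Avoiding just two rim edges thus separates `x` from the spokes at `j`. -/
lemma rim_avoid : ∀ (x : Bool × Fin 5) (j : Fin 5), rimType j x →
    ∃ y z, ∀ a, rimType a y ∨ rimType a z ∨ (rimType a x ∧ a ≠ j) := by decide +kernel

lemma rim_distinguish : ∀ v w : Bool × Fin 5, v ≠ w →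
    ∃ x, rimInc x v ∧ ¬ rimInc x w := by decide +kernel

lemma rimNext_ne : ∀ b i, i ≠ rimNext b i := by decide

open scoped Classical
namespace FinGraph

/-- The Petersen graph with every spoke replaced by `k` parallel edges. -/
def pet (k : ℕ) : FinGraph where
  V := Bool × Fin 5
  E := (Bool × Fin 5) ⊕ (Fin 5 × Fin k)
  s e := match e with
    | .inl x => x
    | .inr y => (false, y.1)
  t e := match e with
    | .inl x => (x.1, rimNext x.1 x.2)
    | .inr y => (true, y.1)
  ne e := by
    cases e with
    | inl x => intro h; exact rimNext_ne x.1 x.2 (congrArg Prod.snd h)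
    | inr y => intro h; exact Bool.false_ne_true (congrArg Prod.fst h)

variable {k : ℕ}

/-- A vertex of the Petersen graph. -/
def pv (k : ℕ) (b : Bool) (i : Fin 5) : (pet k).V := (b, i)
/-- A rim edge. -/
def rim (k : ℕ) (x : Bool × Fin 5) : (pet k).E := Sum.inl x
/-- A spoke. -/
def spoke (i : Fin 5) (t : Fin k) : (pet k).E := Sum.inr (i, t)

lemma pet_cases (e : (pet k).E) : (∃ x, e = rim k x) ∨ ∃ i t, e = spoke i t := by
  rcases e with x | y
  · exact Or.inl ⟨x, rfl⟩
  · exact Or.inr ⟨y.1, y.2, rfl⟩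

lemma rim_link (b : Bool) (i : Fin 5) : (pet k).Link (rim k (b, i)) (pv k b i) (pv k b (rimNext b i)) :=
  Or.inl ⟨rfl, rfl⟩
lemma spoke_link (i : Fin 5) (t : Fin k) : (pet k).Link (spoke i t) (pv k false i) (pv k true i) :=
  Or.inl ⟨rfl, rfl⟩

lemma rim_injective : Function.Injective (rim k) := Sum.inl_injective
lemma spoke_inj {i j : Fin 5} {t u : Fin k} : spoke i t = spoke j u ↔ i = j ∧ t = u := by
  constructor
  · intro h; exact Prod.mk.inj (Sum.inr_injective h)
  · rintro ⟨rfl, rfl⟩; rfl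
lemma rim_ne_spoke {x : Bool × Fin 5} {i : Fin 5} {t : Fin k} : rim k x ≠ spoke i t :=
  Sum.inl_ne_inr

lemma pv_inj {b c : Bool} {i j : Fin 5} : pv k b i = pv k c j ↔ b = c ∧ i = j := Prod.mk_inj
lemma exists_pv (v : (pet k).V) : ∃ b i, v = pv k b i := ⟨v.1, v.2, rfl⟩

lemma rim_inc {x : Bool × Fin 5} {b : Bool} {i : Fin 5} :
    (pet k).Inc (rim k x) (pv k b i) ↔ rimInc x (b, i) := by
  unfold rimInc
  rw [Bool.or_eq_true, decide_eq_true_iff, decide_eq_true_iff]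
  rfl

lemma spoke_inc {j : Fin 5} {t : Fin k} {b : Bool} {i : Fin 5} :
    (pet k).Inc (spoke j t) (pv k b i) ↔ i = j := by
  constructor
  · intro h
    rcases (spoke_link j t).eq_or_eq h with h | h
    · exact (pv_inj.1 h).2
    · exact (pv_inj.1 h).2
  · rintro rfl
    cases b
    · exact (spoke_link i t).inc_left
    · exact (spoke_link i t).inc_right

lemma sum_pet {M : Type} [AddCommMonoid M] (w : (pet k).E → M) :
    ∑ e, w e = (∑ i, (w (rim k (false, i)) + w (rim k (true, i)))) + ∑ i, ∑ t, w (spoke i t) := by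
  have h1 : ∑ e, w e = ∑ x, w (rim k x) + ∑ y : Fin 5 × Fin k, w (spoke y.1 y.2) :=
    Fintype.sum_sum_type w
  rw [h1, Fintype.sum_prod_type, Fintype.sum_prod_type]
  rw [Fintype.sum_bool, sum_add_distrib, add_comm (∑ i, w (rim k (true, i)))]

lemma sum_pet_V {M : Type} [AddCommMonoid M] (w : (pet k).V → M) :
    ∑ e, w e = ∑ i, (w (pv k false i) + w (pv k true i)) := by
  have h1 : ∑ e, w e = ∑ x : Bool × Fin 5, w (pv k x.1 x.2) := rfl
  rw [h1, Fintype.sum_prod_type, Fintype.sum_bool, sum_add_distrib, add_comm]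

lemma toNat_xor_decide (a b : Prop) [Decidable a] [Decidable b] [Decidable (a ↔ b)] : (decide a ^^ decide b).toNat = if (a ↔ b) then 0 else 1 := by
  by_cases ha : a <;> by_cases hb : b <;> simp [ha, hb]

lemma card_cut_pet (S : Finset (pet k).V) {p q : Fin 5 → Bool}
    (hp : p = fun i => decide (pv k false i ∈ S)) (hq : q = fun i => decide (pv k true i ∈ S)) :
    #((pet k).cut S) = ∑ i, ((p i ^^ p (i + 1)).toNat + (q i ^^ q (i + 2)).toNat) +
      k * ∑ i, (p i ^^ q i).toNat := by
  rw [card_cut, sum_pet, mul_sum]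
  congr 1
  · refine sum_congr rfl fun i _ => ?_
    subst hp hq
    dsimp only
    rw [toNat_xor_decide, toNat_xor_decide]
    rfl
  · refine sum_congr rfl fun i _ => ?_
    subst hp hq
    dsimp only
    rw [toNat_xor_decide]
    have : ∀ t : Fin k, (if (pet k).s (spoke i t) ∈ S ↔ (pet k).t (spoke i t) ∈ S then 0 else 1) =
      (if (pv k false i ∈ S ↔ pv k true i ∈ S) then 0 else 1) := fun t => rfl
    rw [sum_congr rfl fun t _ => this t]
    simp

lemma card_pet_finset (S : Finset (pet k).V) :
    #S = ∑ i, ((decide (pv k false i ∈ S)).toNat + (decide (pv k true i ∈ S)).toNat) := by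
  have h : #S = ∑ v, if v ∈ S then 1 else 0 := by
    rw [← card_filter]; congr 1; ext; simp
  rw [h, sum_pet_V]
  refine sum_congr rfl fun i _ => ?_
  congr 1 <;> split_ifs with h <;> simp [h]

lemma pet_cut_odd (hk : 1 ≤ k) {S : Finset (pet k).V} (hS : Odd #S) : k + 2 ≤ #((pet k).cut S) := by
  rw [card_cut_pet S rfl rfl]
  rw [Nat.odd_iff, card_pet_finset] at hS
  rcases rim_cut_odd _ _ hS with h | ⟨h, h'⟩
  · have := Nat.mul_le_mul_left k h
    omega
  · have := Nat.mul_le_mul_left k h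
    omega

lemma pet_three_le_cut (hk : 1 ≤ k) {S : Finset (pet k).V} (hS : S.Nonempty) (hS' : S ≠ univ) :
    3 ≤ #((pet k).cut S) := by
  rw [card_cut_pet S rfl rfl]
  rcases rim_cut (fun i => decide (pv k false i ∈ S)) (fun i => decide (pv k true i ∈ S)) with h | h | h
  · obtain ⟨v, hv⟩ := hS
    obtain ⟨b, i, rfl⟩ := exists_pv v
    have := h i
    cases b <;> simp_all
  · exfalso; apply hS'
    rw [eq_univ_iff_forall]
    intro v
    obtain ⟨b, i, rfl⟩ := exists_pv v
    have := h i
    cases b <;> simp_all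
  · rw [sum_add_distrib] at h
    have := Nat.mul_le_mul_right (∑ i, (decide (pv k false i ∈ S) ^^ decide (pv k true i ∈ S)).toNat) hk
    omega

lemma pet_conn (hk : 1 ≤ k) : (pet k).Conn := by
  refine ⟨⟨pv k false 0⟩, fun S hS h => ?_⟩
  by_contra h'
  have := pet_three_le_cut hk hS h'
  rw [h] at this; simp at this

lemma pet_star (b : Bool) (i : Fin 5) : (pet k).star (pv k b i) =
    insert (rim k (b, i)) (insert (rim k (b, if b then i + 3 else i + 4))
      (univ.image (fun t => spoke i t))) := by
  ext e
  rw [mem_star]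
  simp only [mem_insert, mem_image, mem_univ, true_and]
  rcases pet_cases e with ⟨⟨c, j⟩, rfl⟩ | ⟨j, t, rfl⟩
  · rw [rim_inc, rim_injective.eq_iff, rim_injective.eq_iff]
    have h1 : ¬ ∃ t : Fin k, spoke i t = rim k (c, j) := by
      rintro ⟨t, h⟩; exact rim_ne_spoke h.symm
    simp only [h1, or_false]
    clear h1
    revert b i c j
    decide
  · rw [spoke_inc]
    simp only [rim_ne_spoke.symm, false_or, spoke_inj]
    constructor
    · rintro rfl; exact ⟨t, rfl, rfl⟩
    · rintro ⟨_, h, _⟩; exact h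

lemma card_pet_star (v : (pet k).V) : #((pet k).star v) = k + 2 := by
  obtain ⟨b, i, rfl⟩ := exists_pv v
  rw [pet_star, card_insert_of_notMem, card_insert_of_notMem, card_image_of_injective, card_univ,
    Fintype.card_fin]
  · intro t u h; exact (spoke_inj.1 h).2
  · simp only [mem_image, mem_univ, true_and, not_exists]
    intro t h; exact rim_ne_spoke h.symm
  · simp only [mem_insert, mem_image, mem_univ, true_and, not_or, not_exists]
    refine ⟨?_, fun t h => rim_ne_spoke h.symm⟩
    rw [rim_injective.eq_iff]
    revert b i; decide

lemma pet_isR (hk : 1 ≤ k) : (pet k).IsR (k + 2) := ⟨card_pet_star, fun _ => pet_cut_odd hk⟩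

/-- The perfect matchings of the Petersen graph with multiplied spokes. -/
lemma pet_pm {N : Finset (pet k).E} (hN : (pet k).PM N) :
    (∀ x, rim k x ∉ N) ∨ ∃ a, (∀ x, rim k x ∈ N ↔ rimType a x) ∧
      ∀ i t, spoke i t ∈ N → i = a := by
  have huniq : ∀ v e e', e ∈ N → e' ∈ N → (pet k).Inc e v → (pet k).Inc e' v → e = e' := by
    intro v e e' he he' hi hi'
    exact card_le_one.1 (hN v).le e (mem_inter.2 ⟨he, mem_star.2 hi⟩) e'
      (mem_inter.2 ⟨he', mem_star.2 hi'⟩)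
  have hex : ∀ v, ∃ e ∈ N, (pet k).Inc e v := by
    intro v
    obtain ⟨e, he⟩ := card_pos.1 ((hN v).symm ▸ Nat.one_pos)
    exact ⟨e, (mem_inter.1 he).1, mem_star.1 (mem_inter.1 he).2⟩
  -- The offsets `3 = -2` and `4 = -1` give the preceding rim edge at the vertex. The right side
  -- does not depend on `b`, which couples the two rims.
  have hcov : ∀ b i, (rim k (b, if b then i + 3 else i + 4) ∈ N ∨ rim k (b, i) ∈ N) ↔
      ¬ ∃ t : Fin k, spoke i t ∈ N := by
    intro b i
    constructor
    · rintro h ⟨t, ht⟩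
      have h1 : (pet k).Inc (spoke i t) (pv k b i) := spoke_inc.2 rfl
      rcases h with h | h
      · refine rim_ne_spoke (huniq (pv k b i) _ _ h ht (rim_inc.2 ?_) h1)
        clear h hN huniq hex ht h1
        revert b i; decide
      · exact rim_ne_spoke (huniq (pv k b i) _ _ h ht (rim_inc.2 (by simp [rimInc])) h1)
    · intro h
      obtain ⟨e, he, hi⟩ := hex (pv k b i)
      rw [← mem_star, pet_star] at hi
      simp only [mem_insert, mem_image, mem_univ, true_and] at hi
      rcases hi with rfl | rfl | ⟨t, rfl⟩
      · exact Or.inr he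
      · exact Or.inl he
      · exact absurd ⟨t, he⟩ h
  have hdis : ∀ b i, ¬ (rim k (b, i) ∈ N ∧ rim k (b, rimNext b i) ∈ N) := by
    rintro b i ⟨h, h'⟩
    have := huniq (pv k b (rimNext b i)) _ _ h h' (rim_link b i).inc_right
      (rim_link b (rimNext b i)).inc_left
    rw [rim_injective.eq_iff, Prod.mk_inj] at this
    exact rimNext_ne b i this.2
  rcases rim_matching (fun i => decide (rim k (false, i) ∈ N)) (fun i => decide (rim k (true, i) ∈ N))
    (by
      intro i
      have h1 := hdis false i
      have h2 := hdis true i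
      have h3 := (hcov false i).trans (hcov true i).symm
      simp only [rimNext, if_true, Bool.false_eq_true, if_false] at h1 h2 h3
      simp only [← Bool.decide_and, ← Bool.decide_or, Bool.and_eq_true, Bool.not_eq_true',
        decide_eq_false_iff_not, beq_iff_eq, decide_eq_decide]
      exact ⟨⟨h1, h2⟩, h3⟩) with h | ⟨a, h⟩
  · left
    rintro ⟨b, i⟩
    have := h i
    simp only [decide_eq_false_iff_not] at this
    cases b
    · exact this.1
    · exact this.2
  · right
    have hr : ∀ x, rim k x ∈ N ↔ rimType a x := by
      rintro ⟨b, i⟩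
      have := h i
      cases b
      · rw [← this.1, decide_eq_true_iff]
      · rw [← this.2, decide_eq_true_iff]
    refine ⟨a, hr, fun i t ht => ?_⟩
    have h1 := mt (hcov false i).1 (not_not.2 ⟨t, ht⟩)
    rw [hr, hr] at h1
    clear hr h hdis hcov hex huniq hN ht
    revert i a; decide

end FinGraph
end RGraphs

/-! ### Rigidity of the Petersen graph with multiplied spokes -/

namespace RGraphs
open Finset
open scoped Classical
namespace FinGraph
variable {G H K : FinGraph} {k : ℕ}

/-- Two maps from the edges of `pet k` to those of an `r`-graph which look like colorings, where
the colors of an edge under both maps are always in the same perfect matchings. -/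
structure PetPair (H : FinGraph) (k : ℕ) (F : Bool → (pet k).E → H.E) (σ : (pet k).V → Bool)
    (g : (pet k).V → H.V) : Prop where
  pm : ∀ N, H.PM N → (pet k).PM (univ.filter (fun e => F false e ∈ N))
  mem_iff : ∀ N, H.PM N → ∀ b e, F b e ∈ N ↔ F false e ∈ N
  spoke : ∀ b i t, F b (spoke i t) = F false (spoke i t)
  star : ∀ v, ((pet k).star v).image (F (σ v)) = H.star (g v)

variable {F : Bool → (pet k).E → H.E} {σ : (pet k).V → Bool} {g : (pet k).V → H.V}

lemma PetPair.type (h : PetPair H k F σ g) {N : Finset H.E} (hN : H.PM N) :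
    (∀ b x, F b (rim k x) ∉ N) ∨ ∃ a, (∀ b x, F b (rim k x) ∈ N ↔ rimType a x) ∧
      ∀ b i t, F b (FinGraph.spoke i t) ∈ N → i = a := by
  rcases pet_pm (h.pm N hN) with h1 | ⟨a, h1, h2⟩
  · left
    intro b x
    rw [h.mem_iff N hN]
    simpa using h1 x
  · right
    refine ⟨a, fun b x => ?_, fun b i t hi => h2 i t ?_⟩
    · rw [h.mem_iff N hN]
      simpa using h1 x
    · rw [h.mem_iff N hN] at hi
      simpa using hi

lemma PetPair.rim_inj (h : PetPair H k F σ g) (hH : H.IsR (k + 2)) {b c : Bool}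
    {x y : Bool × Fin 5} (hxy : F b (rim k x) = F c (rim k y)) : x = y := by
  by_contra hne
  obtain ⟨z, hz⟩ := rim_separate x y hne
  obtain ⟨N, hN, hzN⟩ := hH.exists_pm_mem (F false (rim k z)) (by omega)
  rcases h.type hN with h1 | ⟨a, h1, -⟩
  · exact h1 _ _ hzN
  · refine hz a ((h1 _ _).1 hzN) ?_
    rw [← h1 b, ← h1 c, hxy]

lemma PetPair.rim_ne_spoke (h : PetPair H k F σ g) (hH : H.IsR (k + 2)) (b c : Bool)
    (x : Bool × Fin 5) (j : Fin 5) (t : Fin k) : F b (rim k x) ≠ F c (FinGraph.spoke j t) := by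
  intro hxj
  -- A matching through the common color contains the rim edge `x` and a spoke at `j`, so it is of
  -- type `j`.
  have hx : rimType j x := by
    obtain ⟨N, hN, hxN⟩ := hH.exists_pm_mem (F b (rim k x)) (by omega)
    rcases h.type hN with h1 | ⟨a, h1, h2⟩
    · exact absurd hxN (h1 _ _)
    · have h3 := (h1 _ _).1 hxN
      rw [hxj] at hxN
      rwa [h2 _ _ _ hxN]
  obtain ⟨y, z, hyz⟩ := rim_avoid x j hx
  -- The colors to avoid are those of `y`, `z` and the `k - 1` copies of the spoke parallel to the
  -- given one: at most `k + 1 = r - 1` edges.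
  have hcard : #({F false (rim k y), F false (rim k z)} ∪
      (univ.erase t).image (fun u => F false (FinGraph.spoke j u))) < k + 2 := by
    refine lt_of_le_of_lt (card_union_le _ _) ?_
    have h1 := card_le_two (a := F false (rim k y)) (b := F false (rim k z))
    have h2 : #((univ.erase t).image (fun u => F false (FinGraph.spoke j u))) ≤ k - 1 := by
      refine card_image_le.trans ?_
      rw [card_erase_of_mem (mem_univ t), card_univ, Fintype.card_fin]
    have := t.pos
    omega
  obtain ⟨N, hN, hd⟩ := hH.exists_pm _ hcard
  rw [disjoint_right] at hd
  have hy : F false (rim k y) ∉ N := hd (by simp)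
  have hz : F false (rim k z) ∉ N := hd (by simp)
  have hu : ∀ u, u ≠ t → F false (FinGraph.spoke j u) ∉ N := fun u hu =>
    hd (mem_union_right _ (mem_image_of_mem (fun u => F false (FinGraph.spoke j u))
      (mem_erase.2 ⟨hu, mem_univ u⟩)))
  -- If no rim edge is used, the vertex at `j` is covered by copy `t`, whose color is that of the
  -- rim edge `x`. Otherwise the matching contains `x` and is not of type `j`, although the color of
  -- `x` is that of a spoke at `j`.
  rcases h.type hN with h1 | ⟨a, h1, h2⟩
  · have hpm := h.pm N hN (pv k false j)
    obtain ⟨e, he⟩ := card_pos.1 (hpm.symm ▸ Nat.one_pos)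
    simp only [mem_inter, mem_filter, mem_univ, true_and, mem_star] at he
    obtain ⟨he, hi⟩ := he
    rcases pet_cases e with ⟨w, rfl⟩ | ⟨i, u, rfl⟩
    · exact h1 _ _ he
    · rw [spoke_inc] at hi
      subst hi
      by_cases hut : u = t
      · subst hut
        rw [← h.mem_iff N hN c, ← hxj] at he
        exact h1 _ _ he
      · exact hu u hut he
  · rcases hyz a with h3 | h3 | ⟨h3, h4⟩
    · exact hy ((h1 _ _).2 h3)
    · exact hz ((h1 _ _).2 h3)
    · have h5 := (h1 b x).2 h3
      rw [hxj] at h5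
      exact h4 (h2 _ _ _ h5).symm

lemma PetPair.inc (h : PetPair H k F σ g) {e : (pet k).E} {v : (pet k).V}
    (he : (pet k).Inc e v) : H.Inc (F (σ v) e) (g v) := by
  rw [← mem_star, ← h.star]
  exact mem_image_of_mem _ (mem_star.2 he)

/-- Take a rim edge at `v` but not at `w`. If the images agree, its color also occurs at `w`, on a
different rim edge or on a spoke; both are excluded. -/
lemma PetPair.vertex_injective (h : PetPair H k F σ g) (hH : H.IsR (k + 2)) :
    Function.Injective g := by
  intro v w hvw
  by_contra hne
  obtain ⟨b, i, rfl⟩ := exists_pv v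
  obtain ⟨c, j, rfl⟩ := exists_pv w
  obtain ⟨x, hx1, hx2⟩ := rim_distinguish (b, i) (c, j) hne
  have h1 := h.inc (rim_inc.2 hx1)
  rw [hvw, ← mem_star, ← h.star] at h1
  obtain ⟨e, he, hee⟩ := mem_image.1 h1
  rcases pet_cases e with ⟨y, rfl⟩ | ⟨l, t, rfl⟩
  · have := h.rim_inj hH hee
    subst this
    exact hx2 (rim_inc.1 (mem_star.1 he))
  · exact h.rim_ne_spoke hH _ _ _ _ _ hee.symm

lemma PetPair.injective (h : PetPair H k F σ g) (hH : H.IsR (k + 2)) {b c : Bool}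
    {e e' : (pet k).E} (hee : F b e = F c e') : e = e' := by
  rcases pet_cases e with ⟨x, rfl⟩ | ⟨i, t, rfl⟩ <;> rcases pet_cases e' with ⟨y, rfl⟩ | ⟨j, u, rfl⟩
  · rw [h.rim_inj hH hee]
  · exact absurd hee (h.rim_ne_spoke hH _ _ _ _ _)
  · exact absurd hee.symm (h.rim_ne_spoke hH _ _ _ _ _)
  · rw [h.spoke b, h.spoke c] at hee
    by_cases hij : i = j
    · subst hij
      have h1 : Set.InjOn (F (σ (pv k false i))) ((pet k).star (pv k false i)) := by
        rw [← card_image_iff, h.star, hH.1, card_pet_star]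
      apply h1
      · exact mem_star.2 (spoke_inc.2 rfl)
      · exact mem_star.2 (spoke_inc.2 rfl)
      · exact (h.spoke _ _ _).trans (hee.trans (h.spoke _ _ _).symm)
    -- The color is an edge between the distinct images of the two vertices at position `i`, so it
    -- cannot be incident with a third image at position `j`.
    · exfalso
      have h1 : ∀ d, H.Inc (F false (FinGraph.spoke i t)) (g (pv k d i)) := by
        intro d
        have := h.inc (e := FinGraph.spoke i t) (v := pv k d i) (spoke_inc.2 rfl)
        rwa [h.spoke] at this
      have h2 : H.Inc (F false (FinGraph.spoke i t)) (g (pv k false j)) := by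
        have := h.inc (e := FinGraph.spoke j u) (v := pv k false j) (spoke_inc.2 rfl)
        rwa [h.spoke, ← hee] at this
      have hgi := h.vertex_injective hH
      have h3 : g (pv k false i) ≠ g (pv k true i) := by
        rw [Ne, hgi.eq_iff, pv_inj]; simp
      rcases (link_of_inc (h1 false) (h1 true) h3).eq_or_eq h2 with h4 | h4
      · rw [hgi.eq_iff, pv_inj] at h4; exact hij h4.2.symm
      · rw [hgi.eq_iff, pv_inj] at h4; exact hij h4.2.symm

lemma petPair_of_isCol {f : (pet k).E → H.E} (hf : IsCol (pet k) H f) {g : (pet k).V → H.V}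
    (hg : ∀ v, ((pet k).star v).image f = H.star (g v)) :
    PetPair H k (fun _ => f) (fun _ => false) g :=
  ⟨fun _ hN => hf.pm_preimage hN, fun _ _ _ _ => Iff.rfl, fun _ _ _ => rfl, hg⟩

/-- The Petersen graph with multiplied spokes is only colored by itself. -/
theorem pet_rigid (hk : 1 ≤ k) : (pet k).Rigid (k + 2) := by
  refine ⟨pet_isR hk, pet_conn hk, fun H hH hHc hcol => ?_⟩
  obtain ⟨f, hf⟩ := hcol
  obtain ⟨g, hg⟩ := hf.exists_map
  have hi := (petPair_of_isCol hf hg).vertex_injective hH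
  refine hf.iso hg ⟨hi, ?_⟩
  -- A leaving edge would need an edge with identified ends.
  have h1 : H.cut (univ.image g) = ∅ := by
    rw [eq_empty_iff_forall_notMem]
    intro h hh
    obtain ⟨e, x, y, hl, -, hxy⟩ := exists_identified hg hh
    exact hl.ne (hi hxy)
  have : Nonempty (pet k).V := ⟨pv k false 0⟩
  have h2 := hHc.2 _ (univ_nonempty.image g) h1
  intro w
  have : w ∈ univ.image g := by rw [h2]; exact mem_univ w
  obtain ⟨a, -, ha⟩ := mem_image.1 this
  exact ⟨a, ha⟩

end FinGraph
end RGraphs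

/-! ### Replacing edges by gadgets -/

namespace RGraphs
open Finset
open scoped Classical
namespace FinGraph
variable {G H K : FinGraph} {k : ℕ}

/-- The rim edge removed from the Petersen graph to obtain the gadget. -/
def rim₀ (k : ℕ) : (pet k).E := rim k (false, 0)

/-- The end of `rim₀` to which the first (`false`) or second (`true`) attachment edge goes. -/
def rimEnd (k : ℕ) (c : Bool) : (pet k).V := if c then pv k false 1 else pv k false 0

lemma rimEnd_injective : Function.Injective (rimEnd k) := by
  intro c d h
  cases c <;> cases d <;> simp_all [rimEnd, pv_inj]

lemma rim₀_link : (pet k).Link (rim₀ k) (rimEnd k false) (rimEnd k true) := rim_link false 0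

lemma rim₀_inc {w : (pet k).V} : (pet k).Inc (rim₀ k) w ↔ ∃ c, w = rimEnd k c := by
  constructor
  · intro h
    rcases rim₀_link.eq_or_eq h with h | h
    · exact ⟨_, h⟩
    · exact ⟨_, h⟩
  · rintro ⟨c, rfl⟩
    cases c
    · exact rim₀_link.inc_left
    · exact rim₀_link.inc_right

/-- Which attachment edge is used at a vertex of the gadget. -/
noncomputable def rimSide (w : (pet k).V) : Bool := decide (w = rimEnd k true)

lemma rimSide_rimEnd (c : Bool) : rimSide (rimEnd k c) = c := by
  unfold rimSide
  rw [rimEnd_injective.eq_iff]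
  cases c <;> simp

/-- One of the two ends of an edge. -/
def endOf (G : FinGraph) (e : G.E) (c : Bool) : G.V := if c then G.t e else G.s e

lemma inc_endOf (e : G.E) (c : Bool) : G.Inc e (G.endOf e c) := by
  cases c
  · exact inc_s e
  · exact inc_t e

lemma inc_iff_endOf {e : G.E} {v : G.V} : G.Inc e v ↔ ∃ c, G.endOf e c = v := by
  simp [Inc, endOf]

/-- Replace every edge of `G` by a copy of `pet k` minus a rim edge. -/
noncomputable def subst (G : FinGraph) (k : ℕ) : FinGraph where
  V := G.V ⊕ (G.E × (pet k).V)
  E := (G.E × Bool) ⊕ (G.E × {x : (pet k).E // x ≠ rim₀ k})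
  s e := match e with
    | .inl y => .inl (G.endOf y.1 y.2)
    | .inr y => .inr (y.1, (pet k).s y.2.1)
  t e := match e with
    | .inl y => .inr (y.1, rimEnd k y.2)
    | .inr y => .inr (y.1, (pet k).t y.2.1)
  ne e := by
    cases e with
    | inl y => exact Sum.inl_ne_inr
    | inr y => intro h; exact (pet k).ne y.2.1 (congrArg Prod.snd (Sum.inr_injective h))

/-- A vertex of the original graph. -/
def orig (k : ℕ) (v : G.V) : (G.subst k).V := Sum.inl v
/-- A vertex of a gadget. -/
def inn (e : G.E) (w : (pet k).V) : (G.subst k).V := Sum.inr (e, w)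
/-- The edge of the substituted graph corresponding to the edge `x` of `pet k` in the gadget
for `e`; the removed edge corresponds to the two attachment edges. -/
noncomputable def gad (e : G.E) (c : Bool) (x : (pet k).E) : (G.subst k).E :=
  if h : x = rim₀ k then Sum.inl (e, c) else Sum.inr (e, ⟨x, h⟩)
/-- An attachment edge. -/
noncomputable def att (k : ℕ) (e : G.E) (c : Bool) : (G.subst k).E := gad e c (rim₀ k)
/-- The edge of `G` whose gadget contains a given edge. -/
def owner (x : (G.subst k).E) : G.E := Sum.elim Prod.fst Prod.fst x

lemma gad_rim₀ (e : G.E) (c : Bool) : gad e c (rim₀ k) = att k e c := rfl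

lemma att_eq (e : G.E) (c : Bool) : att k e c = Sum.inl (e, c) := dif_pos rfl

lemma gad_eq {x : (pet k).E} (h : x ≠ rim₀ k) (e : G.E) (c : Bool) :
    gad e c x = (Sum.inr (e, ⟨x, h⟩) : (G.subst k).E) := dif_neg h

lemma gad_congr {x : (pet k).E} (h : x ≠ rim₀ k) (e : G.E) (c d : Bool) :
    gad e c x = gad e d x := by rw [gad_eq h, gad_eq h]

@[simp] lemma owner_gad (e : G.E) (c : Bool) (x : (pet k).E) : owner (gad e c x) = e := by
  by_cases h : x = rim₀ k
  · rw [h, gad_rim₀, att_eq]; rfl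
  · rw [gad_eq h]; rfl

@[simp] lemma owner_att (e : G.E) (c : Bool) : owner (att k e c) = e := owner_gad e c _

lemma subst_cases (x : (G.subst k).E) :
    (∃ e c, x = att k e c) ∨ ∃ e c y, y ≠ rim₀ k ∧ x = gad e c y := by
  rcases x with y | y
  · exact Or.inl ⟨y.1, y.2, (att_eq _ _).symm⟩
  · exact Or.inr ⟨y.1, false, y.2.1, y.2.2, (gad_eq y.2.2 _ _).symm⟩

lemma substV_cases (v : (G.subst k).V) : (∃ u, v = orig k u) ∨ ∃ e w, v = inn e w := by
  rcases v with v | v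
  · exact Or.inl ⟨v, rfl⟩
  · exact Or.inr ⟨v.1, v.2, rfl⟩

lemma orig_injective : Function.Injective (orig (G := G) k) := Sum.inl_injective
lemma inn_inj {e e' : G.E} {w w' : (pet k).V} : inn e w = inn e' w' ↔ e = e' ∧ w = w' :=
  ⟨fun h => Prod.mk.inj (Sum.inr_injective h), by rintro ⟨rfl, rfl⟩; rfl⟩
lemma orig_ne_inn {v : G.V} {e : G.E} {w : (pet k).V} : orig k v ≠ inn e w := Sum.inl_ne_inr

lemma gad_inj {e : G.E} {c d : Bool} {x y : (pet k).E} (h : gad e c x = gad e d y) : x = y := by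
  by_cases hx : x = rim₀ k <;> by_cases hy : y = rim₀ k
  · rw [hx, hy]
  · rw [hx, gad_rim₀, att_eq, gad_eq hy] at h; exact absurd h Sum.inl_ne_inr
  · rw [hy, gad_rim₀, att_eq, gad_eq hx] at h; exact absurd h.symm Sum.inl_ne_inr
  · rw [gad_eq hx, gad_eq hy] at h
    exact congrArg (fun z => z.2.1) (Sum.inr_injective h)

lemma att_inj {e e' : G.E} {c d : Bool} : att k e c = att k e' d ↔ e = e' ∧ c = d := by
  rw [att_eq, att_eq]
  exact ⟨fun h => Prod.mk.inj (Sum.inl_injective h), by rintro ⟨rfl, rfl⟩; rfl⟩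

lemma att_link (e : G.E) (c : Bool) :
    (G.subst k).Link (att k e c) (orig k (G.endOf e c)) (inn e (rimEnd k c)) := by
  rw [att_eq]; exact Or.inl ⟨rfl, rfl⟩

lemma gad_link {x : (pet k).E} (h : x ≠ rim₀ k) (e : G.E) (c : Bool) {y z : (pet k).V}
    (hl : (pet k).Link x y z) : (G.subst k).Link (gad e c x) (inn e y) (inn e z) := by
  rw [gad_eq h]
  rcases hl with ⟨rfl, rfl⟩ | ⟨rfl, rfl⟩
  · exact Or.inl ⟨rfl, rfl⟩
  · exact Or.inr ⟨rfl, rfl⟩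

lemma att_inc_orig {e : G.E} {c : Bool} {v : G.V} :
    (G.subst k).Inc (att k e c) (orig k v) ↔ G.endOf e c = v := by
  constructor
  · intro h
    rcases (att_link e c).eq_or_eq h with h | h
    · exact (orig_injective h).symm
    · exact absurd h orig_ne_inn
  · rintro rfl; exact (att_link e c).inc_left

lemma gad_not_inc_orig {x : (pet k).E} (h : x ≠ rim₀ k) {e : G.E} {c : Bool} {v : G.V} :
    ¬ (G.subst k).Inc (gad e c x) (orig k v) := by
  intro hi
  rcases (gad_link h e c (link_s_t x)).eq_or_eq hi with h | h <;> exact orig_ne_inn h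

lemma subst_star_orig (v : G.V) : (G.subst k).star (orig k v) =
    (G.star v).image (fun e => att k e (decide (G.t e = v))) := by
  ext x
  rw [mem_star, mem_image]
  rcases subst_cases x with ⟨e, c, rfl⟩ | ⟨e, c, y, hy, rfl⟩
  · rw [att_inc_orig]
    constructor
    · rintro rfl
      refine ⟨e, mem_star.2 (inc_endOf e c), ?_⟩
      rw [att_inj]
      refine ⟨rfl, ?_⟩
      have := G.ne e
      cases c <;> simp [endOf, Ne.symm this]
    · rintro ⟨e', he', h⟩
      rw [att_inj] at h
      obtain ⟨rfl, rfl⟩ := h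
      rcases mem_star.1 he' with h | h
      · by_cases ht : G.t e' = v
        · simp [endOf, ht]
        · simp [endOf, ht, h]
      · simp [endOf, h]
  · simp only [gad_not_inc_orig hy, false_iff, not_exists, not_and]
    intro e' _ h
    have h1 := congrArg owner h
    rw [owner_att, owner_gad] at h1
    subst h1
    exact hy (gad_inj h).symm

lemma subst_star_inn (e : G.E) (w : (pet k).V) : (G.subst k).star (inn e w) =
    ((pet k).star w).image (gad e (rimSide w)) := by
  ext x
  rw [mem_star, mem_image]
  rcases subst_cases x with ⟨e', c, rfl⟩ | ⟨e', c, y, hy, rfl⟩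
  · constructor
    · intro h
      rcases (att_link e' c).eq_or_eq h with h | h
      · exact absurd h.symm orig_ne_inn
      · rw [inn_inj] at h
        obtain ⟨rfl, rfl⟩ := h
        refine ⟨rim₀ k, mem_star.2 (rim₀_inc.2 ⟨c, rfl⟩), ?_⟩
        rw [rimSide_rimEnd]; rfl
    · rintro ⟨z, hz, h⟩
      have h1 := congrArg owner h
      rw [owner_att, owner_gad] at h1
      subst h1
      have h2 : z = rim₀ k := gad_inj h
      subst h2
      obtain ⟨d, rfl⟩ := rim₀_inc.1 (mem_star.1 hz)
      rw [gad_rim₀, att_inj, rimSide_rimEnd] at h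
      obtain ⟨-, rfl⟩ := h
      exact (att_link e d).inc_right
  · have hl := gad_link hy e' c (link_s_t y)
    constructor
    · intro h
      have h2 : e = e' ∧ (pet k).Inc y w := by
        rcases hl.eq_or_eq h with h | h
        · rw [inn_inj] at h; exact ⟨h.1, Or.inl h.2.symm⟩
        · rw [inn_inj] at h; exact ⟨h.1, Or.inr h.2.symm⟩
      obtain ⟨rfl, h2⟩ := h2
      exact ⟨y, mem_star.2 h2, gad_congr hy _ _ _⟩
    · rintro ⟨z, hz, h⟩
      have h1 := congrArg owner h
      rw [owner_gad, owner_gad] at h1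
      subst h1
      have h2 := gad_inj h
      subst h2
      rcases mem_star.1 hz with h3 | h3
      · rw [← h3]; exact hl.inc_left
      · rw [← h3]; exact hl.inc_right

lemma card_subst_star {r : ℕ} (hG : ∀ v, #(G.star v) = r) (hr : r = k + 2) (v : (G.subst k).V) :
    #((G.subst k).star v) = r := by
  rcases substV_cases v with ⟨u, rfl⟩ | ⟨e, w, rfl⟩
  · rw [subst_star_orig, card_image_of_injective, hG]
    intro e e' h
    exact (att_inj.1 h).1
  · rw [subst_star_inn, card_image_of_injective, card_pet_star, hr]
    intro x y h
    exact gad_inj h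

/-- The part of a vertex set in a gadget. -/
noncomputable def gadPart (S : Finset (G.subst k).V) (e : G.E) : Finset (pet k).V :=
  univ.filter (fun w => inn e w ∈ S)

/-- The part of a vertex set in the original graph. -/
noncomputable def origPart (S : Finset (G.subst k).V) : Finset G.V :=
  univ.filter (fun v => orig k v ∈ S)

lemma mem_gadPart {S : Finset (G.subst k).V} {e : G.E} {w : (pet k).V} :
    w ∈ gadPart S e ↔ inn e w ∈ S := by simp [gadPart]

lemma mem_origPart {S : Finset (G.subst k).V} {v : G.V} :
    v ∈ origPart S ↔ orig k v ∈ S := by simp [origPart]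

lemma card_subst_finset (S : Finset (G.subst k).V) :
    #S = #(origPart S) + ∑ e, #(gadPart S e) := by
  have h : #S = ∑ v, if v ∈ S then 1 else 0 := by
    rw [← card_filter]; congr 1; ext; simp
  have h2 : ∑ v, (if v ∈ S then 1 else 0) = ∑ v, (if orig k v ∈ S then 1 else 0) +
      ∑ y : G.E × (pet k).V, (if inn y.1 y.2 ∈ S then 1 else 0) := Fintype.sum_sum_type _
  rw [h, h2, Fintype.sum_prod_type, origPart, card_filter]
  congr 1
  refine sum_congr rfl fun e _ => ?_
  rw [gadPart, card_filter]

lemma gad_mem_cut {S : Finset (G.subst k).V} {e : G.E} {c : Bool} {x : (pet k).E}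
    (hx : x ≠ rim₀ k) : gad e c x ∈ (G.subst k).cut S ↔ x ∈ (pet k).cut (gadPart S e) := by
  rw [(gad_link hx e c (link_s_t x)).mem_cut, FinGraph.mem_cut, mem_gadPart, mem_gadPart]

lemma att_mem_cut {S : Finset (G.subst k).V} {e : G.E} {c : Bool} :
    att k e c ∈ (G.subst k).cut S ↔ ¬ (G.endOf e c ∈ origPart S ↔ rimEnd k c ∈ gadPart S e) := by
  rw [(att_link e c).mem_cut, mem_gadPart, mem_origPart]

/-- Only the removed rim edge can leave the part in `pet k` without an interior gadget edge as
counterpart. -/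
lemma card_gadPart_cut_le (S : Finset (G.subst k).V) (e : G.E) :
    #((pet k).cut (gadPart S e)) ≤ #((G.subst k).cut S) + 1 := by
  have h1 : #(((pet k).cut (gadPart S e)).erase (rim₀ k)) ≤ #((G.subst k).cut S) := by
    apply card_le_card_of_injOn (gad e false)
    · intro x hx
      rw [mem_coe, mem_erase] at hx
      exact (gad_mem_cut hx.1).2 hx.2
    · intro x _ y _ h
      exact gad_inj h
  have := pred_card_le_card_erase (s := (pet k).cut (gadPart S e)) (a := rim₀ k)
  omega

/-- If neither attachment edge leaves `S`, then `S` separates the ends of the removed rim edge. As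
cuts of `pet k` have at least three edges, some interior edge of the gadget leaves `S`. -/
lemma exists_mem_cut_owner (hk : 1 ≤ k) {S : Finset (G.subst k).V} {e : G.E}
    (he : e ∈ G.cut (origPart S)) : ∃ x ∈ (G.subst k).cut S, owner x = e := by
  by_contra hcon
  push Not at hcon
  have h1 : ∀ c, G.endOf e c ∈ origPart S ↔ rimEnd k c ∈ gadPart S e := by
    intro c
    by_contra h
    exact hcon _ (att_mem_cut.2 h) (owner_att _ _)
  have h2 : rim₀ k ∈ (pet k).cut (gadPart S e) := by
    rw [rim₀_link.mem_cut, ← h1, ← h1]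
    rw [mem_cut] at he
    exact he
  obtain ⟨a, ha, b, hb, -⟩ := mem_cut_iff_link.1 h2
  have h3 := pet_three_le_cut hk ⟨a, ha⟩ (fun h => hb (h ▸ mem_univ b))
  have h4 : 0 < #(((pet k).cut (gadPart S e)).erase (rim₀ k)) := by
    rw [card_erase_of_mem h2]; omega
  obtain ⟨x, hx⟩ := card_pos.1 h4
  rw [mem_erase] at hx
  exact hcon _ ((gad_mem_cut (c := false) hx.1).2 hx.2) (owner_gad _ _ _)

theorem subst_isR (hk : 1 ≤ k) (hG : G.IsR (k + 2)) : (G.subst k).IsR (k + 2) := by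
  have hreg := card_subst_star (k := k) hG.1 rfl
  refine ⟨hreg, fun S hS => ?_⟩
  by_cases hodd : ∃ e, Odd #(gadPart S e)
  · obtain ⟨e, he⟩ := hodd
    have h1 := (pet_cut_odd hk he).trans (card_gadPart_cut_le S e)
    have h2 := sum_star S
    rw [sum_congr rfl fun v _ => hreg v, sum_const, smul_eq_mul] at h2
    -- The removed rim edge costs one, leaving at least `k + 1` edges; parity of the degree sum
    -- recovers the missing one.
    by_contra hlt
    have h3 : #((G.subst k).cut S) = k + 1 := by omega
    rw [h3] at h2
    have h4 : (#S * (k + 2)) % 2 = (k + 2) % 2 := by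
      rw [Nat.mul_mod, Nat.odd_iff.1 hS, one_mul, Nat.mod_mod]
    omega
  · push Not at hodd
    have h1 : Odd #(origPart S) := by
      rw [card_subst_finset] at hS
      have h2 : Even (∑ e, #(gadPart S e)) :=
        even_sum _ fun e _ => Nat.not_odd_iff_even.1 (hodd e)
      exact (Nat.odd_add.1 hS).2 h2
    refine (hG.2 _ h1).trans ?_
    have h2 : G.cut (origPart S) ⊆ ((G.subst k).cut S).image owner := by
      intro e he
      obtain ⟨x, hx, rfl⟩ := exists_mem_cut_owner hk he
      exact mem_image_of_mem _ hx
    exact (card_le_card h2).trans card_image_le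

theorem subst_conn (hk : 1 ≤ k) (hG : G.Conn) : (G.subst k).Conn := by
  obtain ⟨⟨v₀⟩, hG⟩ := hG
  refine ⟨⟨orig k v₀⟩, fun S hS hcut => ?_⟩
  have h1 : ∀ e, gadPart S e = ∅ ∨ gadPart S e = univ := by
    intro e
    by_contra h
    push Not at h
    have h3 := pet_three_le_cut hk h.1 h.2
    have h4 := card_gadPart_cut_le S e
    rw [hcut, card_empty] at h4
    omega
  have h2 : ∀ e c, G.endOf e c ∈ origPart S ↔ rimEnd k c ∈ gadPart S e := by
    intro e c
    by_contra h
    have := att_mem_cut.2 h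
    rw [hcut] at this
    exact notMem_empty _ this
  have h3 : origPart S = univ := by
    apply hG
    · obtain ⟨v, hv⟩ := hS
      rcases substV_cases v with ⟨u, rfl⟩ | ⟨e, w, rfl⟩
      · exact ⟨u, mem_origPart.2 hv⟩
      · refine ⟨G.endOf e false, (h2 e false).2 ?_⟩
        rcases h1 e with h | h
        · rw [← mem_gadPart, h] at hv; exact absurd hv (notMem_empty _)
        · rw [h]; exact mem_univ _
    · rw [eq_empty_iff_forall_notMem]
      intro e he
      obtain ⟨x, hx, -⟩ := exists_mem_cut_owner hk he
      rw [hcut] at hx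
      exact notMem_empty _ hx
  rw [eq_univ_iff_forall]
  intro v
  rcases substV_cases v with ⟨u, rfl⟩ | ⟨e, w, rfl⟩
  · rw [← mem_origPart, h3]; exact mem_univ _
  · rcases h1 e with h | h
    · have := (h2 e false).1 (by rw [h3]; exact mem_univ _)
      rw [h] at this; exact absurd this (notMem_empty _)
    · rw [← mem_gadPart, h]; exact mem_univ _

end FinGraph
end RGraphs

/-! ### Colorings of substituted graphs; collapsed gadgets -/

namespace RGraphs
open Finset
open scoped Classical
namespace FinGraph
variable {G H K : FinGraph} {k : ℕ}

/-- The edges leaving a gadget. -/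
lemma cut_image_inn (e : G.E) :
    (G.subst k).cut (univ.image (inn e)) = {att k e false, att k e true} := by
  have h1 : ∀ e' w, inn e' w ∈ univ.image (inn (k := k) e) ↔ e' = e := by
    intro e' w
    simp only [mem_image, mem_univ, true_and, inn_inj]
    constructor
    · rintro ⟨_, h, -⟩; exact h.symm
    · rintro rfl; exact ⟨w, rfl, rfl⟩
  have h2 : ∀ v, orig k v ∉ univ.image (inn (k := k) e) := by
    intro v h
    obtain ⟨w, -, h⟩ := mem_image.1 h
    exact orig_ne_inn h.symm
  ext x
  rcases subst_cases x with ⟨e', c, rfl⟩ | ⟨e', c, y, hy, rfl⟩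
  · rw [(att_link e' c).mem_cut, h1, mem_insert, mem_singleton, att_inj, att_inj]
    simp only [h2, false_iff, not_not]
    cases c <;> simp
  · rw [(gad_link hy e' c (link_s_t y)).mem_cut, h1, h1, mem_insert, mem_singleton]
    simp only [not_true_eq_false, false_iff, not_or]
    constructor <;>
    · intro h
      have h1 := congrArg owner h
      rw [owner_att, owner_gad] at h1
      subst h1
      exact hy (gad_inj h)

/-- The gadget is an even set with two leaving edges, so a perfect matching contains both or
neither. -/
lemma PM.att_mem {M : Finset (G.subst k).E} (hM : (G.subst k).PM M) (e : G.E) :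
    att k e true ∈ M ↔ att k e false ∈ M := by
  have h1 := hM.parity (univ.image (inn e))
  have h2 : #(univ.image (inn (k := k) e)) = 10 := by
    rw [card_image_of_injective]
    · rfl
    · intro w w' h; exact (inn_inj.1 h).2
  rw [h2, cut_image_inn] at h1
  have h3 : att k e false ≠ att k e true := by rw [Ne, att_inj]; simp
  by_cases ha : att k e true ∈ M <;> by_cases hb : att k e false ∈ M
  · simp [ha, hb]
  · rw [inter_insert_of_notMem hb, inter_singleton_of_mem ha, card_singleton] at h1
    omega
  · rw [inter_insert_of_mem hb, inter_singleton_of_notMem ha, insert_empty_eq, card_singleton] at h1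
    omega
  · simp [ha, hb]

section coloring
variable {f : (G.subst k).E → H.E} {g : (G.subst k).V → H.V}

/-- The two attachment edges play the part of the removed rim edge, each at its own end, and may
have different colors; hence two edge maps. No perfect matching of `H` tells these colors apart,
which is all that the separation arguments for `pet k` require. -/
lemma petPair_gad (hf : IsCol (G.subst k) H f)
    (hg : ∀ v, ((G.subst k).star v).image f = H.star (g v)) (e : G.E) :
    PetPair H k (fun c x => f (gad e c x)) rimSide (fun w => g (inn e w)) := by
  have hmem : ∀ N, H.PM N → ∀ b x, f (gad e b x) ∈ N ↔ f (gad e false x) ∈ N := by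
    intro N hN b x
    by_cases hx : x = rim₀ k
    · subst hx
      cases b
      · rfl
      · have := (hf.pm_preimage hN).att_mem e
        simpa [gad_rim₀] using this
    · rw [gad_congr hx e b false]
  refine ⟨fun N hN w => ?_, hmem, fun b i t => ?_, fun w => ?_⟩
  · rw [← hf.pm_preimage hN (inn e w), subst_star_inn,
      ← card_image_of_injective (f := gad e (rimSide w)) _ (fun x y h => gad_inj h)]
    congr 1
    ext y
    simp only [mem_image, mem_inter, mem_filter, mem_univ, true_and]
    constructor
    · rintro ⟨x, ⟨h1, h2⟩, rfl⟩
      exact ⟨(hmem N hN _ _).2 h1, x, h2, rfl⟩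
    · rintro ⟨h1, x, h2, rfl⟩
      exact ⟨x, ⟨(hmem N hN _ _).1 h1, h2⟩, rfl⟩
  · exact congrArg f (gad_congr (rim_ne_spoke).symm _ _ _)
  · rw [← hg, subst_star_inn, image_image]
    rfl

/-- If the attachment edges of a gadget have the same color, the Petersen graph is colored. -/
lemma col_pet_of_collapsed (hH : H.IsR (k + 2)) (hf : IsCol (G.subst k) H f)
    (hg : ∀ v, ((G.subst k).star v).image f = H.star (g v)) {e : G.E}
    (he : f (att k e false) = f (att k e true)) :
    IsCol (pet k) H (fun x => f (gad e false x)) := by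
  refine isCol_of_image_eq card_pet_star hH.1 (g := fun w => g (inn e w)) fun w => ?_
  rw [← (petPair_gad hf hg e).star]
  congr 1
  ext x
  by_cases hx : x = rim₀ k
  · subst hx
    cases rimSide w
    · rfl
    · exact he
  · exact congrArg f (gad_congr hx _ _ _)

lemma col_of_collapsed (hG : G.IsR (k + 2)) (hH : H.IsR (k + 2))
    (hg : ∀ v, ((G.subst k).star v).image f = H.star (g v))
    (he : ∀ e, f (att k e false) = f (att k e true)) :
    IsCol G H (fun e => f (att k e false)) := by
  refine isCol_of_image_eq hG.1 hH.1 (g := fun v => g (orig k v)) fun v => ?_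
  rw [← hg, subst_star_orig, image_image]
  congr 1
  ext e
  dsimp only [Function.comp]
  cases decide (G.t e = v)
  · rfl
  · exact he e

/-- The image of a gadget. -/
noncomputable def gadImage (g : (G.subst k).V → H.V) (e : G.E) : Finset H.V :=
  univ.image (fun w => g (inn e w))

lemma mem_gadImage {e : G.E} {v : H.V} : v ∈ gadImage g e ↔ ∃ w, g (inn e w) = v := by
  simp [gadImage]

lemma inn_mem_gadImage (e : G.E) (w : (pet k).V) : g (inn e w) ∈ gadImage g e :=
  mem_gadImage.2 ⟨w, rfl⟩

lemma card_gadImage (hH : H.IsR (k + 2)) (hf : IsCol (G.subst k) H f)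
    (hg : ∀ v, ((G.subst k).star v).image f = H.star (g v)) (e : G.E) :
    #(gadImage g e) = 10 := by
  rw [gadImage, card_image_of_injective _ ((petPair_gad hf hg e).vertex_injective hH)]
  rfl

lemma gad_image_link (hH : H.IsR (k + 2)) (hf : IsCol (G.subst k) H f)
    (hg : ∀ v, ((G.subst k).star v).image f = H.star (g v)) {e : G.E} {x : (pet k).E}
    (hx : x ≠ rim₀ k) (c : Bool) {y z : (pet k).V} (hl : (pet k).Link x y z) :
    H.Link (f (gad e c x)) (g (inn e y)) (g (inn e z)) := by
  have h1 := gad_link hx e c hl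
  refine link_of_inc (inc_map hg h1.inc_left) (inc_map hg h1.inc_right) fun h => hl.ne ?_
  exact (petPair_gad hf hg e).vertex_injective hH h

/-- Interior edges stay inside the image. If an attachment color had both ends there, injectivity of
the pair of maps would identify it with the color of the other attachment edge. -/
lemma cut_gadImage (hH : H.IsR (k + 2)) (hf : IsCol (G.subst k) H f)
    (hg : ∀ v, ((G.subst k).star v).image f = H.star (g v)) {e : G.E}
    (he : f (att k e false) ≠ f (att k e true)) {h : H.E} :
    h ∈ H.cut (gadImage g e) ↔ ∃ c, h = f (att k e c) := by
  have hinj := (petPair_gad hf hg e).vertex_injective hH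
  constructor
  · intro hh
    obtain ⟨p, hp, q, hq, hl⟩ := mem_cut_iff_link.1 hh
    obtain ⟨w, rfl⟩ := mem_gadImage.1 hp
    have h1 : h ∈ H.star (g (inn e w)) := mem_star.2 hl.inc_left
    rw [← (petPair_gad hf hg e).star] at h1
    obtain ⟨x, -, rfl⟩ := mem_image.1 h1
    by_cases hx : x = rim₀ k
    · subst hx; exact ⟨_, rfl⟩
    · exfalso
      have h2 := (gad_image_link hH hf hg hx (rimSide w) (link_s_t x)).mem_cut.1 hh
      exact h2 ⟨fun _ => inn_mem_gadImage _ _, fun _ => inn_mem_gadImage _ _⟩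
  · rintro ⟨c, rfl⟩
    have h1 : H.Inc (f (att k e c)) (g (inn e (rimEnd k c))) := inc_map hg (att_link e c).inc_right
    obtain ⟨q, hq, hl⟩ := h1.exists_link
    refine mem_cut_iff_link.2 ⟨_, inn_mem_gadImage _ _, q, fun hqY => ?_, hl⟩
    obtain ⟨w, rfl⟩ := mem_gadImage.1 hqY
    have h2 : f (att k e c) ∈ H.star (g (inn e w)) := mem_star.2 hl.inc_right
    rw [← (petPair_gad hf hg e).star] at h2
    obtain ⟨x, hx, hxe⟩ := mem_image.1 h2
    have h3 : x = rim₀ k := (petPair_gad hf hg e).injective hH hxe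
    subst h3
    obtain ⟨d, rfl⟩ := rim₀_inc.1 (mem_star.1 hx)
    rw [rimSide_rimEnd] at hxe
    have hcd : d ≠ c := by rintro rfl; exact hq rfl
    cases c <;> cases d <;> first | exact hcd rfl | skip
    · exact he hxe.symm
    · exact he hxe

/-- Colorings by the Petersen graph collapse all gadgets. -/
lemma collapsed_of_pet {f : (G.subst k).E → (pet k).E} (hk : 1 ≤ k)
    (hf : IsCol (G.subst k) (pet k) f) (e : G.E) : f (att k e false) = f (att k e true) := by
  by_contra he
  obtain ⟨g, hg⟩ := hf.exists_map
  -- The image has 10 vertices, all that `pet k` has, so no room is left for a leaving edge.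
  have h1 : gadImage g e = univ := by
    apply eq_univ_of_card
    rw [card_gadImage (pet_isR hk) hf hg]
    rfl
  have h2 := (cut_gadImage (pet_isR hk) hf hg he).2 ⟨false, rfl⟩
  rw [h1, cut_univ] at h2
  exact notMem_empty _ h2

lemma pet_col_of_pet_col_subst (hk : 1 ≤ k) (hG : G.IsR (k + 2)) (h : (pet k).Col (G.subst k)) :
    (pet k).Col G := by
  obtain ⟨f, hf⟩ := h
  obtain ⟨g, hg⟩ := hf.exists_map
  exact ⟨_, col_of_collapsed hG (pet_isR hk) hg (collapsed_of_pet hk hf)⟩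

/-- Rim edges have no parallel edges, in contrast to spokes when `k ≥ 2`. -/
lemma eq_rim_of_link {x : (pet k).E} (h : (pet k).Link x (rimEnd k false) (rimEnd k true)) :
    x = rim₀ k := by
  rcases pet_cases x with ⟨y, rfl⟩ | ⟨i, t, rfl⟩
  · have h1 : rimInc y (false, 0) := rim_inc.1 h.inc_left
    have h2 : rimInc y (false, 1) := rim_inc.1 h.inc_right
    have : ∀ y, rimInc y (false, 0) → rimInc y (false, 1) → y = (false, 0) := by decide
    rw [this y h1 h2]; rfl
  · have h1 : (0 : Fin 5) = i := spoke_inc.1 h.inc_left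
    have h2 : (1 : Fin 5) = i := spoke_inc.1 h.inc_right
    exact absurd (h1.trans h2.symm) (by decide)

/-- For `k ≥ 2`, the Petersen graph with multiplied spokes does not color every graph. -/
theorem not_pet_col_subst_pet (hk : 2 ≤ k) : ¬ (pet k).Col ((pet k).subst k) := by
  rintro ⟨f, hf⟩
  have hk1 : 1 ≤ k := by omega
  have hH := pet_isR hk1
  obtain ⟨g, hg⟩ := hf.exists_map
  have hcol := collapsed_of_pet hk1 hf
  have h1 := col_of_collapsed hH hH hg hcol
  obtain ⟨g₁, hg₁⟩ := h1.exists_map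
  have P₁ := petPair_of_isCol h1 hg₁
  -- Two parallel spokes, available since `k ≥ 2`. Collapsing all gadgets colors `pet k` by itself
  -- and gives `e₀`, `e₁` distinct parallel colors. Inside the gadget of `e₀`, however, the first of
  -- these colors comes from a rim edge, which has no parallel edge.
  let e₀ : (pet k).E := spoke 0 ⟨0, by omega⟩
  let e₁ : (pet k).E := spoke 0 ⟨1, by omega⟩
  have hne : e₁ ≠ e₀ := by
    intro h
    have := (spoke_inj.1 h).2
    simp at this
  have h2 := col_pet_of_collapsed hH hf hg (hcol e₀)
  obtain ⟨g₂, hg₂⟩ := h2.exists_map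
  have P₂ := petPair_of_isCol h2 hg₂
  -- The collapsed gadget is an injective coloring of `pet k` by itself, so the color of `e₁` is hit
  -- by some `x`, necessarily parallel to the removed rim edge.
  have hs : Function.Surjective (fun x => f (gad e₀ false x)) :=
    Finite.surjective_of_injective fun x y hxy => P₂.injective hH (b := false) (c := false) hxy
  obtain ⟨x, hx⟩ := hs (f (att k e₁ false))
  have hlink : ∀ {f' : (pet k).E → (pet k).E} {g' : (pet k).V → (pet k).V}
      (P : PetPair (pet k) k (fun _ => f') (fun _ => false) g') {e v w}, (pet k).Link e v w →
      (pet k).Link (f' e) (g' v) (g' w) := by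
    intro f' g' P e v w hl
    exact link_of_inc (P.inc hl.inc_left) (P.inc hl.inc_right)
      (fun h => hl.ne (P.vertex_injective hH h))
  have l0 := hlink P₁ (spoke_link 0 (⟨0, by omega⟩ : Fin k))
  have l1 := hlink P₁ (spoke_link 0 (⟨1, by omega⟩ : Fin k))
  have l2 := hlink P₂ rim₀_link
  have hends : ∀ c, (pet k).Inc (f (att k e₁ false)) (g₂ (rimEnd k c)) := by
    intro c
    have h3 : (pet k).Inc (f (att k e₀ false)) (g₂ (rimEnd k c)) := by
      cases c
      · exact l2.inc_left
      · exact l2.inc_right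
    rcases l0.eq_or_eq h3 with h4 | h4 <;> rw [h4]
    · exact l1.inc_left
    · exact l1.inc_right
  have hxl := hlink P₂ (link_s_t x)
  simp only at hxl hx
  rw [hx] at hxl
  have hxi : ∀ c, (pet k).Inc x (rimEnd k c) := by
    intro c
    rcases hxl.eq_or_eq (hends c) with h4 | h4
    · rw [P₂.vertex_injective hH h4]; exact inc_s x
    · rw [P₂.vertex_injective hH h4]; exact inc_t x
  have hx0 := eq_rim_of_link (link_of_inc (hxi false) (hxi true) rim₀_link.ne)
  subst hx0
  exact hne (P₁.injective hH (b := false) (c := false) hx.symm)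

end coloring

end FinGraph
end RGraphs

/-! ### Uncollapsed gadgets and the quotient graph -/

namespace RGraphs
open Finset
open scoped Classical
namespace FinGraph
variable {G H K : FinGraph} {k : ℕ}

/-- A coloring of a substituted graph in which no gadget is collapsed. -/
structure Uncollapsed (G H : FinGraph) (k : ℕ) (f : (G.subst k).E → H.E)
    (g : (G.subst k).V → H.V) : Prop where
  pos : 1 ≤ k
  isR : H.IsR (k + 2)
  isCol : IsCol (G.subst k) H f
  star : ∀ v, ((G.subst k).star v).image f = H.star (g v)
  ne : ∀ e, f (att k e false) ≠ f (att k e true)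

namespace Uncollapsed
variable {f : (G.subst k).E → H.E} {g : (G.subst k).V → H.V}

lemma mem_cut (h : Uncollapsed G H k f g) {e : G.E} {x : H.E} :
    x ∈ H.cut (gadImage g e) ↔ ∃ c, x = f (att k e c) :=
  cut_gadImage h.isR h.isCol h.star (h.ne e)

lemma gad_link (h : Uncollapsed G H k f g) {e : G.E} {x : (pet k).E} (hx : x ≠ rim₀ k) (c : Bool)
    {y z : (pet k).V} (hl : (pet k).Link x y z) :
    H.Link (f (gad e c x)) (g (inn e y)) (g (inn e z)) :=
  gad_image_link h.isR h.isCol h.star hx c hl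

lemma inc (h : Uncollapsed G H k f g) {x : (G.subst k).E} {v : (G.subst k).V}
    (hi : (G.subst k).Inc x v) : H.Inc (f x) (g v) := inc_map h.star hi

/-- The trace of a vertex set on a gadget. -/
lemma mem_trace_cut (h : Uncollapsed G H k f g) {e : G.E} {T : Finset H.V} {x : (pet k).E}
    (hx : x ≠ rim₀ k) (c : Bool) :
    f (gad e c x) ∈ H.cut T ↔ x ∈ (pet k).cut (univ.filter (fun w => g (inn e w) ∈ T)) := by
  rw [(h.gad_link hx c (link_s_t x)).mem_cut, FinGraph.mem_cut]
  simp

/-- The gadget images do not contain images of original vertices. -/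
lemma orig_notMem (h : Uncollapsed G H k f g) (e' : G.E) (v : G.V) :
    g (orig k v) ∉ gadImage g e' := by
  intro hmem
  obtain ⟨w, hw⟩ := mem_gadImage.1 hmem
  have P := petPair_gad h.isCol h.star e'
  -- an interior edge of one gadget has the color of an attachment edge of another one
  obtain ⟨x, hxw, hx⟩ : ∃ x ∈ (pet k).star w, x ≠ rim₀ k := by
    have : 0 < #(((pet k).star w).erase (rim₀ k)) := by
      have := pred_card_le_card_erase (s := (pet k).star w) (a := rim₀ k)
      rw [card_pet_star] at this
      omega
    obtain ⟨x, hx⟩ := card_pos.1 this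
    exact ⟨x, (mem_erase.1 hx).2, (mem_erase.1 hx).1⟩
  have h1 : f (gad e' (rimSide w) x) ∈ H.star (g (orig k v)) := by
    rw [← hw, ← P.star]
    exact mem_image_of_mem (fun x => f (gad e' (rimSide w) x)) hxw
  rw [← h.star, subst_star_orig, image_image] at h1
  obtain ⟨e, -, hex⟩ := mem_image.1 h1
  dsimp only [Function.comp] at hex
  set c := decide (G.t e = v) with hc
  set T := gadImage g e with hT
  set T' := univ.filter (fun w => g (inn e' w) ∈ T) with hT'
  have hxT' : x ∈ (pet k).cut T' := by
    rw [← h.mem_trace_cut hx (rimSide w), ← hex]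
    exact h.mem_cut.2 ⟨c, rfl⟩
  have h3 : 3 ≤ #((pet k).cut T') := by
    obtain ⟨a, ha, b, hb, -⟩ := mem_cut_iff_link.1 hxT'
    exact pet_three_le_cut h.pos ⟨a, ha⟩ (fun hu => hb (hu ▸ mem_univ b))
  have himg : (((pet k).cut T').erase (rim₀ k)).image (fun x => f (gad e' false x)) ⊆ H.cut T := by
    intro y hy
    obtain ⟨z, hz, rfl⟩ := mem_image.1 hy
    rw [mem_erase] at hz
    exact (h.mem_trace_cut hz.1 false).2 hz.2
  have hcardimg : #((((pet k).cut T').erase (rim₀ k)).image (fun x => f (gad e' false x))) =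
      #(((pet k).cut T').erase (rim₀ k)) :=
    card_image_of_injective _ fun x y hxy => P.injective h.isR (b := false) (c := false) hxy
  have hcutT : #(H.cut T) ≤ 2 := by
    have : H.cut T ⊆ {f (att k e false), f (att k e true)} := by
      intro y hy
      obtain ⟨d, rfl⟩ := h.mem_cut.1 hy
      cases d <;> simp
    exact (card_le_card this).trans card_le_two
  -- At least three edges of `pet k` leave the trace `T'`, and all but the removed rim edge yield
  -- distinct edges leaving `T`, of which there are at most two. So the removed edge is among them,
  -- and both edges leaving `T` come from the interior of the gadget of `e'`.
  have hrim : rim₀ k ∈ (pet k).cut T' := by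
    by_contra hno
    rw [erase_eq_of_notMem hno] at hcardimg himg
    have := card_le_card himg
    omega
  rw [card_erase_of_mem hrim] at hcardimg
  have himgeq := eq_of_subset_of_card_le himg (by omega)
  -- both edges leaving `T` have both ends in the image of `e'`
  have hboth : ∀ y ∈ H.cut T, ∀ p, H.Inc y p → p ∈ gadImage g e' := by
    intro y hy p hp
    rw [← himgeq] at hy
    obtain ⟨z, hz, rfl⟩ := mem_image.1 hy
    rw [mem_erase] at hz
    rcases (h.gad_link hz.1 false (link_s_t z)).eq_or_eq hp with rfl | rfl <;>
      exact inn_mem_gadImage _ _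
  obtain ⟨d, hd⟩ : ∃ d, ∀ c', rimEnd k c' ∈ T' ↔ c' = d := by
    have := (rim₀_link (k := k)).mem_cut.1 hrim
    by_cases ha : rimEnd k false ∈ T'
    · refine ⟨false, fun c' => ?_⟩
      cases c' <;> simp_all
    · refine ⟨true, fun c' => ?_⟩
      cases c' <;> simp_all
  have hd' : ∀ c', g (inn e' (rimEnd k c')) ∈ T ↔ c' = d := by
    intro c'
    rw [← hd]; simp [hT']
  -- What remains of `T` is joined to the rest only through the attachment edge at the end `d`
  -- inside `T`. A cut with a single edge is impossible in an `r`-graph.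
  have hZ : H.cut (T \ gadImage g e') = {f (att k e' d)} := by
    ext y
    rw [mem_singleton]
    constructor
    · intro hy
      obtain ⟨p, hp, q, hq, hl⟩ := mem_cut_iff_link.1 hy
      rw [mem_sdiff] at hp hq
      have hqT : q ∈ T := by
        by_contra hqT
        exact hp.2 (hboth y (mem_cut_iff_link.2 ⟨p, hp.1, q, hqT, hl⟩) p hl.inc_left)
      have hqe : q ∈ gadImage g e' := by by_contra hqe; exact hq ⟨hqT, hqe⟩
      obtain ⟨c', rfl⟩ := h.mem_cut.1 (mem_cut_iff_link.2 ⟨q, hqe, p, hp.2, hl.symm⟩)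
      have hi := h.inc (att_link e' c').inc_right
      rcases hl.eq_or_eq hi with h5 | h5
      · exact absurd (h5 ▸ inn_mem_gadImage e' _) hp.2
      · rw [← h5, hd'] at hqT
        rw [hqT]
    · rintro rfl
      have hi := h.inc (att_link e' d).inc_right
      obtain ⟨p, hp, hl⟩ := hi.exists_link
      have hc1 : f (att k e' d) ∈ H.cut (gadImage g e') := h.mem_cut.2 ⟨d, rfl⟩
      rw [hl.mem_cut] at hc1
      have hpe : p ∉ gadImage g e' := fun hpe =>
        hc1 ⟨fun _ => hpe, fun _ => inn_mem_gadImage e' _⟩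
      have hqT : g (inn e' (rimEnd k d)) ∈ T := (hd' d).2 rfl
      have hpT : p ∈ T := by
        by_contra hpT
        exact hpe (hboth _ (mem_cut_iff_link.2 ⟨_, hqT, p, hpT, hl⟩) p hl.inc_right)
      exact mem_cut_iff_link.2 ⟨p, mem_sdiff.2 ⟨hpT, hpe⟩, _,
        fun h' => (mem_sdiff.1 h').2 (inn_mem_gadImage e' _), hl.symm⟩
  exact h.isR.card_cut_ne_one (by omega) _ (by rw [hZ, card_singleton])

lemma att_link' (h : Uncollapsed G H k f g) (e : G.E) (c : Bool) :
    H.Link (f (att k e c)) (g (orig k (G.endOf e c))) (g (inn e (rimEnd k c))) :=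
  link_of_inc (h.inc (att_link e c).inc_left) (h.inc (att_link e c).inc_right)
    fun h' => h.orig_notMem e _ (by rw [h']; exact inn_mem_gadImage e _)

/-- The outer end of an attachment edge is determined by its color. -/
lemma orig_eq_of_inc (h : Uncollapsed G H k f g) {e : G.E} {c : Bool} {v : G.V}
    (hi : H.Inc (f (att k e c)) (g (orig k v))) : g (orig k v) = g (orig k (G.endOf e c)) :=
  ((h.att_link' e c).eq_or_eq hi).resolve_right
    fun h' => h.orig_notMem e v (h' ▸ inn_mem_gadImage e _)

/-- An interior edge of the gadget of `e` whose color leaves the image of `e'` would be an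
attachment color of `e'`, with an original vertex inside the image of `e`. So at most the removed
rim edge leaves the trace, and cuts of `pet k` with fewer than three edges are trivial. -/
lemma gadImage_subset (h : Uncollapsed G H k f g) {e e' : G.E} {z : H.V}
    (hz : z ∈ gadImage g e) (hz' : z ∈ gadImage g e') : gadImage g e ⊆ gadImage g e' := by
  set T' := univ.filter (fun w => g (inn e w) ∈ gadImage g e') with hT'
  have h1 : (pet k).cut T' ⊆ {rim₀ k} := by
    intro x hx
    rw [mem_singleton]
    by_contra hne
    rw [← h.mem_trace_cut hne false] at hx
    obtain ⟨c, hc⟩ := h.mem_cut.1 hx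
    have hi := (h.att_link' e' c).inc_left
    rw [← hc] at hi
    rcases (h.gad_link hne false (link_s_t x)).eq_or_eq hi with h2 | h2
    · exact h.orig_notMem e _ (by rw [h2]; exact inn_mem_gadImage e _)
    · exact h.orig_notMem e _ (by rw [h2]; exact inn_mem_gadImage e _)
  obtain ⟨w, rfl⟩ := mem_gadImage.1 hz
  have h2 : T' = univ := by
    by_contra hne
    have h3 := pet_three_le_cut h.pos (S := T') ⟨w, by simpa [hT'] using hz'⟩ hne
    have h4 := card_le_card h1
    rw [card_singleton] at h4
    omega
  intro y hy
  obtain ⟨w', rfl⟩ := mem_gadImage.1 hy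
  have h3 : w' ∈ T' := by rw [h2]; exact mem_univ _
  simpa [hT'] using h3

lemma gadImage_eq (h : Uncollapsed G H k f g) {e e' : G.E} {z : H.V}
    (hz : z ∈ gadImage g e) (hz' : z ∈ gadImage g e') : gadImage g e = gadImage g e' :=
  (h.gadImage_subset hz hz').antisymm (h.gadImage_subset hz' hz)

/-- If both outer ends were the vertex `u`, then `u` and the gadget image would form a set of 11
vertices left only by the `k` other edges at `u`, fewer than `r`. -/
lemma ends_ne (h : Uncollapsed G H k f g) (e : G.E) :
    g (orig k (G.endOf e false)) ≠ g (orig k (G.endOf e true)) := by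
  intro heq
  set u := g (orig k (G.endOf e false)) with hu
  have hinc : ∀ c, H.Inc (f (att k e c)) u := by
    intro c
    have := (h.att_link' e c).inc_left
    cases c
    · exact this
    · rwa [heq]
  have hnot : u ∉ gadImage g e := h.orig_notMem e _
  have hodd : Odd #(insert u (gadImage g e)) := by
    rw [card_insert_of_notMem hnot, card_gadImage h.isR h.isCol h.star]
    decide
  have h1 := h.isR.2 _ hodd
  have hatt : ∀ c, f (att k e c) ∉ H.cut (insert u (gadImage g e)) := by
    intro c
    have hl := h.att_link' e c
    rw [hl.mem_cut, not_not]
    refine ⟨fun _ => mem_insert_of_mem (inn_mem_gadImage e _), fun _ => ?_⟩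
    rw [← h.orig_eq_of_inc (hinc c)]
    exact mem_insert_self _ _
  have h2 : H.cut (insert u (gadImage g e)) ⊆
      ((H.star u).erase (f (att k e false))).erase (f (att k e true)) := by
    intro y hy
    rw [mem_erase, mem_erase]
    refine ⟨fun h' => hatt _ (h' ▸ hy), fun h' => hatt _ (h' ▸ hy), ?_⟩
    obtain ⟨p, hp, q, hq, hl⟩ := mem_cut_iff_link.1 hy
    rcases mem_insert.1 hp with rfl | hp
    · exact mem_star.2 hl.inc_left
    · exfalso
      obtain ⟨c, rfl⟩ := h.mem_cut.1 (mem_cut_iff_link.2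
        ⟨p, hp, q, fun hq' => hq (mem_insert_of_mem hq'), hl⟩)
      exact hatt c hy
  have h3 := card_le_card h2
  rw [card_erase_of_mem, card_erase_of_mem, h.isR.1] at h3
  · omega
  · exact mem_star.2 (hinc _)
  · exact mem_erase.2 ⟨(h.ne e).symm, mem_star.2 (hinc _)⟩

/-- An original edge from each gadget image. -/
noncomputable def rep (g : (G.subst k).V → H.V) (Y : {Y // Y ∈ univ.image (gadImage g)}) : G.E :=
  (mem_image.1 Y.2).choose

lemma gadImage_rep (Y : {Y // Y ∈ univ.image (gadImage g)}) : gadImage g (rep g Y) = Y.1 :=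
  (mem_image.1 Y.2).choose_spec.2

/-- The graph on the images of the original vertices, with the gadget images as edges. -/
noncomputable def quot (h : Uncollapsed G H k f g) : FinGraph where
  V := {u // u ∈ univ.image (fun v => g (orig k v))}
  E := {Y // Y ∈ univ.image (gadImage g)}
  s Y := ⟨_, mem_image_of_mem (fun v => g (orig k v)) (mem_univ (G.endOf (rep g Y) false))⟩
  t Y := ⟨_, mem_image_of_mem (fun v => g (orig k v)) (mem_univ (G.endOf (rep g Y) true))⟩
  ne Y h' := h.ends_ne (rep g Y) (congrArg Subtype.val h')

/-- The vertex of the quotient graph given by an original vertex. -/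
def quotV (h : Uncollapsed G H k f g) (v : G.V) : h.quot.V :=
  ⟨_, mem_image_of_mem (fun v => g (orig k v)) (mem_univ v)⟩

/-- The edge of the quotient graph given by an original edge. -/
noncomputable def quotE (h : Uncollapsed G H k f g) (e : G.E) : h.quot.E :=
  ⟨_, mem_image_of_mem (gadImage g) (mem_univ e)⟩

/-- The underlying vertex. -/
def quotVal (h : Uncollapsed G H k f g) (u : h.quot.V) : H.V := Subtype.val u

/-- The underlying gadget image. -/
def quotSet (h : Uncollapsed G H k f g) (y : h.quot.E) : Finset H.V := Subtype.val y

lemma quotVal_injective (h : Uncollapsed G H k f g) : Function.Injective h.quotVal :=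
  Subtype.val_injective
lemma quotSet_quotE (h : Uncollapsed G H k f g) (e : G.E) : h.quotSet (h.quotE e) = gadImage g e :=
  rfl

lemma quotV_eq (h : Uncollapsed G H k f g) {v w : G.V} :
    h.quotV v = h.quotV w ↔ g (orig k v) = g (orig k w) := Subtype.mk_eq_mk
lemma quotE_eq (h : Uncollapsed G H k f g) {e e' : G.E} :
    h.quotE e = h.quotE e' ↔ gadImage g e = gadImage g e' := Subtype.mk_eq_mk
lemma exists_quotV (h : Uncollapsed G H k f g) (u : h.quot.V) : ∃ v, u = h.quotV v := by
  obtain ⟨v, -, hv⟩ := mem_image.1 u.2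
  exact ⟨v, Subtype.ext hv.symm⟩
lemma exists_quotE (h : Uncollapsed G H k f g) (y : h.quot.E) : ∃ e, y = h.quotE e := by
  obtain ⟨v, -, hv⟩ := mem_image.1 y.2
  exact ⟨v, Subtype.ext hv.symm⟩

/-- The attachment colors are the edges leaving the image, so the image determines them up to order.
This makes the quotient independent of the chosen representatives. -/
lemma exists_att_eq (h : Uncollapsed G H k f g) {e e' : G.E} (he : gadImage g e = gadImage g e')
    (c : Bool) : ∃ d, f (att k e c) = f (att k e' d) := by
  have : f (att k e c) ∈ H.cut (gadImage g e) := h.mem_cut.2 ⟨c, rfl⟩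
  rw [he] at this
  exact h.mem_cut.1 this

lemma quot_inc (h : Uncollapsed G H k f g) {e : G.E} {v : G.V} :
    h.quot.Inc (h.quotE e) (h.quotV v) ↔ ∃ c, H.Inc (f (att k e c)) (g (orig k v)) := by
  set e' := rep g (h.quotE e) with he'
  have hY : gadImage g e' = gadImage g e := gadImage_rep (h.quotE e)
  have hs : h.quot.s (h.quotE e) = h.quotV (G.endOf e' false) := rfl
  have ht : h.quot.t (h.quotE e) = h.quotV (G.endOf e' true) := rfl
  unfold FinGraph.Inc
  rw [hs, ht, h.quotV_eq, h.quotV_eq]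
  constructor
  · intro h1
    obtain ⟨c, hc⟩ : ∃ c, g (orig k (G.endOf e' c)) = g (orig k v) := by
      rcases h1 with h1 | h1 <;> exact ⟨_, h1⟩
    obtain ⟨d, hd⟩ := h.exists_att_eq hY c
    refine ⟨d, ?_⟩
    have := (h.att_link' e' c).inc_left
    rwa [hd, hc] at this
  · rintro ⟨c, hc⟩
    obtain ⟨d, hd⟩ := h.exists_att_eq hY.symm c
    have : H.Inc (f (att k e' d)) (g (orig k v)) := by rwa [← hd]
    have h2 := h.orig_eq_of_inc this
    cases d
    · exact Or.inl h2.symm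
    · exact Or.inr h2.symm

lemma quot_inc_endOf (h : Uncollapsed G H k f g) (e : G.E) (c : Bool) :
    h.quot.Inc (h.quotE e) (h.quotV (G.endOf e c)) := h.quot_inc.2 ⟨c, (h.att_link' e c).inc_left⟩

lemma quot_star (h : Uncollapsed G H k f g) (v : G.V) :
    (G.star v).image h.quotE = h.quot.star (h.quotV v) := by
  ext y
  rw [mem_image, mem_star]
  constructor
  · rintro ⟨e, he, rfl⟩
    obtain ⟨c, rfl⟩ := inc_iff_endOf.1 (mem_star.1 he)
    exact h.quot_inc_endOf e c
  · intro hi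
    obtain ⟨e, rfl⟩ := h.exists_quotE y
    obtain ⟨c, hc⟩ := h.quot_inc.1 hi
    have h1 := mem_star.2 hc
    rw [← h.star, subst_star_orig, image_image] at h1
    obtain ⟨e', he', hee⟩ := mem_image.1 h1
    refine ⟨e', he', h.quotE_eq.2 ?_⟩
    dsimp only [Function.comp] at hee
    set d := decide (G.t e' = v)
    have l1 := h.att_link' e c
    have l2 := h.att_link' e' d
    rw [hee] at l2
    rcases l1.eq_or_eq l2.inc_right with h3 | h3
    · exact absurd (by rw [← h3]; exact inn_mem_gadImage e' _) (h.orig_notMem e' (G.endOf e c))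
    · exact h.gadImage_eq (inn_mem_gadImage e' _) (by rw [h3]; exact inn_mem_gadImage e _)

/-- Edges with the same image share an attachment color at the common vertex: the outer ends of a
gadget are distinct, so the sides must match. The coloring is injective at that vertex. -/
lemma quot_injOn (h : Uncollapsed G H k f g) (v : G.V) : Set.InjOn h.quotE (G.star v) := by
  intro e he e' he' hee
  obtain ⟨c, rfl⟩ := inc_iff_endOf.1 (mem_star.1 he)
  obtain ⟨d, hd⟩ := h.exists_att_eq (h.quotE_eq.1 hee) c
  have h1 := (h.att_link' e c).inc_left
  rw [hd] at h1
  have h2 := h.orig_eq_of_inc h1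
  obtain ⟨d', hd'⟩ := inc_iff_endOf.1 (mem_star.1 he')
  rw [← hd'] at h2
  have hdd : d' = d := by
    have := h.ends_ne e'
    cases d <;> cases d' <;> first | rfl | skip
    · exact absurd h2.symm this
    · exact absurd h2 this
  subst hdd
  have h3 := h.isCol.injOn (orig k (G.endOf e c)) (mem_star.2 (att_link e c).inc_left)
    (mem_star.2 (hd' ▸ (att_link e' d').inc_left)) hd
  exact (att_inj.1 h3).1

lemma quot_card_star (h : Uncollapsed G H k f g) (hG : G.IsR (k + 2)) (u : h.quot.V) :
    #(h.quot.star u) = k + 2 := by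
  obtain ⟨v, rfl⟩ := h.exists_quotV u
  rw [← h.quot_star, card_image_of_injOn (h.quot_injOn v), hG.1]

lemma quot_link (h : Uncollapsed G H k f g) (e : G.E) (c : Bool) :
    h.quot.Link (h.quotE e) (h.quotV (G.endOf e c)) (h.quotV (G.endOf e !c)) := by
  refine link_of_inc (h.quot_inc_endOf e c) (h.quot_inc_endOf e _) fun h' => ?_
  rw [h.quotV_eq] at h'
  cases c
  · exact h.ends_ne e h'
  · exact h.ends_ne e h'.symm

/-- Expand a set of vertices of the quotient by the gadget images meeting it. -/
noncomputable def expand (h : Uncollapsed G H k f g) (S : Finset h.quot.V) : Finset H.V :=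
  S.image h.quotVal ∪
    (univ.filter (fun y : h.quot.E => ∃ u ∈ S, h.quot.Inc y u)).biUnion h.quotSet

lemma mem_expand (h : Uncollapsed G H k f g) {S : Finset h.quot.V} {z : H.V} :
    z ∈ h.expand S ↔ (∃ v, h.quotV v ∈ S ∧ g (orig k v) = z) ∨
      ∃ e, (∃ c, h.quotV (G.endOf e c) ∈ S) ∧ z ∈ gadImage g e := by
  rw [expand, mem_union, mem_image, mem_biUnion]
  refine or_congr ⟨?_, ?_⟩ ⟨?_, ?_⟩
  · rintro ⟨u, hu, rfl⟩
    obtain ⟨v, rfl⟩ := h.exists_quotV u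
    exact ⟨v, hu, rfl⟩
  · rintro ⟨v, hv, rfl⟩
    exact ⟨_, hv, rfl⟩
  · rintro ⟨y, hy, hz⟩
    obtain ⟨-, u, hu, hi⟩ := mem_filter.1 hy
    obtain ⟨e, rfl⟩ := h.exists_quotE y
    refine ⟨e, ?_, hz⟩
    rcases (h.quot_link e false).eq_or_eq hi with rfl | rfl
    · exact ⟨_, hu⟩
    · exact ⟨_, hu⟩
  · rintro ⟨e, ⟨c, hc⟩, hz⟩
    exact ⟨h.quotE e, mem_filter.2 ⟨mem_univ _, _, hc, h.quot_inc_endOf e c⟩, hz⟩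

/-- The added gadget images are disjoint sets of 10 vertices, so parity is unchanged. -/
lemma odd_card_expand (h : Uncollapsed G H k f g) {S : Finset h.quot.V} (hS : Odd #S) :
    Odd #(h.expand S) := by
  rw [expand, card_union_of_disjoint, card_image_of_injective _ h.quotVal_injective,
    card_biUnion]
  · rw [Nat.odd_add]
    refine ⟨fun _ => even_sum _ fun y _ => ?_, fun _ => hS⟩
    obtain ⟨e, rfl⟩ := h.exists_quotE y
    have : #(gadImage g e) = 10 := card_gadImage h.isR h.isCol h.star e
    rw [h.quotSet_quotE, this]; decide
  · intro y _ y' _ hne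
    obtain ⟨e, rfl⟩ := h.exists_quotE y
    obtain ⟨e', rfl⟩ := h.exists_quotE y'
    change Disjoint (gadImage g e) (gadImage g e')
    rw [disjoint_left]
    intro z hz hz'
    exact hne (h.quotE_eq.2 (h.gadImage_eq hz hz'))
  · rw [disjoint_left]
    intro z hz hz'
    obtain ⟨u, -, rfl⟩ := mem_image.1 hz
    obtain ⟨v, rfl⟩ := h.exists_quotV u
    obtain ⟨y, -, hy⟩ := mem_biUnion.1 hz'
    obtain ⟨e, rfl⟩ := h.exists_quotE y
    exact h.orig_notMem e v hy

/-- Edges leaving an expanded set come from edges leaving the original set. -/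
lemma exists_of_mem_cut_expand (h : Uncollapsed G H k f g) {S : Finset h.quot.V} {y : H.E}
    (hy : y ∈ H.cut (h.expand S)) : ∃ e c, y = f (att k e c) ∧ h.quotV (G.endOf e c) ∉ S ∧
      h.quotV (G.endOf e !c) ∈ S := by
  obtain ⟨p, hp, q, hq, hl⟩ := mem_cut_iff_link.1 hy
  rw [h.mem_expand] at hp hq
  push Not at hq
  rcases hp with ⟨v, hv, rfl⟩ | ⟨e, ⟨c, hc⟩, hpe⟩
  · exfalso
    have h1 := mem_star.2 hl.inc_left
    rw [← h.star, subst_star_orig, image_image] at h1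
    obtain ⟨e, -, rfl⟩ := mem_image.1 h1
    dsimp only [Function.comp] at hl
    set c := decide (G.t e = v)
    have h2 := h.orig_eq_of_inc hl.inc_left
    have hv' : h.quotV (G.endOf e c) ∈ S := by rwa [← h.quotV_eq.2 h2]
    rcases (h.att_link' e c).eq_or_eq hl.inc_right with h3 | h3
    · exact hq.1 _ hv' h3.symm
    · refine hq.2 e ⟨c, hv'⟩ ?_
      rw [h3]; exact inn_mem_gadImage e _
  · have hqe : q ∉ gadImage g e := hq.2 e ⟨c, hc⟩
    obtain ⟨d, rfl⟩ := h.mem_cut.1 (mem_cut_iff_link.2 ⟨p, hpe, q, hqe, hl⟩)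
    have hqd : g (orig k (G.endOf e d)) = q := by
      have h4 := h.att_link' e d
      rcases h4.eq_or_eq hl.inc_right with h3 | h3
      · exact h3.symm
      · exact absurd (by rw [h3]; exact inn_mem_gadImage e _) hqe
    have hdS : h.quotV (G.endOf e d) ∉ S := fun hd => hq.1 _ hd hqd
    refine ⟨e, d, rfl, hdS, ?_⟩
    have : c = !d := by
      cases c <;> cases d <;> first | rfl | exact absurd hc hdS
    rwa [← this]

/-- Each edge leaving the expansion of `S` is an attachment color whose gadget image is an edge
leaving `S`. Different edges give different images, since only one outer end of such a gadget is
outside `S`. -/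
lemma quot_isR (h : Uncollapsed G H k f g) (hG : G.IsR (k + 2)) : h.quot.IsR (k + 2) := by
  refine ⟨h.quot_card_star hG, fun S hS => ?_⟩
  refine (h.isR.2 _ (h.odd_card_expand hS)).trans ?_
  have hex := fun y (hy : y ∈ H.cut (h.expand S)) => h.exists_of_mem_cut_expand hy
  rcases (H.cut (h.expand S)).eq_empty_or_nonempty with h0 | ⟨y₀, hy₀⟩
  · rw [h0, card_empty]; exact Nat.zero_le _
  have : Nonempty G.E := ⟨(hex y₀ hy₀).choose⟩
  choose! ε γ h1 h2 h3 using hex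
  apply card_le_card_of_injOn (fun y => h.quotE (ε y))
  · intro y hy
    have := h.quot_link (ε y) (γ y)
    rw [mem_coe, this.mem_cut]
    have a := h2 y hy
    have b := h3 y hy
    tauto
  · intro y hy z hz hyz
    obtain ⟨d, hd⟩ := h.exists_att_eq (h.quotE_eq.1 hyz) (γ y)
    have h4 := (h.att_link' (ε y) (γ y)).inc_left
    rw [hd] at h4
    have h5 := h.orig_eq_of_inc h4
    rw [← h.quotV_eq] at h5
    have h6 : d = γ z := by
      by_contra hne
      have h7 : d = !γ z := Bool.eq_not_iff.2 hne
      have h8 := h2 y hy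
      rw [h5, h7] at h8
      exact h8 (h3 z hz)
    rw [h1 y hy, hd, h6, ← h1 z hz]

lemma quot_isCol (h : Uncollapsed G H k f g) : IsCol G h.quot h.quotE :=
  fun v => ⟨h.quotV v, h.quot_injOn v, h.quot_star v⟩

lemma quot_conn (h : Uncollapsed G H k f g) (hG : G.Conn) : h.quot.Conn := by
  obtain ⟨⟨v₀⟩, hc⟩ := hG
  refine ⟨⟨h.quotV v₀⟩, fun S hS hcut => ?_⟩
  obtain ⟨u, hu⟩ := hS
  obtain ⟨v, rfl⟩ := h.exists_quotV u
  have h1 := hc _ ⟨v, by simpa using hu⟩ (cut_preimage_eq_empty h.quot_star hcut)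
  rw [eq_univ_iff_forall]
  intro u
  obtain ⟨w, rfl⟩ := h.exists_quotV u
  have : w ∈ univ.filter (fun v => h.quotV v ∈ S) := by rw [h1]; exact mem_univ w
  simpa using this

/-- The vertices of the quotient are images of original vertices, which miss every gadget image. -/
lemma quot_card_lt (h : Uncollapsed G H k f g) (e : G.E) :
    Fintype.card h.quot.V < Fintype.card H.V := by
  refine Fintype.card_lt_of_injective_of_notMem h.quotVal
    h.quotVal_injective (b := g (inn e (pv k false 0))) ?_
  rintro ⟨u, hu⟩
  obtain ⟨v, rfl⟩ := h.exists_quotV u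
  apply h.orig_notMem e v
  have : g (orig k v) = g (inn e (pv k false 0)) := hu
  rw [this]; exact inn_mem_gadImage e _

end Uncollapsed

/-! ### Graphs colored only by large graphs -/

/-- Connected graphs coloring the substituted graph are larger than some coloring the original
graph, unless the Petersen graph colors the original graph. -/
theorem exists_col_card_lt (hk : 1 ≤ k) (hG : G.IsR (k + 2)) (hGc : G.Conn)
    (hpet : ¬ (pet k).Col G) (hH : H.IsR (k + 2)) (hHc : H.Conn) (hcol : H.Col (G.subst k)) :
    ∃ H' : FinGraph, H'.IsR (k + 2) ∧ H'.Conn ∧ H'.Col G ∧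
      Fintype.card H'.V < Fintype.card H.V := by
  have hcol' := hcol
  obtain ⟨f, hf⟩ := hcol
  obtain ⟨g, hg⟩ := hf.exists_map
  -- A collapsed gadget makes `H` color `pet k`. By rigidity `H` is `pet k`, which then collapses
  -- all gadgets and colors `G`.
  have hne : ∀ e, f (att k e false) ≠ f (att k e true) := by
    intro e he
    have h1 : H.Col (pet k) := ⟨_, col_pet_of_collapsed hH hf hg he⟩
    have h2 := (pet_rigid hk).2.2 H hH hHc h1
    exact hpet (pet_col_of_pet_col_subst hk hG (hcol'.trans h2.symm.col))
  have h : Uncollapsed G H k f g := ⟨hk, hH, hf, hg, hne⟩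
  obtain ⟨v₀⟩ := hGc.1
  obtain ⟨e, -⟩ : (G.star v₀).Nonempty := by
    rw [← card_pos, hG.1]; omega
  exact ⟨h.quot, h.quot_isR hG, h.quot_conn hGc, ⟨_, h.quot_isCol⟩, h.quot_card_lt e⟩

/-- If the Petersen graph does not color `G`, then there are graphs colored only by large
graphs. -/
theorem exists_forall_le_card (hk : 1 ≤ k) (hG : G.IsR (k + 2)) (hGc : G.Conn)
    (hpet : ¬ (pet k).Col G) (n : ℕ) : ∃ F : FinGraph, F.IsR (k + 2) ∧ F.Conn ∧ ¬ (pet k).Col F ∧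
      ∀ H : FinGraph, H.IsR (k + 2) → H.Conn → H.Col F → n ≤ Fintype.card H.V := by
  induction n with
  | zero => exact ⟨G, hG, hGc, hpet, fun _ _ _ _ => Nat.zero_le _⟩
  | succ n ih =>
    obtain ⟨F, hF, hFc, hFp, hFn⟩ := ih
    refine ⟨F.subst k, subst_isR hk hF, subst_conn hk hFc,
      fun h => hFp (pet_col_of_pet_col_subst hk hF h), fun H hH hHc hcol => ?_⟩
    obtain ⟨H', h1, h2, h3, h4⟩ := exists_col_card_lt hk hF hFc hFp hH hHc hcol
    exact (hFn H' h1 h2 h3).trans_lt h4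

end FinGraph
end RGraphs

/-! ### Transfer to graphs in the sense of the statement -/

namespace RGraphs
open Finset
open scoped Classical

/-- A presentation of a graph by a `FinGraph`. -/
structure Rep {α β : Type} (G : Graph α β) (F : FinGraph) where
  vert : F.V → α
  edge : F.E → β
  vert_injective : Function.Injective vert
  edge_injective : Function.Injective edge
  range_vert : Set.range vert = V(G)
  range_edge : Set.range edge = E(G)
  isLink_iff : ∀ e x y, G.IsLink (edge e) (vert x) (vert y) ↔ F.Link e x y

namespace Rep

variable {α β α' β' : Type} {G : Graph α β} {G' : Graph α' β'} {F F' : FinGraph}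

lemma vert_mem (R : Rep G F) (x : F.V) : R.vert x ∈ V(G) := by
  rw [← R.range_vert]; exact Set.mem_range_self x

lemma edge_mem (R : Rep G F) (e : F.E) : R.edge e ∈ E(G) := by
  rw [← R.range_edge]; exact Set.mem_range_self e

lemma exists_vert (R : Rep G F) {x : α} (h : x ∈ V(G)) : ∃ v, R.vert v = x := by
  rwa [← R.range_vert] at h

lemma exists_edge (R : Rep G F) {e : β} (h : e ∈ E(G)) : ∃ a, R.edge a = e := by
  rwa [← R.range_edge] at h

/-- The bijection on vertices. -/
noncomputable def vertEquiv (R : Rep G F) : F.V ≃ V(G) :=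
  Equiv.ofBijective (fun x => ⟨R.vert x, R.vert_mem x⟩)
    ⟨fun _ _ h => R.vert_injective (congrArg Subtype.val h),
      fun x => (R.exists_vert x.2).imp fun _ h => Subtype.ext h⟩

/-- The bijection on edges. -/
noncomputable def edgeEquiv (R : Rep G F) : F.E ≃ E(G) :=
  Equiv.ofBijective (fun e => ⟨R.edge e, R.edge_mem e⟩)
    ⟨fun _ _ h => R.edge_injective (congrArg Subtype.val h),
      fun x => (R.exists_edge x.2).imp fun _ h => Subtype.ext h⟩

@[simp] lemma coe_vertEquiv (R : Rep G F) (x : F.V) : (R.vertEquiv x : α) = R.vert x := rfl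
@[simp] lemma coe_edgeEquiv (R : Rep G F) (e : F.E) : (R.edgeEquiv e : β) = R.edge e := rfl

lemma vert_symm (R : Rep G F) (x : V(G)) : R.vert (R.vertEquiv.symm x) = x := by
  rw [← coe_vertEquiv, Equiv.apply_symm_apply]

lemma edge_symm (R : Rep G F) (e : E(G)) : R.edge (R.edgeEquiv.symm e) = e := by
  rw [← coe_edgeEquiv, Equiv.apply_symm_apply]

lemma inc_iff (R : Rep G F) {e : F.E} {x : F.V} : G.Inc (R.edge e) (R.vert x) ↔ F.Inc e x := by
  constructor
  · rintro ⟨y, hy⟩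
    obtain ⟨y, rfl⟩ := R.exists_vert hy.right_mem
    exact ((R.isLink_iff e x y).1 hy).inc_left
  · intro h
    obtain ⟨w, -, hw⟩ := h.exists_link
    exact ⟨_, (R.isLink_iff e x w).2 hw⟩

lemma incidenceSet_eq (R : Rep G F) (x : F.V) :
    G.incidenceSet (R.vert x) = R.edge '' (F.star x : Set F.E) := by
  ext e
  simp only [Graph.mem_incidenceSet, Set.mem_image, mem_coe, FinGraph.mem_star]
  constructor
  · intro h
    obtain ⟨a, rfl⟩ := R.exists_edge h.edge_mem
    exact ⟨a, R.inc_iff.1 h, rfl⟩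
  · rintro ⟨a, ha, rfl⟩
    exact R.inc_iff.2 ha

lemma ncard_edge_image (R : Rep G F) (N : Finset F.E) : (R.edge '' (N : Set F.E)).ncard = #N := by
  rw [Set.ncard_image_of_injective _ R.edge_injective, Set.ncard_coe_finset]

lemma edgeCut_eq (R : Rep G F) (S : Finset F.V) :
    edgeCut G (R.vert '' (S : Set F.V)) = R.edge '' (F.cut S : Set F.E) := by
  ext e
  simp only [edgeCut, Set.mem_ofPred_eq, Set.mem_image, mem_coe]
  constructor
  · rintro ⟨_, y, hl, ⟨x, hx, rfl⟩, hy⟩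
    obtain ⟨a, rfl⟩ := R.exists_edge hl.edge_mem
    obtain ⟨y, rfl⟩ := R.exists_vert hl.right_mem
    exact ⟨a, FinGraph.mem_cut_iff_link.2
      ⟨x, hx, y, fun h => hy ⟨y, h, rfl⟩, (R.isLink_iff a x y).1 hl⟩, rfl⟩
  · rintro ⟨a, ha, rfl⟩
    obtain ⟨x, hx, y, hy, hl⟩ := FinGraph.mem_cut_iff_link.1 ha
    refine ⟨R.vert x, R.vert y, (R.isLink_iff a x y).2 hl, ⟨x, hx, rfl⟩, ?_⟩
    rintro ⟨z, hz, hzy⟩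
    exact hy (R.vert_injective hzy ▸ hz)

lemma exists_finset (R : Rep G F) {X : Set α} (hX : X ⊆ V(G)) :
    ∃ S : Finset F.V, R.vert '' (S : Set F.V) = X := by
  refine ⟨univ.filter (fun v => R.vert v ∈ X), ?_⟩
  ext x
  simp only [coe_filter, mem_univ, true_and, Set.mem_image, Set.mem_ofPred_eq]
  constructor
  · rintro ⟨v, hv, rfl⟩; exact hv
  · intro hx
    obtain ⟨v, rfl⟩ := R.exists_vert (hX hx)
    exact ⟨v, hx, rfl⟩

lemma isRegular_iff (R : Rep G F) {r : ℕ} : IsRegular r G ↔ ∀ v, #(F.star v) = r := by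
  constructor
  · intro h v
    rw [← h _ (R.vert_mem v), R.incidenceSet_eq, R.ncard_edge_image]
  · intro h x hx
    obtain ⟨v, rfl⟩ := R.exists_vert hx
    rw [R.incidenceSet_eq, R.ncard_edge_image, h]

lemma isRGraph_iff (R : Rep G F) {r : ℕ} : IsRGraph r G ↔ F.IsR r := by
  refine and_congr R.isRegular_iff ⟨fun h S hS => ?_, fun h X hX hodd => ?_⟩
  · rw [← R.ncard_edge_image, ← R.edgeCut_eq]
    apply h
    · rintro _ ⟨v, -, rfl⟩; exact R.vert_mem v
    · rwa [Set.ncard_image_of_injective _ R.vert_injective, Set.ncard_coe_finset]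
  · obtain ⟨S, rfl⟩ := R.exists_finset hX
    rw [R.edgeCut_eq, R.ncard_edge_image]
    apply h
    rwa [Set.ncard_image_of_injective _ R.vert_injective, Set.ncard_coe_finset] at hodd

lemma adj_iff (R : Rep G F) {x y : F.V} :
    G.toSimpleGraph.Adj (R.vertEquiv x) (R.vertEquiv y) ↔ ∃ e, F.Link e x y := by
  constructor
  · rintro ⟨-, e, he⟩
    obtain ⟨a, rfl⟩ := R.exists_edge he.edge_mem
    exact ⟨a, (R.isLink_iff a x y).1 he⟩
  · rintro ⟨e, he⟩
    exact ⟨fun h => he.ne (R.vertEquiv.injective h), R.edge e, (R.isLink_iff e x y).2 he⟩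

lemma isConnected_iff (R : Rep G F) : IsConnected G ↔ F.Conn := by
  rw [IsConnected, SimpleGraph.connected_iff, FinGraph.Conn]
  constructor
  · rintro ⟨hp, ⟨v₀⟩⟩
    refine ⟨⟨R.vertEquiv.symm v₀⟩, fun S ⟨u, hu⟩ hS => eq_univ_of_forall fun v => ?_⟩
    have h := hp (R.vertEquiv u) (R.vertEquiv v)
    rw [SimpleGraph.reachable_iff_reflTransGen] at h
    suffices ∀ w, Relation.ReflTransGen G.toSimpleGraph.Adj (R.vertEquiv u) w →
        R.vertEquiv.symm w ∈ S by simpa using this _ h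
    intro w hw
    induction hw with
    | refl => simpa using hu
    | @tail b c _ hbc ih =>
      obtain ⟨b, rfl⟩ := R.vertEquiv.surjective b
      obtain ⟨c, rfl⟩ := R.vertEquiv.surjective c
      obtain ⟨e, he⟩ := R.adj_iff.1 hbc
      rw [Equiv.symm_apply_apply] at ih ⊢
      by_contra hc
      have : e ∈ F.cut S := he.mem_cut.2 (by simp [ih, hc])
      simp [hS] at this
  · rintro ⟨⟨v₀⟩, h⟩
    refine ⟨fun u v => ?_, ⟨R.vertEquiv v₀⟩⟩
    let S : Finset F.V := univ.filter (fun w => G.toSimpleGraph.Reachable u (R.vertEquiv w))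
    have hS : S = univ := by
      apply h
      · exact ⟨R.vertEquiv.symm u, by simp [S]⟩
      · rw [eq_empty_iff_forall_notMem]
        intro e he
        obtain ⟨x, hx, y, hy, hl⟩ := FinGraph.mem_cut_iff_link.1 he
        simp only [S, mem_filter, mem_univ, true_and] at hx hy
        exact hy (hx.trans (R.adj_iff.2 ⟨e, hl⟩).reachable)
    have : R.vertEquiv.symm v ∈ S := by rw [hS]; exact mem_univ _
    simpa [S] using this

lemma colors_iff (R : Rep G F) (R' : Rep G' F') : Colors G G' ↔ F.Col F' := by
  constructor
  · rintro ⟨f, hf, hf'⟩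
    refine ⟨fun e => R.edgeEquiv.symm (f (R'.edgeEquiv e)), fun v => ?_⟩
    obtain ⟨u, hu, huv⟩ := hf' _ (R'.vert_mem v)
    obtain ⟨u, rfl⟩ := R.exists_vert hu
    refine ⟨u, ?_, ?_⟩
    · intro a ha b hb hab
      by_contra hne
      have h1 := R.edgeEquiv.symm.injective hab
      refine hf (R'.edgeEquiv a) (R'.edgeEquiv b) ⟨fun h => hne (R'.edge_injective h), R'.vert v,
        ?_, ?_⟩ h1
      · exact R'.inc_iff.2 (FinGraph.mem_star.1 ha)
      · exact R'.inc_iff.2 (FinGraph.mem_star.1 hb)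
    · ext e
      simp only [mem_image, FinGraph.mem_star]
      constructor
      · rintro ⟨a, ha, rfl⟩
        have : f (R'.edgeEquiv a) ∈ f '' {e : E(G') | G'.Inc e (R'.vert v)} :=
          Set.mem_image_of_mem _ (R'.inc_iff.2 ha)
        rw [huv] at this
        rw [← R.inc_iff, R.edge_symm]
        exact this
      · intro he
        have : R.edgeEquiv e ∈ {e : E(G) | G.Inc e (R.vert u)} := R.inc_iff.2 he
        rw [← huv] at this
        obtain ⟨a, ha, hae⟩ := this
        refine ⟨R'.edgeEquiv.symm a, ?_, ?_⟩
        · rw [← R'.inc_iff, R'.edge_symm]; exact ha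
        · rw [Equiv.apply_symm_apply, hae, Equiv.symm_apply_apply]
  · rintro ⟨f, hf⟩
    refine ⟨fun e => R.edgeEquiv (f (R'.edgeEquiv.symm e)), ?_, ?_⟩
    · rintro e₁ e₂ ⟨hne, v, h₁, h₂⟩ h
      obtain ⟨v, rfl⟩ := R'.exists_vert h₁.vertex_mem
      rw [← R'.edge_symm, R'.inc_iff] at h₁ h₂
      have h1 := hf.injOn v (FinGraph.mem_star.2 h₁) (FinGraph.mem_star.2 h₂)
        (R.edgeEquiv.injective h)
      exact hne (congrArg Subtype.val (R'.edgeEquiv.symm.injective h1))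
    · intro v hv
      obtain ⟨v, rfl⟩ := R'.exists_vert hv
      obtain ⟨u, -, hu⟩ := hf v
      refine ⟨R.vert u, R.vert_mem u, ?_⟩
      ext e
      obtain ⟨e, rfl⟩ := R.edgeEquiv.surjective e
      rw [Set.mem_ofPred_eq, coe_edgeEquiv, R.inc_iff, ← FinGraph.mem_star, ← hu, mem_image,
        Set.mem_image]
      constructor
      · rintro ⟨a, ha, hae⟩
        refine ⟨R'.edgeEquiv.symm a, ?_, R.edgeEquiv.injective hae⟩
        rw [FinGraph.mem_star, ← R'.inc_iff, R'.edge_symm]; exact ha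
      · rintro ⟨a, ha, rfl⟩
        refine ⟨R'.edgeEquiv a, R'.inc_iff.2 (FinGraph.mem_star.1 ha), ?_⟩
        rw [Equiv.symm_apply_apply]

lemma isomorphic_iff (R : Rep G F) (R' : Rep G' F') : Isomorphic G G' ↔ F.Iso F' := by
  constructor
  · rintro ⟨θ, φ, h⟩
    refine ⟨(R.vertEquiv.trans θ).trans R'.vertEquiv.symm,
      (R.edgeEquiv.trans φ).trans R'.edgeEquiv.symm, fun e x y => ?_⟩
    rw [← R.isLink_iff, ← R'.isLink_iff]
    simp only [Equiv.trans_apply, R'.edge_symm, R'.vert_symm]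
    exact h (R.edgeEquiv e) (R.vertEquiv x) (R.vertEquiv y)
  · rintro ⟨θ, φ, h⟩
    refine ⟨(R.vertEquiv.symm.trans θ).trans R'.vertEquiv,
      (R.edgeEquiv.symm.trans φ).trans R'.edgeEquiv, fun e x y => ?_⟩
    rw [← R.edge_symm e, ← R.vert_symm x, ← R.vert_symm y, R.isLink_iff, h, ← R'.isLink_iff]
    rfl

lemma exists_of_isomorphic (h : Isomorphic G G') (R : Rep G' F) : Nonempty (Rep G F) := by
  obtain ⟨θ, φ, h⟩ := h
  refine ⟨⟨fun v => θ.symm (R.vertEquiv v), fun e => φ.symm (R.edgeEquiv e),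
    Subtype.val_injective.comp (θ.symm.injective.comp R.vertEquiv.injective),
    Subtype.val_injective.comp (φ.symm.injective.comp R.edgeEquiv.injective), ?_, ?_,
    fun e x y => ?_⟩⟩
  · ext x
    constructor
    · rintro ⟨v, rfl⟩; exact Subtype.coe_prop _
    · intro hx
      exact ⟨R.vertEquiv.symm (θ ⟨x, hx⟩), by simp⟩
  · ext x
    constructor
    · rintro ⟨v, rfl⟩; exact Subtype.coe_prop _
    · intro hx
      exact ⟨R.edgeEquiv.symm (φ ⟨x, hx⟩), by simp⟩
  · rw [h, ← R.isLink_iff]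
    simp

/-- The required set consists of the vertices reachable from one end without the edge. -/
lemma isBridge_iff (R : Rep G F) {e : F.E} :
    IsBridge G (R.edge e) ↔ ∃ S, F.cut S = {e} := by
  constructor
  · rintro ⟨x, y, hl, hxy⟩
    obtain ⟨x, rfl⟩ := R.exists_vert hl.left_mem
    obtain ⟨y, rfl⟩ := R.exists_vert hl.right_mem
    let S : Finset F.V := univ.filter (fun w => Relation.ReflTransGen
      (fun a b => ∃ e', e' ≠ R.edge e ∧ G.IsLink e' a b) (R.vert x) (R.vert w))
    refine ⟨S, ?_⟩
    ext e'
    rw [mem_singleton]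
    constructor
    · intro he'
      obtain ⟨a, ha, b, hb, hab⟩ := FinGraph.mem_cut_iff_link.1 he'
      simp only [S, mem_filter, mem_univ, true_and] at ha hb
      by_contra hne
      exact hb (ha.tail ⟨R.edge e', fun h => hne (R.edge_injective h), (R.isLink_iff _ _ _).2 hab⟩)
    · rintro rfl
      refine FinGraph.mem_cut_iff_link.2 ⟨x, ?_, y, ?_, (R.isLink_iff _ _ _).1 hl⟩
      · simp [S, Relation.ReflTransGen.refl]
      · simpa [S] using hxy
  · rintro ⟨S, hS⟩
    have he : e ∈ F.cut S := by simp [hS]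
    obtain ⟨x, hx, y, hy, hl⟩ := FinGraph.mem_cut_iff_link.1 he
    refine ⟨R.vert x, R.vert y, (R.isLink_iff _ _ _).2 hl, fun h => ?_⟩
    suffices ∀ w, Relation.ReflTransGen (fun a b => ∃ e', e' ≠ R.edge e ∧ G.IsLink e' a b)
        (R.vert x) w → w ∈ R.vert '' (S : Set F.V) by
      obtain ⟨z, hz, hzy⟩ := this _ h
      exact hy (R.vert_injective hzy ▸ hz)
    intro w hw
    induction hw with
    | refl => exact ⟨x, hx, rfl⟩
    | @tail b c _ hbc ih =>
      obtain ⟨b, hb, rfl⟩ := ih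
      obtain ⟨e', he', hl'⟩ := hbc
      obtain ⟨e', rfl⟩ := R.exists_edge hl'.edge_mem
      obtain ⟨c, rfl⟩ := R.exists_vert hl'.right_mem
      refine ⟨c, ?_, rfl⟩
      by_contra hc
      have : e' ∈ F.cut S := FinGraph.mem_cut_iff_link.2 ⟨b, hb, c, hc, (R.isLink_iff _ _ _).1 hl'⟩
      rw [hS, mem_singleton] at this
      exact he' (by rw [this])

lemma isBridgeless_iff (R : Rep G F) : IsBridgeless G ↔ ∀ S, #(F.cut S) ≠ 1 := by
  constructor
  · intro h S hS
    obtain ⟨e, he⟩ := card_eq_one.1 hS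
    exact h _ (R.edge_mem e) (R.isBridge_iff.2 ⟨S, he⟩)
  · intro h e he hb
    obtain ⟨e, rfl⟩ := R.exists_edge he
    obtain ⟨S, hS⟩ := R.isBridge_iff.1 hb
    exact h S (by rw [hS, card_singleton])

/-- The bridgeless cubic graphs are the `3`-graphs. -/
lemma isR_three_iff (R : Rep G F) : IsRegular 3 G ∧ IsBridgeless G ↔ F.IsR 3 := by
  rw [R.isRegular_iff, R.isBridgeless_iff]
  constructor
  · rintro ⟨h, hb⟩
    refine ⟨h, fun S hS => ?_⟩
    have h1 := F.sum_star S
    simp only [h, sum_const, smul_eq_mul] at h1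
    have h2 := hb S
    rw [Nat.odd_iff] at hS
    omega
  · intro h
    exact ⟨h.1, h.card_cut_ne_one (by norm_num)⟩

end Rep

/-- The graph presented by a `FinGraph`. -/
def FinGraph.toMultigraph (F : FinGraph) : Multigraph where
  graph :=
    { vertexSet := Set.univ
      IsLink := F.Link
      isLink_symm := fun _ _ => ⟨fun _ _ h => h.symm⟩
      eq_or_eq_of_isLink_of_isLink := fun _ _ _ _ _ h h' => h'.eq_or_eq h.inc_left
      left_mem_of_isLink := fun _ _ _ _ => trivial }
  finite_vertexSet := Set.toFinite _
  finite_edgeSet := Set.toFinite _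
  loopless := ⟨fun _ _ h => FinGraph.Link.ne h rfl⟩

/-- `F` presents its graph. -/
def FinGraph.repToMultigraph (F : FinGraph) : Rep F.toMultigraph.graph F where
  vert := id
  edge := id
  vert_injective := Function.injective_id
  edge_injective := Function.injective_id
  range_vert := Set.range_id
  range_edge := Set.range_id.trans
    (Set.eq_univ_of_forall (s := E(F.toMultigraph.graph)) fun e => ⟨_, _, F.link_s_t e⟩).symm
  isLink_iff _ _ _ := Iff.rfl

lemma Multigraph.exists_rep (M : Multigraph) : ∃ F, Nonempty (Rep M.graph F) := by
  have h : ∀ e : E(M.graph), ∃ p : V(M.graph) × V(M.graph), M.graph.IsLink e p.1 p.2 := by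
    intro e
    obtain ⟨x, y, hl⟩ := Graph.exists_isLink_of_mem_edgeSet e.2
    exact ⟨(⟨x, hl.left_mem⟩, ⟨y, hl.right_mem⟩), hl⟩
  choose p hp using h
  have := M.loopless
  have := M.finite_vertexSet.fintype
  have := M.finite_edgeSet.fintype
  refine ⟨⟨V(M.graph), E(M.graph), fun e => (p e).1, fun e => (p e).2,
    fun e he => (hp e).ne (congrArg Subtype.val he)⟩, ⟨⟨Subtype.val, Subtype.val,
    Subtype.val_injective, Subtype.val_injective, Subtype.range_val, Subtype.range_val, ?_⟩⟩⟩
  intro e x y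
  rw [(hp e).isLink_iff]
  simp only [FinGraph.Link, Subtype.ext_iff]

end RGraphs

/-! ### The Petersen graph as `pet 1`; reduction of the conjecture to connected graphs -/

namespace RGraphs
open Finset

/-- The vertices of the Petersen graph as sets. -/
def petSet (x : Bool × Fin 5) : Finset (Fin 5) :=
  if x.1 then {2 * x.2 + 2, 2 * x.2 + 4} else {2 * x.2, 2 * x.2 + 1}

lemma card_petSet : ∀ x, #(petSet x) = 2 := by decide

lemma petSet_injective : ∀ x y, petSet x = petSet y → x = y := by decide +kernel

lemma exists_petSet : ∀ s : Finset (Fin 5), #s = 2 → ∃ x, petSet x = s := by decide +kernel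

lemma disjoint_petSet_rim : ∀ x : Bool × Fin 5,
    Disjoint (petSet x) (petSet (x.1, rimNext x.1 x.2)) := by decide +kernel

lemma disjoint_petSet_spoke : ∀ i : Fin 5, Disjoint (petSet (false, i)) (petSet (true, i)) := by
  decide +kernel

lemma cases_of_disjoint_petSet : ∀ x y : Bool × Fin 5, Disjoint (petSet x) (petSet y) →
    y = (x.1, rimNext x.1 x.2) ∨ x = (y.1, rimNext y.1 y.2) ∨ x.1 ≠ y.1 ∧ x.2 = y.2 := by
  decide +kernel

lemma rim_unique : ∀ x y : Bool × Fin 5,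
    x = y ∧ (x.1, rimNext x.1 x.2) = (y.1, rimNext y.1 y.2) ∨
      x = (y.1, rimNext y.1 y.2) ∧ (x.1, rimNext x.1 x.2) = y → x = y := by decide +kernel

open scoped Classical

/-- The vertices of the Petersen graph. -/
def petVert (x : (FinGraph.pet 1).V) : {s : Finset (Fin 5) // s.card = 2} :=
  ⟨petSet x, card_petSet x⟩

lemma petVert_injective : Function.Injective petVert := fun x y h =>
  petSet_injective x y (congrArg Subtype.val h)

lemma petVert_surjective : Function.Surjective petVert := fun s =>
  (exists_petSet s.1 s.2).imp fun _ h => Subtype.ext h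

lemma pet_link_iff {e : (FinGraph.pet 1).E} {x y : (FinGraph.pet 1).V} :
    (FinGraph.pet 1).Link e x y ↔
      s(petVert ((FinGraph.pet 1).s e), petVert ((FinGraph.pet 1).t e)) =
        s(petVert x, petVert y) := by
  rw [Sym2.eq_iff]
  simp only [petVert_injective.eq_iff]
  rfl

lemma petersen_adj_iff {x y : (FinGraph.pet 1).V} :
    petersenSimple.Adj (petVert x) (petVert y) ↔ ∃ e, (FinGraph.pet 1).Link e x y := by
  constructor
  · intro h
    rcases cases_of_disjoint_petSet x y h with h | h | ⟨h1, h2⟩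
    · exact ⟨.inl x, Or.inl ⟨rfl, h.symm⟩⟩
    · exact ⟨.inl y, Or.inr ⟨rfl, h.symm⟩⟩
    · refine ⟨.inr (x.2, 0), ?_⟩
      obtain ⟨b, i⟩ := x
      obtain ⟨c, j⟩ := y
      obtain rfl : i = j := h2
      cases b <;> cases c
      · exact absurd rfl h1
      · exact Or.inl ⟨rfl, rfl⟩
      · exact Or.inr ⟨rfl, rfl⟩
      · exact absurd rfl h1
  · rintro ⟨e, he⟩
    have : petersenSimple.Adj (petVert ((FinGraph.pet 1).s e))
        (petVert ((FinGraph.pet 1).t e)) := by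
      rcases e with z | ⟨i, -⟩
      · exact disjoint_petSet_rim z
      · exact disjoint_petSet_spoke i
    rcases he with ⟨rfl, rfl⟩ | ⟨rfl, rfl⟩
    · exact this
    · exact this.symm

lemma pet_link_unique {e e' : (FinGraph.pet 1).E}
    (h : (FinGraph.pet 1).Link e ((FinGraph.pet 1).s e') ((FinGraph.pet 1).t e')) : e = e' := by
  rcases e with x | ⟨i, a⟩ <;> rcases e' with y | ⟨j, b⟩
  · refine congrArg Sum.inl (rim_unique x y ?_)
    exact h.imp id id
  · exfalso
    rcases h with ⟨h1, h2⟩ | ⟨h1, h2⟩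
    · exact Bool.false_ne_true ((congrArg Prod.fst h1).symm.trans (congrArg Prod.fst h2))
    · exact Bool.false_ne_true ((congrArg Prod.fst h2).symm.trans (congrArg Prod.fst h1))
  · exfalso
    rcases h with ⟨h1, h2⟩ | ⟨h1, h2⟩
    · exact Bool.false_ne_true ((congrArg Prod.fst h1).trans (congrArg Prod.fst h2).symm)
    · exact Bool.false_ne_true ((congrArg Prod.fst h1).trans (congrArg Prod.fst h2).symm)
  · have h1 : i = j := by
      rcases h with ⟨h1, -⟩ | ⟨h1, -⟩
      · exact congrArg Prod.snd h1
      · exact congrArg Prod.snd h1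
    rw [h1, Subsingleton.elim a b]

/-- `pet 1` presents the Petersen graph. -/
def repPetersen : Rep petersen.graph (FinGraph.pet 1) where
  vert := petVert
  edge e := s(petVert ((FinGraph.pet 1).s e), petVert ((FinGraph.pet 1).t e))
  vert_injective := petVert_injective
  edge_injective e e' h := pet_link_unique (pet_link_iff.2 h)
  range_vert := petVert_surjective.range_eq
  range_edge := by
    ext z
    induction z using Sym2.ind with | _ x y
    obtain ⟨x, rfl⟩ := petVert_surjective x
    obtain ⟨y, rfl⟩ := petVert_surjective y
    refine Iff.trans ?_ petersen_adj_iff.symm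
    exact exists_congr fun e => pet_link_iff.symm
  isLink_iff e x y := by
    refine Iff.trans ?_ pet_link_iff.symm
    refine ⟨fun h => h.1, fun h => ⟨h, ?_⟩⟩
    exact petersen_adj_iff.2 ⟨e, FinGraph.link_s_t e⟩

namespace FinGraph
variable {G H K : FinGraph} {k : ℕ}

lemma col_of_col_sub {S : Finset G.V} (hS : G.cut S = ∅) (h₁ : K.Col (G.sub S))
    (h₂ : K.Col (G.sub Sᶜ)) : K.Col G := by
  have hS' : G.cut Sᶜ = ∅ := by rw [cut_compl, hS]
  obtain ⟨f₁, hf₁⟩ := h₁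
  obtain ⟨f₂, hf₂⟩ := h₂
  have hex : ∀ e : G.E, ∃ c : K.E, (∀ a, subE S a = e → f₁ a = c) ∧
      ∀ a, subE Sᶜ a = e → f₂ a = c := by
    intro e
    by_cases he : G.s e ∈ S
    · obtain ⟨a, rfl⟩ := exists_subE (mem_of_cut_eq_empty' hS he (inc_s e))
      refine ⟨f₁ a, fun b hb => by rw [subE_injective S hb], fun b hb => ?_⟩
      rw [← hb, ← subV_s] at he
      exact absurd he (mem_compl.1 (subV_mem _))
    · rw [← mem_compl] at he
      obtain ⟨a, rfl⟩ := exists_subE (mem_of_cut_eq_empty' hS' he (inc_s e))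
      refine ⟨f₂ a, fun b hb => ?_, fun b hb => by rw [subE_injective Sᶜ hb]⟩
      rw [← hb, ← subV_s] at he
      exact absurd (subV_mem _) (mem_compl.1 he)
  choose f hf using hex
  have key : ∀ {T : Finset G.V} (_ : G.cut T = ∅) {f' : (G.sub T).E → K.E}
      (_ : IsCol (G.sub T) K f') (_ : ∀ a, f (subE T a) = f' a) (v : G.V) (_ : v ∈ T),
      ∃ u, Set.InjOn f (G.star v) ∧ (G.star v).image f = K.star u := by
    intro T hT f' hf' h v hv
    obtain ⟨v, rfl⟩ := exists_subV hv
    obtain ⟨u, hu, huv⟩ := hf' v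
    refine ⟨u, ?_, ?_⟩
    · rw [← image_sub_star hT]
      intro a ha b hb hab
      obtain ⟨a', ha', rfl⟩ := mem_image.1 (mem_coe.1 ha)
      obtain ⟨b', hb', rfl⟩ := mem_image.1 (mem_coe.1 hb)
      rw [h, h] at hab
      rw [hu ha' hb' hab]
    · rw [← image_sub_star hT, image_image, ← huv]
      exact image_congr fun a _ => h a
  refine ⟨f, fun v => ?_⟩
  by_cases hv : v ∈ S
  · exact key hS hf₁ (fun a => ((hf _).1 a rfl).symm) v hv
  · exact key hS' hf₂ (fun a => ((hf _).2 a rfl).symm) v (mem_compl.2 hv)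

/-- A graph coloring all connected `r`-graphs colors all `r`-graphs. -/
lemma col_of_forall_conn {r : ℕ} (h : ∀ F : FinGraph, F.IsR r → F.Conn → K.Col F)
    (hG : G.IsR r) : K.Col G := by
  generalize hn : Fintype.card G.V = n
  induction n using Nat.strong_induction_on generalizing G with
  | _ n ih =>
    subst hn
    -- The conjecture also speaks of disconnected graphs and of the empty graph, which is colored
    -- vacuously.
    rcases isEmpty_or_nonempty G.V with hV | hV
    · exact ⟨fun e => (hV.false (G.s e)).elim, fun v => (hV.false v).elim⟩
    by_cases hc : G.Conn
    · exact h G hG hc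
    obtain ⟨S, hne, hS, hu⟩ : ∃ S : Finset G.V, S.Nonempty ∧ G.cut S = ∅ ∧ S ≠ univ := by
      by_contra! hcon
      exact hc ⟨hV, hcon⟩
    have hlt := (card_lt_iff_ne_univ S).2 hu
    have hpos := hne.card_pos
    have hS' : G.cut Sᶜ = ∅ := by rw [cut_compl, hS]
    refine col_of_col_sub hS (ih _ ?_ (sub_isR hG hS) rfl) (ih _ ?_ (sub_isR hG hS') rfl)
    · rwa [card_sub_V]
    · rw [card_sub_V, card_compl]; omega

end FinGraph

/-- The Petersen Coloring Conjecture in terms of connected graphs. -/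
lemma petersenColoringConjecture_iff : PetersenColoringConjecture ↔
    ∀ F : FinGraph, F.IsR 3 → F.Conn → (FinGraph.pet 1).Col F := by
  constructor
  · intro h F hF _
    have h1 := F.repToMultigraph.isR_three_iff.2 hF
    exact (repPetersen.colors_iff F.repToMultigraph).1 (h _ h1.1 h1.2)
  · intro h G h1 h2
    obtain ⟨F, ⟨R⟩⟩ := G.exists_rep
    exact (repPetersen.colors_iff R).2
      (FinGraph.col_of_forall_conn h (R.isR_three_iff.1 ⟨h1, h2⟩))

/-! ### The set of rigid classes and the main theorem -/

/-- The classes of the rigid graphs. -/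
def rigidClasses (r : ℕ) : Set IsoClass :=
  {c | ∃ (M : Multigraph) (F : FinGraph), Nonempty (Rep M.graph F) ∧ F.Rigid r ∧ c = isoClass M}

lemma isoClass_eq_iff {M N : Multigraph} : isoClass M = isoClass N ↔ Isomorphic M.graph N.graph :=
  Quotient.eq

lemma exists_of_mem_rigidClasses {r : ℕ} {M : Multigraph} (h : isoClass M ∈ rigidClasses r) :
    ∃ F, Nonempty (Rep M.graph F) ∧ F.Rigid r := by
  obtain ⟨N, F, ⟨R⟩, hF, hMN⟩ := h
  exact ⟨F, Rep.exists_of_isomorphic (isoClass_eq_iff.1 hMN) R, hF⟩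

lemma isConnectedRGraph_iff {r : ℕ} {M : Multigraph} {F : FinGraph} (R : Rep M.graph F) :
    IsConnectedRGraph r M ↔ F.IsR r ∧ F.Conn :=
  and_congr R.isRGraph_iff R.isConnected_iff

/-- `pet k` takes care of all `r`-edge-colorable graphs; the others are colored by a rigid graph of
least order. -/
lemma isComplete_rigidClasses (k : ℕ) (hk : 1 ≤ k) : IsComplete (k + 2) (rigidClasses (k + 2)) := by
  constructor
  · intro G hG
    obtain ⟨F, ⟨R⟩, hF⟩ := exists_of_mem_rigidClasses hG
    exact (isConnectedRGraph_iff R).2 ⟨hF.1, hF.2.1⟩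
  · intro G hG
    obtain ⟨F, ⟨R⟩⟩ := G.exists_rep
    obtain ⟨h1, h2⟩ := (isConnectedRGraph_iff R).1 hG
    obtain ⟨H, hH, hc⟩ : ∃ H : FinGraph, H.Rigid (k + 2) ∧ H.Col F := by
      by_cases h : F.ClassOne (k + 2)
      · exact ⟨FinGraph.pet k, FinGraph.pet_rigid hk,
          h.col h1.1 (FinGraph.card_pet_star (FinGraph.pv k false 0))⟩
      · exact FinGraph.exists_rigid (by omega) h1 h2 h
    exact ⟨H.toMultigraph, ⟨_, H, ⟨H.repToMultigraph⟩, hH, rfl⟩,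
      (H.repToMultigraph.colors_iff R).2 hc⟩

/-- The member of `A` that colors a rigid graph is isomorphic to it. -/
lemma rigidClasses_subset {r : ℕ} {A : Set IsoClass} (hA : IsComplete r A) :
    rigidClasses r ⊆ A := by
  rintro _ ⟨M, F, ⟨R⟩, hF, rfl⟩
  obtain ⟨N, hN, hc⟩ := hA.2 M ((isConnectedRGraph_iff R).2 ⟨hF.1, hF.2.1⟩)
  obtain ⟨F', ⟨R'⟩⟩ := N.exists_rep
  obtain ⟨h1, h2⟩ := (isConnectedRGraph_iff R').1 (hA.1 N hN)
  rwa [isoClass_eq_iff.2 ((R.isomorphic_iff R').2 (hF.2.2 F' h1 h2 ((R'.colors_iff R).1 hc)))]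

lemma isMinimalComplete_iff {r : ℕ} (hr : 3 ≤ r) {A : Set IsoClass} :
    IsMinimalComplete r A ↔ A = rigidClasses r := by
  have hc : IsComplete r (rigidClasses r) := by
    obtain ⟨k, rfl⟩ := Nat.exists_eq_add_of_le' (show 2 ≤ r by omega)
    exact isComplete_rigidClasses k (by omega)
  constructor
  · exact fun h => (h.2 hc (rigidClasses_subset h.1)).antisymm (rigidClasses_subset h.1)
  · rintro rfl
    exact ⟨hc, fun B hB _ => rigidClasses_subset hB⟩

/-- The number of vertices. -/
noncomputable def isoClassCard : IsoClass → ℕ :=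
  Quotient.lift (fun M : Multigraph => Nat.card V(M.graph)) fun _ _ h =>
    Nat.card_congr h.choose

/-- Finitely many rigid classes would have bounded order, but some graph is colored only by larger
connected graphs, one of which is rigid. A graph not colored by `pet k` is not `r`-edge-colorable,
so `exists_rigid` applies. -/
lemma infinite_rigidClasses {k : ℕ} (hk : 1 ≤ k) {G : FinGraph} (hG : G.IsR (k + 2)) (hGc : G.Conn)
    (hpet : ¬ (FinGraph.pet k).Col G) : (rigidClasses (k + 2)).Infinite := by
  intro hfin
  obtain ⟨n, hn⟩ := (hfin.image isoClassCard).bddAbove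
  obtain ⟨F, hF, hFc, hFp, hFn⟩ := FinGraph.exists_forall_le_card hk hG hGc hpet (n + 1)
  obtain ⟨H, hH, hc⟩ := FinGraph.exists_rigid (by omega) hF hFc fun h =>
    hFp (h.col hF.1 (FinGraph.card_pet_star (FinGraph.pv k false 0)))
  have h1 := hFn H hH.1 hH.2.1 hc
  have h2 : isoClassCard (isoClass H.toMultigraph) ≤ n :=
    hn ⟨_, ⟨_, H, ⟨H.repToMultigraph⟩, hH, rfl⟩, rfl⟩
  have h3 : isoClassCard (isoClass H.toMultigraph) = Fintype.card H.V :=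
    (Nat.card_congr H.repToMultigraph.vertEquiv.symm).trans Nat.card_eq_fintype_card
  omega

/-- If the Petersen graph colors all connected `3`-graphs, it colors every rigid one and is
therefore isomorphic to it. The converse is completeness. -/
lemma rigidClasses_three_eq_iff :
    rigidClasses 3 = {isoClass petersen} ↔ PetersenColoringConjecture := by
  rw [petersenColoringConjecture_iff]
  constructor
  · intro h F hF hFc
    have hc := isComplete_rigidClasses 1 le_rfl
    rw [h] at hc
    obtain ⟨M, hM, hcol⟩ :=
      hc.2 F.toMultigraph ((isConnectedRGraph_iff F.repToMultigraph).2 ⟨hF, hFc⟩)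
    obtain ⟨R⟩ := Rep.exists_of_isomorphic (isoClass_eq_iff.1 hM) repPetersen
    exact (R.colors_iff F.repToMultigraph).1 hcol
  · intro h
    ext c
    constructor
    · rintro ⟨M, F, ⟨R⟩, hF, rfl⟩
      have hp := FinGraph.pet_rigid le_rfl (k := 1)
      exact isoClass_eq_iff.2 ((R.isomorphic_iff repPetersen).2
        (hF.2.2 _ hp.1 hp.2.1 (h F hF.1 hF.2.1)))
    · rintro rfl
      exact ⟨_, _, ⟨repPetersen⟩, FinGraph.pet_rigid le_rfl, rfl⟩

end RGraphs

theorem mainTheorem2 :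
    (∀ r : ℕ, 3 ≤ r → ∃! A : Set RGraphs.IsoClass, RGraphs.IsMinimalComplete r A) ∧
    (∀ H₃ : Set RGraphs.IsoClass, RGraphs.IsMinimalComplete 3 H₃ →
      (H₃ = {RGraphs.isoClass RGraphs.petersen} ∨ H₃.Infinite) ∧
      (H₃ = {RGraphs.isoClass RGraphs.petersen} ↔ RGraphs.PetersenColoringConjecture)) ∧
    (∀ r : ℕ, 4 ≤ r → ∀ Hr : Set RGraphs.IsoClass, RGraphs.IsMinimalComplete r Hr →
      Hr.Infinite) := by
  refine ⟨fun r hr => ⟨_, (RGraphs.isMinimalComplete_iff hr).2 rfl,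
    fun A hA => (RGraphs.isMinimalComplete_iff hr).1 hA⟩, fun A hA => ?_, fun r hr A hA => ?_⟩
  · rw [(RGraphs.isMinimalComplete_iff le_rfl).1 hA]
    refine ⟨?_, RGraphs.rigidClasses_three_eq_iff⟩
    rw [RGraphs.rigidClasses_three_eq_iff, RGraphs.petersenColoringConjecture_iff]
    by_contra! h
    obtain ⟨⟨F, hF, hFc, hFp⟩, hfin⟩ := h
    exact RGraphs.infinite_rigidClasses le_rfl hF hFc hFp hfin
  · obtain ⟨k, rfl⟩ := Nat.exists_eq_add_of_le' (show 2 ≤ r by omega)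
    have hk : 1 ≤ k := by omega
    rw [(RGraphs.isMinimalComplete_iff (by omega)).1 hA]
    exact RGraphs.infinite_rigidClasses hk
      (RGraphs.FinGraph.subst_isR hk (RGraphs.FinGraph.pet_isR hk))
      (RGraphs.FinGraph.subst_conn hk (RGraphs.FinGraph.pet_conn hk))
      (RGraphs.FinGraph.not_pet_col_subst_pet (by omega))
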